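/- Let $\mathfrak n$ be a real two-step Lie algebra with a basis $Z_1,\dots,Z_{n-2d},Y_1,\dots,Y_d,X_1,\dots,X_d$ ($d\ge 1$) such that $Z_1,\dots,Z_{n-2d}$ span the center $\mathfrak z$ of $\mathfrak n$, $[Y_i,Y_j]=0=[X_i,X_j]$ for all $i,j$, and for some linear functional $\ell$ on $\mathfrak n$ the radical $\{W:\ell[W,V]=0\ \forall V\}$ equals $\mathfrak z$. Let $N$ be the connected, simply connected Lie group with Lie algebra $\mathfrak n$, in the coordinates $\exp(\sum z_jZ_j)\exp(\sum y_jY_j)\exp(\sum x_jX_j)$, with Haar measure $dz\,dy\,dx$, and let $L$ be its left regular representation, $(L(g)f)(h)=f(g^{-1}h)$. For $\lambda\in\mathbb R^{n-2d}=\mathfrak z^*$ (extended by $0$ on the $Y_j,X_j$) let $B(\lambda)=(-\lambda[X_i,Y_j])_{1\le i,j\le d}$, $\Sigma=\{\lambda:\det B(\lambda)\ne0\}$, $d\mu(\lambda)=|\det B(\lambda)|\,d\lambda$, and let $\pi_\lambda$ be the representation of $N$ on $L^2(\mathbb R^d)$ given by $$\pi_\lambda\Big(e^{\sum z_jZ_j}e^{\sum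 y_jY_j}e^{\sum x_jX_j}\Big)F(t)=e^{2\pi i\langle\lambda,z\rangle}e^{2\pi i\langle t,B(\lambda)y\rangle}F(t-x).$$ Let $\mathcal P:L^2(N)\to\int_\Sigma^\oplus L^2(\mathbb R^d)\otimes L^2(\mathbb R^d)\,d\mu(\lambda)$ be the Plancherel transform, that is, the continuous extension of $f\mapsto\big(\int_N f(g)\pi_\lambda(g)\,dg\big)_\lambda$ from $L^1(N)\cap L^2(N)$, the fibres being the Hilbert-Schmidt operators on $L^2(\mathbb R^d)$. Let $a\in(0,\infty)^{n-2d}$ and $q,b\in(0,\infty)^d$ satisfy $b_1\cdots b_d\,q_1\cdots q_d\,a_1\cdots a_{n-2d}=1$, and let $$\Gamma_{a,q,b}=\Big\{\prod_j\exp\big(\tfrac{m_j}{a_j}Z_j\big)\prod_j\exp\big(\tfrac{k_j}{q_j}Y_j\big)\prod_j\exp\big(\tfrac{n_j}{b_j}X_j\big): m_j,k_j,n_j\in\mathbb Z\Big\}.$$ Let $\mathbf I\subseteq\{\lambda\in\Sigma:0\le\lambda_i\le a_i\text{ for all }i\}$ be measurable, let $$\mathbf S=\Big\{\lambda\in\mathbf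 I:\frac{|\det B(\lambda)|}{b_1\cdots b_d\,q_1\cdots q_d}\le1\Big\},$$ let $(\mathbf u(\lambda))_{\lambda\in\mathbf S}$ be a measurable field of unit vectors in $L^2(\mathbb R^d)$ (for instance a constant one), and let $\mathcal H=\mathcal P^{-1}\big(\int_{\mathbf S}^\oplus L^2(\mathbb R^d)\otimes\mathbf u(\lambda)\,d\mu(\lambda)\big)$ be the corresponding multiplicity-free band-limited subspace of $L^2(N)$. Then there is $\phi\in\mathcal H$ such that: 1. $\phi$ is a continuous wavelet (admissible vector) for $L|_{\mathcal H}$: the map $\psi\mapsto\big(g\mapsto\langle\psi,L(g)\phi\rangle\big)$ is an isometry of $\mathcal H$ into $L^2(N)$; 2. the map $\psi\mapsto(\langle\psi,L(\gamma)\phi\rangle)_{\gamma\in\Gamma_{a,q,b}}$ is a linear isometric embedding of $\mathcal H$ into $\ell^2(\Gamma_{a,q,b})$; 3. if $\mu(\mathbf S)=1$, then $\{L(\gamma)\phi\}_{\gamma\in\Gamma_{a,q,b}}$ is an orthonormal basis of $\mathcal H$. -/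

import Mathlib

open MeasureTheory
open scoped ENNReal

noncomputable section

namespace BandLimited

/-- A real Lie algebra `𝔫` in the class under study, presented with a basis
`Z₁, …, Z_m, Y₁, …, Y_d, X₁, …, X_d` (so `dim 𝔫 = n = m + 2d`): `Z₁, …, Z_m` span the center,
`𝔫` is two-step, `𝔭 = span (Z, Y)` and `𝔪 = span X` are commutative, and for some (equivalently,
generic) linear functional `ℓ` the radical `𝔫(ℓ) = {W : ℓ [W, V] = 0 for all V}` is the center. -/
structure AdaptedBasis (𝔫 : Type*) [LieRing 𝔫] [LieAlgebra ℝ 𝔫] (m d : ℕ) where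
  basis : Module.Basis (Fin m ⊕ Fin d ⊕ Fin d) ℝ 𝔫
  center_eq : (LieAlgebra.center ℝ 𝔫).toSubmodule
    = Submodule.span ℝ (Set.range fun j : Fin m => basis (Sum.inl j))
  two_step : ∀ U V : 𝔫, ⁅U, V⁆ ∈ LieAlgebra.center ℝ 𝔫
  lie_Y_Y : ∀ i j : Fin d, ⁅basis (Sum.inr (Sum.inl i)), basis (Sum.inr (Sum.inl j))⁆ = 0
  lie_X_X : ∀ i j : Fin d, ⁅basis (Sum.inr (Sum.inr i)), basis (Sum.inr (Sum.inr j))⁆ = 0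
  radical_eq_center : ∃ ℓ : Module.Dual ℝ 𝔫,
    ∀ W : 𝔫, (∀ V : 𝔫, ℓ ⁅W, V⁆ = 0) ↔ W ∈ LieAlgebra.center ℝ 𝔫

variable {𝔫 : Type*} [LieRing 𝔫] [LieAlgebra ℝ 𝔫] {m d : ℕ}

namespace AdaptedBasis

variable (β : AdaptedBasis 𝔫 m d)

def Z (j : Fin m) : 𝔫 := β.basis (Sum.inl j)
def Y (j : Fin d) : 𝔫 := β.basis (Sum.inr (Sum.inl j))
def X (j : Fin d) : 𝔫 := β.basis (Sum.inr (Sum.inr j))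

/-- The linear functional `(lam₁, …, lam_m, 0, …, 0)` on `𝔫`, in the dual basis. -/
def functional (lam : Fin m → ℝ) : Module.Dual ℝ 𝔫 :=
  ∑ j, lam j • β.basis.coord (Sum.inl j)

/-- The matrix `B(lam)`, with entries `- lam [X_i, Y_j]`. -/
def B (lam : Fin m → ℝ) : Matrix (Fin d) (Fin d) ℝ :=
  Matrix.of fun i j => - β.functional lam ⁅β.X i, β.Y j⁆

/-- The cross-section `Σ` of the generic coadjoint orbits, inside `𝔷(𝔫)^* = ℝ^m`. -/
def crossSection : Set (Fin m → ℝ) := {lam | (β.B lam).det ≠ 0}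

/-- The Plancherel measure `dμ(lam) = |det B(lam)| dlam` (the complement of `Σ` is null). -/
def plancherelMeasure : Measure (Fin m → ℝ) :=
  volume.withDensity fun lam => ENNReal.ofReal |(β.B lam).det|

/-- The structure constants: `[X_i, Y_j] = ∑ k, structConst i j k • Z_k`. -/
def structConst (i j : Fin d) (k : Fin m) : ℝ :=
  β.basis.repr ⁅β.X i, β.Y j⁆ (Sum.inl k)

/-- The coordinates in the center of `[∑ x_i X_i, ∑ y_j Y_j]`. -/
def bracket (x y : Fin d → ℝ) : Fin m → ℝ :=
  fun k => ∑ i, ∑ j, x i * y j * β.structConst i j k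

/-- The simply connected Lie group `N` with Lie algebra `𝔫`, in the global coordinates
`(z, y, x) ↦ exp (∑ z_j Z_j) exp (∑ y_j Y_j) exp (∑ x_j X_j)`. See `log_mul` and
`log_bijective` below. -/
def N (_β : AdaptedBasis 𝔫 m d) : Type := (Fin m → ℝ) × (Fin d → ℝ) × (Fin d → ℝ)

end AdaptedBasis

open AdaptedBasis

namespace N

variable {β : AdaptedBasis 𝔫 m d}

/-- The group element `exp (∑ z_j Z_j) exp (∑ y_j Y_j) exp (∑ x_j X_j)`. -/
def mk (z : Fin m → ℝ) (y x : Fin d → ℝ) : β.N := (z, y, x)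

def zc (g : β.N) : Fin m → ℝ := g.1
def yc (g : β.N) : Fin d → ℝ := g.2.1
def xc (g : β.N) : Fin d → ℝ := g.2.2

@[ext] theorem ext {g h : β.N} (hz : zc g = zc h) (hy : yc g = yc h) (hx : xc g = xc h) : g = h :=
  Prod.ext hz (Prod.ext hy hx)

/-- Haar measure on `N`: Lebesgue measure `dz dy dx` in the coordinates. -/
instance : MeasureSpace β.N :=
  inferInstanceAs (MeasureSpace ((Fin m → ℝ) × (Fin d → ℝ) × (Fin d → ℝ)))

theorem bracket_add_left (x x' y : Fin d → ℝ) :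
    β.bracket (x + x') y = β.bracket x y + β.bracket x' y := by
  ext k; simp [bracket, add_mul, Finset.sum_add_distrib]

theorem bracket_add_right (x y y' : Fin d → ℝ) :
    β.bracket x (y + y') = β.bracket x y + β.bracket x y' := by
  ext k; simp [bracket, add_mul, mul_add, Finset.sum_add_distrib]

theorem bracket_neg_left (x y : Fin d → ℝ) : β.bracket (-x) y = - β.bracket x y := by
  ext k; simp [bracket]

theorem bracket_zero_left (y : Fin d → ℝ) : β.bracket 0 y = 0 := by
  ext k; simp [bracket]

theorem bracket_zero_right (x : Fin d → ℝ) : β.bracket x 0 = 0 := by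
  ext k; simp [bracket]

instance : Mul β.N :=
  ⟨fun g h => mk (zc g + zc h + β.bracket (xc g) (yc h)) (yc g + yc h) (xc g + xc h)⟩

instance : One β.N := ⟨mk 0 0 0⟩

instance : Inv β.N :=
  ⟨fun g => mk (- zc g + β.bracket (xc g) (yc g)) (- yc g) (- xc g)⟩

@[simp] theorem zc_mk (z : Fin m → ℝ) (y x : Fin d → ℝ) : zc (mk z y x : β.N) = z := rfl
@[simp] theorem yc_mk (z : Fin m → ℝ) (y x : Fin d → ℝ) : yc (mk z y x : β.N) = y := rfl
@[simp] theorem xc_mk (z : Fin m → ℝ) (y x : Fin d → ℝ) : xc (mk z y x : β.N) = x := rfl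
@[simp] theorem zc_mul (g h : β.N) : zc (g * h) = zc g + zc h + β.bracket (xc g) (yc h) := rfl
@[simp] theorem yc_mul (g h : β.N) : yc (g * h) = yc g + yc h := rfl
@[simp] theorem xc_mul (g h : β.N) : xc (g * h) = xc g + xc h := rfl
@[simp] theorem zc_one : zc (1 : β.N) = 0 := rfl
@[simp] theorem yc_one : yc (1 : β.N) = 0 := rfl
@[simp] theorem xc_one : xc (1 : β.N) = 0 := rfl
@[simp] theorem zc_inv (g : β.N) : zc g⁻¹ = - zc g + β.bracket (xc g) (yc g) := rfl
@[simp] theorem yc_inv (g : β.N) : yc g⁻¹ = - yc g := rfl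
@[simp] theorem xc_inv (g : β.N) : xc g⁻¹ = - xc g := rfl

instance : Group β.N :=
  Group.ofLeftAxioms
    (fun a b c => by
      apply ext
      · simp only [zc_mul, yc_mul, xc_mul, bracket_add_left, bracket_add_right]; abel
      · simp only [yc_mul]; abel
      · simp only [xc_mul]; abel)
    (fun a => by apply ext <;> simp [bracket_zero_left])
    (fun a => by apply ext <;> simp [bracket_neg_left])

/-- The logarithm `N → 𝔫`; by the Baker-Campbell-Hausdorff formula in a two-step algebra,
`log (exp z exp y exp x) = z + y + x + ½ [y, x]`. -/
def log (g : β.N) : 𝔫 :=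
  ∑ j, zc g j • β.Z j + ∑ j, yc g j • β.Y j + ∑ j, xc g j • β.X j
    + (1 / 2 : ℝ) • ⁅∑ j, yc g j • β.Y j, ∑ j, xc g j • β.X j⁆

theorem lie_sum_X_sum_Y (x y : Fin d → ℝ) :
    ⁅∑ i, x i • β.X i, ∑ j, y j • β.Y j⁆ = ∑ k, β.bracket x y k • β.Z k := by
  have key : ∀ i j, ⁅β.X i, β.Y j⁆ = ∑ k, β.structConst i j k • β.Z k := by
    intro i j
    have hmem : ⁅β.X i, β.Y j⁆ ∈ Submodule.span ℝ (Set.range fun k : Fin m => β.basis (Sum.inl k)) :=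
      β.center_eq ▸ β.two_step _ _
    obtain ⟨c, hc⟩ := (Submodule.mem_span_range_iff_exists_fun ℝ).1 hmem
    have hk : ∀ k, β.structConst i j k = c k := by
      intro k
      unfold structConst
      rw [← hc]
      simp [Finsupp.single_apply]
    simp only [hk, Z, hc]
  simp only [sum_lie, lie_sum, lie_smul, smul_lie, key, bracket,
    Finset.sum_smul, Finset.smul_sum, smul_smul]
  symm
  conv_rhs => rw [Finset.sum_comm]
  rw [Finset.sum_comm]
  refine Finset.sum_congr rfl fun i _ => ?_
  rw [Finset.sum_comm]
  refine Finset.sum_congr rfl fun j _ => Finset.sum_congr rfl fun k _ => ?_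
  congr 1
  ring

/-- The group law of `N` is the Baker-Campbell-Hausdorff product of the two-step algebra `𝔫`. -/
theorem log_mul (g h : β.N) :
    log (g * h) = log g + log h + (1 / 2 : ℝ) • ⁅log g, log h⁆ := by
  have hc : ∀ U V W : 𝔫, ⁅⁅U, V⁆, W⁆ = 0 := by
    intro U V W
    rw [← lie_skew, (LieModule.mem_maxTrivSubmodule ℝ 𝔫 𝔫 _).1 (β.two_step U V) W, neg_zero]
  have hc' : ∀ U V W : 𝔫, ⁅W, ⁅U, V⁆⁆ = 0 := fun U V W =>
    (LieModule.mem_maxTrivSubmodule ℝ 𝔫 𝔫 _).1 (β.two_step U V) W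
  have hZ : ∀ (z : Fin m → ℝ) (W : 𝔫), ⁅W, ∑ j, z j • β.Z j⁆ = 0 := by
    intro z W
    have : ∀ j, ⁅W, β.Z j⁆ = 0 := fun j =>
      (LieModule.mem_maxTrivSubmodule ℝ 𝔫 𝔫 _).1
        (show β.Z j ∈ (LieAlgebra.center ℝ 𝔫).toSubmodule from
          β.center_eq ▸ Submodule.subset_span ⟨j, rfl⟩) W
    simp [lie_sum, this]
  have hZ' : ∀ (z : Fin m → ℝ) (W : 𝔫), ⁅∑ j, z j • β.Z j, W⁆ = 0 := fun z W => by
    rw [← lie_skew, hZ, neg_zero]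
  have hY : ∀ y y' : Fin d → ℝ, ⁅∑ j, y j • β.Y j, ∑ j, y' j • β.Y j⁆ = 0 := by
    intro y y'
    simp [lie_sum, sum_lie, Y, β.lie_Y_Y]
  have hX : ∀ y y' : Fin d → ℝ, ⁅∑ j, y j • β.X j, ∑ j, y' j • β.X j⁆ = 0 := by
    intro y y'
    simp [lie_sum, sum_lie, X, β.lie_X_X]
  unfold log
  simp only [zc_mul, yc_mul, xc_mul, Pi.add_apply, add_smul, Finset.sum_add_distrib]
  rw [← lie_sum_X_sum_Y]
  simp only [lie_add, add_lie, hZ, hZ', hX, hY, lie_smul, smul_lie, hc, hc', smul_zero, add_zero,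
    zero_add]
  rw [← lie_skew (∑ j, yc h j • β.Y j) (∑ j, xc g j • β.X j)]
  module

theorem log_bijective : Function.Bijective (log : β.N → 𝔫) := by
  have hlog : ∀ g : β.N, log g = β.basis.equivFun.symm
      (Sum.elim (zc g - (1 / 2 : ℝ) • β.bracket (xc g) (yc g)) (Sum.elim (yc g) (xc g))) := by
    intro g
    unfold log
    rw [← lie_skew, lie_sum_X_sum_Y, Module.Basis.equivFun_symm_apply]
    simp only [Fintype.sum_sum_type, Sum.elim_inl, Sum.elim_inr, Pi.sub_apply, Pi.smul_apply,
      sub_smul, Finset.sum_sub_distrib, smul_assoc, ← Finset.smul_sum, Z, Y, X]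
    module
  constructor
  · intro g h hgh
    rw [hlog, hlog] at hgh
    have h1 := β.basis.equivFun.symm.injective hgh
    have hy : yc g = yc h := funext fun j => congrFun h1 (Sum.inr (Sum.inl j))
    have hx : xc g = xc h := funext fun j => congrFun h1 (Sum.inr (Sum.inr j))
    have hz : zc g = zc h := funext fun j => by
      have := congrFun h1 (Sum.inl j)
      simpa [hx, hy] using this
    exact ext hz hy hx
  · intro V
    obtain ⟨w, rfl⟩ := β.basis.equivFun.symm.surjective V
    refine ⟨mk ((fun j => w (Sum.inl j)) + (1 / 2 : ℝ) • β.bracket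
      (fun j => w (Sum.inr (Sum.inr j))) (fun j => w (Sum.inr (Sum.inl j))))
      (fun j => w (Sum.inr (Sum.inl j))) (fun j => w (Sum.inr (Sum.inr j))), ?_⟩
    rw [hlog]
    congr 1
    ext j
    rcases j with j | j | j <;> simp

theorem measurePreserving_mul_left (g : β.N) : MeasurePreserving (fun h : β.N => g * h) := by
  have h1 : MeasurePreserving (fun p : (Fin d → ℝ) × (Fin d → ℝ) => (yc g + p.1, xc g + p.2))
      (volume.prod volume) (volume.prod volume) :=
    (measurePreserving_add_left volume (yc g)).prod (measurePreserving_add_left volume (xc g))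
  have hcont : Continuous fun y : Fin d → ℝ => β.bracket (xc g) y := by
    unfold bracket; fun_prop
  have h2 : MeasurePreserving
      (fun p : ((Fin d → ℝ) × (Fin d → ℝ)) × (Fin m → ℝ) =>
        ((yc g + p.1.1, xc g + p.1.2), (zc g + β.bracket (xc g) p.1.1) + p.2))
      ((volume.prod volume).prod volume) ((volume.prod volume).prod volume) := by
    refine h1.skew_product
      (g := fun (p : (Fin d → ℝ) × (Fin d → ℝ)) (z : Fin m → ℝ) =>
        (zc g + β.bracket (xc g) p.1) + z) ?_ ?_
    · apply Continuous.measurable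
      have := hcont
      simp only [Function.uncurry_def]
      fun_prop
    · exact Filter.Eventually.of_forall fun p => (measurePreserving_add_left volume _).map_eq
  have h3 := (Measure.measurePreserving_swap.comp h2).comp
    (Measure.measurePreserving_swap (μ := (volume : Measure (Fin m → ℝ)))
      (ν := (volume : Measure (Fin d → ℝ)).prod (volume : Measure (Fin d → ℝ))))
  have h4 : (fun h : β.N => g * h) =
      ((Prod.swap ∘ fun p : ((Fin d → ℝ) × (Fin d → ℝ)) × (Fin m → ℝ) =>
        ((yc g + p.1.1, xc g + p.1.2), (zc g + β.bracket (xc g) p.1.1) + p.2)) ∘ Prod.swap) := by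
    funext h
    apply ext
    · change zc g + zc h + β.bracket (xc g) (yc h) = zc g + β.bracket (xc g) (yc h) + zc h
      abel
    · rfl
    · rfl
  rw [h4]
  exact h3

end N

/-- `L²(ℝ^d)`. -/
abbrev L2R (d : ℕ) : Type := Lp ℂ 2 (volume : Measure (Fin d → ℝ))

namespace AdaptedBasis

variable (β : AdaptedBasis 𝔫 m d)

/-- `L²(N)`. -/
abbrev L2N : Type := Lp ℂ 2 (volume : Measure β.N)

/-- The left regular representation, `(L(g) f)(h) = f(g⁻¹ h)`. -/
def leftReg (g : β.N) : β.L2N →ₗᵢ[ℂ] β.L2N :=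
  Lp.compMeasurePreservingₗᵢ ℂ (fun h => g⁻¹ * h) (N.measurePreserving_mul_left g⁻¹)

/-- The phase `exp (2πi (⟨lam, z⟩ + ⟨t, B(lam) y⟩))`. -/
def phase (lam : Fin m → ℝ) (g : β.N) (t : Fin d → ℝ) : ℂ :=
  Complex.exp (2 * Real.pi * Complex.I *
    ((lam ⬝ᵥ N.zc g + t ⬝ᵥ (β.B lam).mulVec (N.yc g) : ℝ) : ℂ))

theorem memLp_rep (lam : Fin m → ℝ) (g : β.N) (v : L2R d) :
    MemLp (fun t => β.phase lam g t * v (t - N.xc g)) 2 volume := by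
  have h1 : MemLp (fun t => v (t - N.xc g)) 2 volume :=
    (Lp.memLp v).comp_measurePreserving (measurePreserving_sub_right volume (N.xc g))
  have h2 : Continuous (β.phase lam g) := by
    unfold phase Matrix.mulVec dotProduct; fun_prop
  refine h1.of_le (h2.aestronglyMeasurable.mul h1.aestronglyMeasurable) ?_
  refine Filter.Eventually.of_forall fun t => ?_
  have h3 : ‖β.phase lam g t‖ = 1 := by
    unfold phase
    rw [show ∀ r : ℝ, 2 * Real.pi * Complex.I * (r : ℂ) = ((2 * Real.pi * r : ℝ) : ℂ) * Complex.I
      from fun r => by push_cast; ring]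
    exact Complex.norm_exp_ofReal_mul_I _
  simp [h3]

/-- The irreducible representation `π_lam` induced from the character
`exp W ↦ exp (2πi lam(W))` of `exp 𝔭`, realized on `L²(ℝ^d)`: the center acts by the character,
the `Y`-directions by modulations and the `X`-directions by translations. -/
def rep (lam : Fin m → ℝ) (g : β.N) (v : L2R d) : L2R d :=
  (β.memLp_rep lam g v).toLp

/-- The operator-valued Fourier transform `F(f)(lam) = ∫_N f(g) π_lam(g) dg`. -/
def fourier (f : β.N → ℂ) (lam : Fin m → ℝ) (v : L2R d) : L2R d :=
  ∫ g : β.N, f g • β.rep lam g v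

/-- The direct integral `∫_Σ^⊕ L²(ℝ^d) ⊗ L²(ℝ^d) dμ(lam)`; the fibre is the space of
Hilbert-Schmidt operators on `L²(ℝ^d)`, given by their kernels in `L²(ℝ^d × ℝ^d)`. -/
abbrev HSField : Type :=
  Lp ℂ 2 (β.plancherelMeasure.prod (volume : Measure ((Fin d → ℝ) × (Fin d → ℝ))))

/-- The operator `T` on `L²(ℝ^d)` is the integral operator with kernel `k`. -/
def HasKernel (T : L2R d → L2R d) (k : (Fin d → ℝ) × (Fin d → ℝ) → ℂ) : Prop :=
  ∀ v : L2R d, (T v : (Fin d → ℝ) → ℂ) =ᵐ[volume] fun t => ∫ s, k (t, s) * v s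

/-- `K` is the Plancherel transform of `f`. The Plancherel transform is the continuous extension
to `L²(N)` of the Fourier transform on `L¹(N) ∩ L²(N)`: its graph is the closure of the graph of
the latter. -/
def IsPlancherelTransform (f : β.L2N) (K : β.HSField) : Prop :=
  (f, K) ∈ closure {p : β.L2N × β.HSField | Integrable (p.1 : β.N → ℂ) ∧
    ∀ᵐ lam ∂β.plancherelMeasure, HasKernel (β.fourier p.1 lam) fun ts => p.2 (lam, ts)}

/-- `K` lies in `∫_S^⊕ L²(ℝ^d) ⊗ u(lam) dμ(lam)`. The operator `w ⊗ u` has the kernel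
`(t, s) ↦ w(t) * conj (u(s))`. -/
def MemMultiplicityFree (S : Set (Fin m → ℝ)) (u : (Fin m → ℝ) → L2R d) (K : β.HSField) : Prop :=
  ∀ᵐ lam ∂β.plancherelMeasure,
    (lam ∈ S → ∃ w : L2R d, (fun ts => K (lam, ts)) =ᵐ[volume]
      fun ts : (Fin d → ℝ) × (Fin d → ℝ) => w ts.1 * (starRingEnd ℂ) (u lam ts.2)) ∧
    (lam ∉ S → (fun ts => K (lam, ts)) =ᵐ[volume] 0)

/-- `φ ∈ H` is admissible (a continuous wavelet) for the restriction of `L` to `H`: the map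
`ψ ↦ (g ↦ ⟨ψ, L(g) φ⟩)` is an isometry of `H` into `L²(N)`. -/
def IsContinuousWavelet (H : Submodule ℂ β.L2N) (φ : β.L2N) : Prop :=
  φ ∈ H ∧ ∃ W : H →ₗᵢ[ℂ] β.L2N, ∀ ψ : H,
    (W ψ : β.N → ℂ) =ᵐ[volume] fun g => inner ℂ (β.leftReg g φ) (ψ : β.L2N)

/-- The quasi-lattice `Γ_{a,q,b}` of the elements
`∏ exp ((k_j / a_j) Z_j) ∏ exp ((l_j / q_j) Y_j) ∏ exp ((p_j / b_j) X_j)` with integers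
`k_j, l_j, p_j`. -/
def quasiLattice (a : Fin m → ℝ) (q b : Fin d → ℝ) : Set β.N :=
  {g | ∃ (k : Fin m → ℤ) (l p : Fin d → ℤ),
    g = N.mk (fun j => k j / a j) (fun j => l j / q j) (fun j => p j / b j)}

end AdaptedBasis

end BandLimited

end

open BandLimited


namespace BandLimited

open Filter Topology
open scoped Pointwise Matrix

/-!
Read `f ∈ L²(N)` as a function of the coordinates `(x, z, y)`. A partial Fourier transform in
`(z, y)` followed by the change of variables `(lam, t, s) ↦ (t - s, lam, B(lam)ᵀ t)` is unitary,
and its value at `lam` is the integral kernel of `π_lam(f)`: this is the Plancherel transform, and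
it identifies the multiplicity-free band-limited space with `L²(S × ℝᵈ, μ ⊗ dt)` through
`V ↦ (V(lam, ·) ⊗ conj u(lam))_lam`.

For a window `v(lam)`, the coefficient of `V ⊗ conj u` along `L(g)(v ⊗ conj u)` is, up to
conjugation, the Fourier transform in `(lam, t)` of `V · conj v(· - x)` at the coordinates of `g`.
Plancherel in `(lam, t)` makes every unit field `v` admissible. For the discrete statement take
`v(lam)` to be a normalized indicator of a set that tiles `ℝᵈ` under `∏ (1 / b_j) ℤ` and packs under
the lattice dual to the modulations by `B(lam) (k / q)`. Such a set exists exactly when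
`|det B(lam)| ≤ ∏ b_j ∏ q_j`, and can be chosen measurably in `lam`. The coefficients along `Γ`
are then Fourier coefficients of functions supported in a packing set, so Parseval sums them to the
norm, and a Parseval frame of unit vectors is an orthonormal basis.
-/

section SquareIntegrable

variable {α T E : Type*} [MeasurableSpace α] [MeasurableSpace T] [NormedAddCommGroup E]
  {μ : Measure α}

instance fact_two_ne_top : Fact ((2 : ℝ≥0∞) ≠ ∞) := ⟨ENNReal.ofNat_ne_top⟩

theorem eLpNorm_two_sq (μ : Measure α) (f : α → E) :
    eLpNorm f 2 μ ^ 2 = ∫⁻ x, ‖f x‖ₑ ^ 2 ∂μ := by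
  have h := eLpNorm_nnreal_pow_eq_lintegral (f := f) (μ := μ) (p := 2) two_ne_zero
  rw [show ((2 : NNReal) : ℝ) = ((2 : ℕ) : ℝ) by norm_num] at h
  simp only [ENNReal.rpow_natCast] at h
  exact h

theorem lintegral_enorm_sq_coeFn (f : Lp E 2 μ) : ∫⁻ x, ‖f x‖ₑ ^ 2 ∂μ = ‖f‖ₑ ^ 2 := by
  rw [← eLpNorm_two_sq, Lp.enorm_def]

theorem enorm_sq_toLp {f : α → E} (hf : MemLp f 2 μ) :
    ‖hf.toLp‖ₑ ^ 2 = ∫⁻ x, ‖f x‖ₑ ^ 2 ∂μ := by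
  rw [Lp.enorm_toLp, eLpNorm_two_sq]

theorem memLp_two_iff_lintegral_enorm_sq {f : α → E} (hf : AEStronglyMeasurable f μ) :
    MemLp f 2 μ ↔ ∫⁻ x, ‖f x‖ₑ ^ 2 ∂μ < ∞ := by
  rw [← eLpNorm_two_sq, MemLp, ENNReal.pow_lt_top_iff]
  simp [hf]

theorem norm_eq_of_enorm_sq_eq {F : Type*} [NormedAddCommGroup F] {x : E} {y : F}
    (h : ‖x‖ₑ ^ 2 = ‖y‖ₑ ^ 2) : ‖x‖ = ‖y‖ := by
  have h' : ‖x‖ₑ = ‖y‖ₑ := (ENNReal.pow_right_strictMono two_ne_zero).injective h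
  simpa [← toReal_enorm] using congrArg ENNReal.toReal h'

theorem stronglyMeasurable_of_measurable_dist {F : Type*} [PseudoMetricSpace F]
    [SecondCountableTopology F] {f : α → F} (h : ∀ y, Measurable fun a => dist (f a) y) :
    StronglyMeasurable f := by
  borelize F
  refine (measurable_of_isClosed' fun C hC hne _ => ?_).stronglyMeasurable
  obtain ⟨D, hDC, hD, hCD⟩ :=
    (TopologicalSpace.IsSeparable.of_separableSpace C).exists_countable_dense_subset
  have : Countable D := hD
  have hinf (x : F) : Metric.infDist x C = ⨅ y : D, dist x y := by
    rw [← Metric.infDist_eq_iInf, ← Metric.infDist_closure (s := D),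
      (closure_minimal hDC hC).antisymm hCD]
  have hpre : f ⁻¹' C = {a | ⨅ y : D, dist (f a) y = 0} := by
    ext a
    rw [Set.mem_preimage, hC.mem_iff_infDist_zero hne, hinf, Set.mem_ofPred_eq]
  rw [hpre]
  exact measurableSet_eq_fun (.iInf fun y => h y) measurable_const

theorem dist_toLp_eq {f : α → E} (hf : MemLp f 2 μ) (g : Lp E 2 μ) :
    dist hf.toLp g = ((∫⁻ x, ‖f x - g x‖ₑ ^ 2 ∂μ) ^ (1 / 2 : ℝ)).toReal := by
  rw [← eLpNorm_two_sq, dist_edist, ← ENNReal.rpow_natCast, ← ENNReal.rpow_mul, Lp.edist_def]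
  norm_num
  congr 1
  refine eLpNorm_congr_ae ?_
  filter_upwards [hf.coeFn_toLp] with x hx
  simp [hx]

end SquareIntegrable

section Slice

variable {α T E : Type*} [MeasurableSpace α] [MeasurableSpace T] [NormedAddCommGroup E]
  {μ : Measure α} {ν : Measure T}

theorem ae_eq_prod_of_ae_ae [SFinite ν] {F G : α × T → E}
    (hF : AEStronglyMeasurable F (μ.prod ν)) (hG : AEStronglyMeasurable G (μ.prod ν))
    (h : ∀ᵐ a ∂μ, (fun t => F (a, t)) =ᵐ[ν] fun t => G (a, t)) : F =ᵐ[μ.prod ν] G := by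
  have hmk : hF.mk F =ᵐ[μ.prod ν] hG.mk G := by
    refine (Measure.ae_prod_iff_ae_ae
      (hF.stronglyMeasurable_mk.measurableSet_eq_fun hG.stronglyMeasurable_mk)).2 ?_
    filter_upwards [h, Measure.ae_ae_of_ae_prod hF.ae_eq_mk,
      Measure.ae_ae_of_ae_prod hG.ae_eq_mk] with a ha hFa hGa
    exact EventuallyEq.trans (EventuallyEq.trans (EventuallyEq.symm hFa) ha) hGa
  exact hF.ae_eq_mk.trans (hmk.trans hG.ae_eq_mk.symm)

theorem lintegral_prod_enorm_sq [SFinite ν] {F : α × T → E}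
    (hF : AEStronglyMeasurable F (μ.prod ν)) {f : α → Lp E 2 ν}
    (h : ∀ᵐ a ∂μ, (fun t => F (a, t)) =ᵐ[ν] f a) :
    ∫⁻ p, ‖F p‖ₑ ^ 2 ∂(μ.prod ν) = ∫⁻ a, ‖f a‖ₑ ^ 2 ∂μ := by
  rw [lintegral_prod _ (hF.enorm.pow_const 2)]
  refine lintegral_congr_ae ?_
  filter_upwards [h] with a ha
  rw [← lintegral_enorm_sq_coeFn]
  exact lintegral_congr_ae (ha.mono fun t ht => by simp only [ht])

theorem ae_memLp_prodMk_left [SFinite ν] {F : α × T → E} (hF : MemLp F 2 (μ.prod ν)) :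
    ∀ᵐ a ∂μ, MemLp (fun t => F (a, t)) 2 ν := by
  have hfin := (memLp_two_iff_lintegral_enorm_sq hF.aestronglyMeasurable).1 hF
  rw [lintegral_prod _ (hF.aestronglyMeasurable.enorm.pow_const 2)] at hfin
  filter_upwards [ae_lt_top' (hF.aestronglyMeasurable.enorm.pow_const 2).lintegral_prod_right'
    hfin.ne, hF.aestronglyMeasurable.prodMk_left] with a ha ham
  exact (memLp_two_iff_lintegral_enorm_sq ham).2 ha

open Classical in
/-- The slice `F (a, ·)` as an element of `L²(ν)`, with value `0` if it is not square integrable. -/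
noncomputable def slice (ν : Measure T) (F : α × T → E) (a : α) : Lp E 2 ν :=
  if h : MemLp (fun t => F (a, t)) 2 ν then h.toLp else 0

omit [MeasurableSpace α] in
theorem slice_of_memLp {F : α × T → E} {a : α} (h : MemLp (fun t => F (a, t)) 2 ν) :
    slice ν F a = h.toLp :=
  dif_pos h

omit [MeasurableSpace α] in
theorem coeFn_slice {F : α × T → E} {a : α} (h : MemLp (fun t => F (a, t)) 2 ν) :
    slice ν F a =ᵐ[ν] fun t => F (a, t) := by
  rw [slice_of_memLp h]
  exact h.coeFn_toLp

omit [MeasurableSpace α] in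
theorem slice_eq_of_ae_eq {F : α × T → E} {a : α} {f : Lp E 2 ν}
    (h : (fun t => F (a, t)) =ᵐ[ν] f) : slice ν F a = f :=
  Lp.ext ((coeFn_slice ((memLp_congr_ae h).2 (Lp.memLp f))).trans h)

theorem ae_coeFn_slice [SFinite ν] {F : α × T → E} (hF : MemLp F 2 (μ.prod ν)) :
    ∀ᵐ a ∂μ, slice ν F a =ᵐ[ν] fun t => F (a, t) := by
  filter_upwards [ae_memLp_prodMk_left hF] with a ha
  exact coeFn_slice ha

variable [SFinite ν] [MeasurableSpace.CountablyGenerated T]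

theorem stronglyMeasurable_slice [SecondCountableTopology E] {F : α × T → E}
    (hF : StronglyMeasurable F) : StronglyMeasurable (slice ν F) := by
  refine stronglyMeasurable_of_measurable_dist fun g => ?_
  have hmem : MeasurableSet {a | MemLp (fun t => F (a, t)) 2 ν} := by
    have hm (a : α) : AEStronglyMeasurable (fun t => F (a, t)) ν :=
      (hF.comp_measurable measurable_prodMk_left).aestronglyMeasurable
    simp_rw [memLp_two_iff_lintegral_enorm_sq (hm _)]
    exact measurableSet_lt (hF.enorm.pow_const 2).lintegral_prod_right' measurable_const
  have hdist : Measurable fun a => ((∫⁻ t, ‖F (a, t) - g t‖ₑ ^ 2 ∂ν) ^ (1 / 2 : ℝ)).toReal := by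
    refine (Measurable.pow_const ?_ _).ennreal_toReal
    exact (((hF.sub ((Lp.stronglyMeasurable g).comp_measurable
      measurable_snd)).enorm).pow_const 2).lintegral_prod_right'
  classical
  have hite : (fun a => dist (slice ν F a) g) = fun a =>
      if MemLp (fun t => F (a, t)) 2 ν
      then ((∫⁻ t, ‖F (a, t) - g t‖ₑ ^ 2 ∂ν) ^ (1 / 2 : ℝ)).toReal else dist 0 g := by
    ext a
    split_ifs with ha
    · rw [slice_of_memLp ha, dist_toLp_eq]
    · rw [slice, dif_neg ha]
  rw [hite]
  exact Measurable.ite hmem hdist measurable_const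

theorem stronglyMeasurable_toLp [SecondCountableTopology E] {F : α × T → E}
    (hF : StronglyMeasurable F) (h : ∀ a, MemLp (fun t => F (a, t)) 2 ν) :
    StronglyMeasurable fun a => (h a).toLp := by
  rw [← funext fun a => slice_of_memLp (h a)]
  exact stronglyMeasurable_slice hF

theorem memLp_slice [SecondCountableTopology E] (F : Lp E 2 (μ.prod ν)) :
    MemLp (slice ν F) 2 μ := by
  rw [memLp_two_iff_lintegral_enorm_sq
    (stronglyMeasurable_slice (Lp.stronglyMeasurable F)).aestronglyMeasurable,
    ← lintegral_prod_enorm_sq (Lp.aestronglyMeasurable F)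
      ((ae_coeFn_slice (Lp.memLp F)).mono fun _ h => h.symm), lintegral_enorm_sq_coeFn]
  simp [ENNReal.pow_lt_top_iff]

end Slice

section Curry

variable {α T T' E E' : Type*} [MeasurableSpace α] [MeasurableSpace T] [MeasurableSpace T']
  [MeasurableSpace.CountablyGenerated T] [MeasurableSpace.CountablyGenerated T']
  [NormedAddCommGroup E] [NormedSpace ℂ E] [SecondCountableTopology E]
  [NormedAddCommGroup E'] [NormedSpace ℂ E'] [SecondCountableTopology E']
  {μ : Measure α} {ν : Measure T} [SFinite ν] {ν' : Measure T'} [SFinite ν']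

/-- The isometry `L²(μ ⊗ ν) → L²(μ; L²(ν))`, `F ↦ (a ↦ F (a, ·))`. -/
noncomputable def curryₗᵢ : Lp E 2 (μ.prod ν) →ₗᵢ[ℂ] Lp (Lp E 2 ν) 2 μ where
  toFun F := (memLp_slice F).toLp
  map_add' F G := by
    rw [← MemLp.toLp_add]
    refine MemLp.toLp_congr _ _ ?_
    filter_upwards [ae_coeFn_slice (Lp.memLp F), ae_coeFn_slice (Lp.memLp G),
      Measure.ae_ae_of_ae_prod (Lp.coeFn_add F G)] with a hF hG hFG
    refine slice_eq_of_ae_eq ?_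
    filter_upwards [hF, hG, hFG, Lp.coeFn_add (slice ν F a) (slice ν G a)] with t h1 h2 h3 h4
    rw [h3, Pi.add_apply, Pi.add_apply, h4, Pi.add_apply, h1, h2]
  map_smul' c F := by
    rw [RingHom.id_apply, ← MemLp.toLp_const_smul]
    refine MemLp.toLp_congr _ _ ?_
    filter_upwards [ae_coeFn_slice (Lp.memLp F),
      Measure.ae_ae_of_ae_prod (Lp.coeFn_smul c F)] with a hF hcF
    refine slice_eq_of_ae_eq ?_
    filter_upwards [hF, hcF, Lp.coeFn_smul c (slice ν F a)] with t h1 h2 h3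
    rw [h2, Pi.smul_apply, Pi.smul_apply, h3, Pi.smul_apply, h1]
  norm_map' F := by
    refine norm_eq_of_enorm_sq_eq ?_
    simp only [LinearMap.coe_mk, AddHom.coe_mk]
    rw [enorm_sq_toLp, ← lintegral_enorm_sq_coeFn F]
    exact (lintegral_prod_enorm_sq (Lp.aestronglyMeasurable F)
      ((ae_coeFn_slice (Lp.memLp F)).mono fun _ h => h.symm)).symm

theorem curryₗᵢ_toLp {F : α × T → E} (hF : MemLp F 2 (μ.prod ν)) {f : Lp (Lp E 2 ν) 2 μ}
    (h : ∀ᵐ a ∂μ, (fun t => F (a, t)) =ᵐ[ν] f a) : curryₗᵢ hF.toLp = f := by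
  refine Lp.ext ((memLp_slice hF.toLp).coeFn_toLp.trans ?_)
  filter_upwards [h, Measure.ae_ae_of_ae_prod hF.coeFn_toLp] with a ha hFa
  exact slice_eq_of_ae_eq (EventuallyEq.trans hFa ha)

omit [MeasurableSpace.CountablyGenerated T] [SecondCountableTopology E] [NormedSpace ℂ E]
  [SFinite ν] [MeasurableSpace α] in
theorem indicator_prod_univ_ae_eq (s : Set α) (c : Lp E 2 ν) (a : α) :
    (fun t => (s ×ˢ Set.univ).indicator (fun p : α × T => c p.2) (a, t))
      =ᵐ[ν] (s.indicator (fun _ => c) a : Lp E 2 ν) := by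
  by_cases ha : a ∈ s
  · exact .of_eq (by ext t; simp [ha])
  · filter_upwards [Lp.coeFn_zero E 2 ν] with t ht
    simpa [ha] using ht.symm

theorem curryₗᵢ_surjective [CompleteSpace E] :
    Function.Surjective (curryₗᵢ : Lp E 2 (μ.prod ν) →ₗᵢ[ℂ] Lp (Lp E 2 ν) 2 μ) := by
  intro f
  induction f using Lp.induction (p := 2) ENNReal.ofNat_ne_top with
  | @indicatorConst c s hs hμs =>
    have hm : AEStronglyMeasurable ((s ×ˢ Set.univ).indicator fun p : α × T => c p.2)
        (μ.prod ν) :=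
      (((Lp.stronglyMeasurable c).comp_measurable measurable_snd).indicator
        (hs.prod MeasurableSet.univ)).aestronglyMeasurable
    have hF : MemLp ((s ×ˢ Set.univ).indicator fun p : α × T => c p.2) 2 (μ.prod ν) := by
      rw [memLp_two_iff_lintegral_enorm_sq hm,
        lintegral_prod_enorm_sq hm (.of_forall (indicator_prod_univ_ae_eq s c))]
      have hc := memLp_indicator_const (μ := μ) 2 hs c (.inr hμs.ne)
      exact (memLp_two_iff_lintegral_enorm_sq hc.aestronglyMeasurable).1 hc
    refine ⟨hF.toLp, curryₗᵢ_toLp hF ?_⟩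
    filter_upwards [indicatorConstLp_coeFn (p := 2) (hs := hs) (hμs := hμs.ne) (c := c)] with a ha
    rw [Lp.simpleFunc.coe_indicatorConst, ha]
    exact indicator_prod_univ_ae_eq s c a
  | add hf hg _ ihf ihg =>
    obtain ⟨F, hF⟩ := ihf
    obtain ⟨G, hG⟩ := ihg
    exact ⟨F + G, by rw [map_add, hF, hG]⟩
  | isClosed => exact curryₗᵢ.isometry.isClosedEmbedding.isClosed_range

/-- Currying as an isometric isomorphism `L²(μ ⊗ ν) ≃ L²(μ; L²(ν))`. -/
noncomputable def curryEquiv [CompleteSpace E] :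
    Lp E 2 (μ.prod ν) ≃ₗᵢ[ℂ] Lp (Lp E 2 ν) 2 μ :=
  LinearIsometryEquiv.ofSurjective curryₗᵢ curryₗᵢ_surjective

theorem ae_coeFn_curryEquiv [CompleteSpace E] (F : Lp E 2 (μ.prod ν)) :
    ∀ᵐ a ∂μ, (fun t => F (a, t)) =ᵐ[ν] curryEquiv F a := by
  filter_upwards [(memLp_slice F).coeFn_toLp, ae_coeFn_slice (Lp.memLp F)] with a h hF
  rw [show curryEquiv F a = slice ν F a from h]
  exact hF.symm

end Curry

section LpEquiv

variable {α β T T' H H' : Type*} [MeasurableSpace α] [MeasurableSpace β] [MeasurableSpace T]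
  [MeasurableSpace T'] [NormedAddCommGroup H] [NormedSpace ℂ H] [NormedAddCommGroup H']
  [NormedSpace ℂ H'] {p : ℝ≥0∞} [Fact (1 ≤ p)] {μ : Measure α} {μ' : Measure β}

omit [Fact (1 ≤ p)] in
theorem compLpₗ_symm_compLpₗ (L : H ≃ₗᵢ[ℂ] H') (f : Lp H p μ) :
    (L.symm.toContinuousLinearEquiv : H' →L[ℂ] H).compLpₗ p μ
      ((L.toContinuousLinearEquiv : H →L[ℂ] H').compLpₗ p μ f) = f := by
  refine Lp.ext (EventuallyEq.trans
    ((L.symm.toContinuousLinearEquiv : H' →L[ℂ] H).coeFn_compLp _) ?_)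
  filter_upwards [(L.toContinuousLinearEquiv : H →L[ℂ] H').coeFn_compLp f] with a ha
  exact (congrArg L.symm ha).trans (L.symm_apply_apply _)

/-- The isometric isomorphism of `Lᵖ` spaces of vector valued functions obtained by applying an
isometric isomorphism pointwise. -/
noncomputable def mapLpEquiv (L : H ≃ₗᵢ[ℂ] H') (p : ℝ≥0∞) [Fact (1 ≤ p)] (μ : Measure α) :
    Lp H p μ ≃ₗᵢ[ℂ] Lp H' p μ where
  __ := (L.toContinuousLinearEquiv : H →L[ℂ] H').compLpₗ p μ
  invFun := (L.symm.toContinuousLinearEquiv : H' →L[ℂ] H).compLpₗ p μ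
  left_inv := compLpₗ_symm_compLpₗ L
  right_inv := compLpₗ_symm_compLpₗ L.symm
  norm_map' f := by
    simp only [Lp.norm_def]
    refine congrArg ENNReal.toReal (eLpNorm_congr_norm_ae ?_)
    filter_upwards [(L.toContinuousLinearEquiv : H →L[ℂ] H').coeFn_compLp f] with a ha
    exact (congrArg norm ha).trans (L.norm_map _)

theorem coeFn_mapLpEquiv (L : H ≃ₗᵢ[ℂ] H') (f : Lp H p μ) :
    mapLpEquiv L p μ f =ᵐ[μ] fun a => L (f a) :=
  (L.toContinuousLinearEquiv : H →L[ℂ] H').coeFn_compLp f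

variable [MeasurableSpace.CountablyGenerated T] [MeasurableSpace.CountablyGenerated T']
  [CompleteSpace H] [SecondCountableTopology H] [CompleteSpace H'] [SecondCountableTopology H']
  {ν : Measure T} [SFinite ν] {ν' : Measure T'} [SFinite ν']

/-- The operator `1 ⊗ L` on `L²(μ ⊗ ν)`. -/
noncomputable def sliceMap (L : Lp H 2 ν ≃ₗᵢ[ℂ] Lp H' 2 ν') (μ : Measure α) :
    Lp H 2 (μ.prod ν) ≃ₗᵢ[ℂ] Lp H' 2 (μ.prod ν') :=
  curryEquiv.trans ((mapLpEquiv L 2 μ).trans curryEquiv.symm)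

theorem ae_coeFn_sliceMap (L : Lp H 2 ν ≃ₗᵢ[ℂ] Lp H' 2 ν') (F : Lp H 2 (μ.prod ν)) :
    ∀ᵐ a ∂μ, ∀ f : Lp H 2 ν, f =ᵐ[ν] (fun t => F (a, t)) →
      (fun t => sliceMap L μ F (a, t)) =ᵐ[ν'] L f := by
  have hcurry : curryEquiv (sliceMap L μ F) = mapLpEquiv L 2 μ (curryEquiv F) := by simp [sliceMap]
  filter_upwards [ae_coeFn_curryEquiv F, ae_coeFn_curryEquiv (sliceMap L μ F),
    coeFn_mapLpEquiv L (curryEquiv F)] with a hF hLF hmap f hf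
  rw [hcurry, hmap] at hLF
  rwa [show f = curryEquiv F a from Lp.ext (hf.trans hF)]

/-- Composition with a measure preserving map that has a left inverse almost everywhere. -/
noncomputable def compMeasurePreservingEquiv (e : α → β) (he : MeasurePreserving e μ μ')
    (e' : β → α) (he' : Measurable e') (hee' : ∀ᵐ x ∂μ, e' (e x) = x) :
    Lp H p μ' ≃ₗᵢ[ℂ] Lp H p μ :=
  LinearIsometryEquiv.ofSurjective (Lp.compMeasurePreservingₗᵢ ℂ e he) fun f => by
    have hm : StronglyMeasurable (f ∘ e') := (Lp.stronglyMeasurable f).comp_measurable he'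
    have hae : (f ∘ e') ∘ e =ᵐ[μ] f := by
      filter_upwards [hee'] with x hx
      simp only [Function.comp_apply, hx]
    have hmem : MemLp (f ∘ e') p μ' := by
      rw [← he.map_eq]
      exact (memLp_map_measure_iff hm.aestronglyMeasurable he.measurable.aemeasurable).2
        ((memLp_congr_ae hae).2 (Lp.memLp f))
    exact ⟨hmem.toLp, Lp.ext ((Lp.coeFn_compMeasurePreserving _ he).trans
      ((he.quasiMeasurePreserving.ae_eq_comp hmem.coeFn_toLp).trans hae))⟩

omit [CompleteSpace H] [SecondCountableTopology H] in
theorem coeFn_compMeasurePreservingEquiv (e : α → β) (he : MeasurePreserving e μ μ')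
    (e' : β → α) (he' : Measurable e') (hee' : ∀ᵐ x ∂μ, e' (e x) = x) (f : Lp H p μ') :
    compMeasurePreservingEquiv e he e' he' hee' f =ᵐ[μ] fun x => f (e x) :=
  Lp.coeFn_compMeasurePreserving _ he

end LpEquiv

section IntegralLp

variable {α T : Type*} [MeasurableSpace α] [MeasurableSpace T] {μ : Measure α} {ν : Measure T}

theorem lintegral_enorm_restrict_le (f : Lp ℂ 2 ν) (s : Set T) :
    ∫⁻ t, ‖f t‖ₑ ∂(ν.restrict s) ≤ ‖f‖ₑ * ν s ^ (1 / 2 : ℝ) := by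
  calc ∫⁻ t, ‖f t‖ₑ ∂(ν.restrict s)
      ≤ eLpNorm f 2 (ν.restrict s) * ν s ^ (1 / 2 : ℝ) := by
        have h : eLpNorm f 1 (ν.restrict s) ≤ _ :=
          eLpNorm_le_eLpNorm_mul_rpow_measure_univ (q := 2) (by norm_num)
            (Lp.aestronglyMeasurable f).restrict
        rw [eLpNorm_one_eq_lintegral_enorm, Measure.restrict_apply_univ] at h
        norm_num at h ⊢
        exact h
    _ ≤ ‖f‖ₑ * ν s ^ (1 / 2 : ℝ) := by
        rw [Lp.enorm_def]
        gcongr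
        exact Measure.restrict_le_self

theorem integrable_prod_restrict_of_ae_eq [SFinite ν] {F : α → Lp ℂ 2 ν} (hF : Integrable F μ)
    {Φ : α × T → ℂ} (hΦ : StronglyMeasurable Φ)
    (h : ∀ᵐ a ∂μ, (fun t => Φ (a, t)) =ᵐ[ν] F a) {s : Set T} (hνs : ν s < ∞) :
    Integrable Φ (μ.prod (ν.restrict s)) := by
  refine ⟨hΦ.aestronglyMeasurable, ?_⟩
  rw [hasFiniteIntegral_iff_enorm, lintegral_prod _ hΦ.enorm.aemeasurable]
  calc ∫⁻ a, ∫⁻ t, ‖Φ (a, t)‖ₑ ∂(ν.restrict s) ∂μ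
      ≤ ∫⁻ a, ‖F a‖ₑ * ν s ^ (1 / 2 : ℝ) ∂μ := by
        refine lintegral_mono_ae ?_
        filter_upwards [h] with a ha
        refine le_of_eq_of_le (lintegral_congr_ae (ae_restrict_of_ae ?_))
          (lintegral_enorm_restrict_le (F a) s)
        exact ha.mono fun t ht => congrArg enorm ht
    _ < ∞ := by
        rw [lintegral_mul_const'' _ hF.1.enorm]
        exact ENNReal.mul_lt_top hF.2 (ENNReal.rpow_lt_top_of_nonneg (by norm_num) hνs.ne)

variable [SigmaFinite ν] [SFinite μ] {F : α → Lp ℂ 2 ν} {Φ : α × T → ℂ}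

theorem ae_integrable_of_integrable_Lp (hF : Integrable F μ) (hΦ : StronglyMeasurable Φ)
    (h : ∀ᵐ a ∂μ, (fun t => Φ (a, t)) =ᵐ[ν] F a) :
    ∀ᵐ t ∂ν, Integrable (fun a => Φ (a, t)) μ := by
  have hloc := (ae_restrict_iUnion_iff (μ := ν) (spanningSets ν)
    fun t => Integrable (fun a => Φ (a, t)) μ).2 fun n =>
      (integrable_prod_restrict_of_ae_eq hF hΦ h (measure_spanningSets_lt_top ν n)).prod_left_ae
  rwa [iUnion_spanningSets, Measure.restrict_univ] at hloc

theorem coeFn_integral (hF : Integrable F μ) (hΦ : StronglyMeasurable Φ)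
    (h : ∀ᵐ a ∂μ, (fun t => Φ (a, t)) =ᵐ[ν] F a) :
    (∫ a, F a ∂μ : Lp ℂ 2 ν) =ᵐ[ν] fun t => ∫ a, Φ (a, t) ∂μ := by
  refine ae_eq_of_forall_setIntegral_eq_of_sigmaFinite (fun s _ hνs => ?_)
    (fun s _ hνs => (integrable_prod_restrict_of_ae_eq hF hΦ h hνs).integral_prod_right)
    fun s hs hνs => ?_
  · have : IsFiniteMeasure (ν.restrict s) := ⟨by simpa using hνs⟩
    exact ((Lp.memLp _).restrict s).integrable (by norm_num)
  · rw [← integral_integral_swap (f := fun a t => Φ (a, t))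
      (integrable_prod_restrict_of_ae_eq hF hΦ h hνs),
      ← L2.inner_indicatorConstLp_one hs hνs.ne, ← integral_inner hF]
    refine integral_congr_ae ?_
    filter_upwards [h] with a ha
    rw [L2.inner_indicatorConstLp_one hs hνs.ne]
    exact integral_congr_ae (ae_restrict_of_ae ha.symm)

end IntegralLp

section FourierInv

open FourierTransform SchwartzMap

variable {E : Type*} [NormedAddCommGroup E] [InnerProductSpace ℝ E] [FiniteDimensional ℝ E]
  [MeasurableSpace E] [BorelSpace E]

omit [FiniteDimensional ℝ E] [MeasurableSpace E] [BorelSpace E] in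
theorem continuous_uncurry_neg_innerₗ :
    Continuous fun w : E × E => (-innerₗ E) w.1 w.2 := by
  simp only [LinearMap.neg_apply, innerₗ_apply_apply]
  fun_prop

theorem continuous_fourierInv {f : E → ℂ} (hf : Integrable f) : Continuous (𝓕⁻ f) :=
  VectorFourier.fourierIntegral_continuous Real.continuous_fourierChar
    continuous_uncurry_neg_innerₗ hf

theorem integral_fourierInv_smul_eq (G : 𝓢(E, ℂ)) {f : E → ℂ} (hf : Integrable f) :
    ∫ x, (𝓕⁻ G) x • f x = ∫ x, G x • (𝓕⁻ f) x := by
  have hflip : (-innerₗ E).flip = -innerₗ E := by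
    ext x y; simp [real_inner_comm]
  have h := VectorFourier.integral_fourierIntegral_smul_eq_flip (L := -innerₗ E)
    (μ := volume) (ν := volume) Real.continuous_fourierChar continuous_uncurry_neg_innerₗ
    G.integrable hf
  rw [hflip] at h
  rw [fourierInv_coe]
  exact h

/-- The two functions have the same integral against every test function. -/
theorem coeFn_Lp_fourierInv (f : Lp (α := E) ℂ 2) (hf : Integrable f) :
    (𝓕⁻ f : Lp (α := E) ℂ 2) =ᵐ[volume] 𝓕⁻ (f : E → ℂ) := by
  refine ae_eq_of_integral_contDiff_smul_eq ((Lp.memLp _).locallyIntegrable (by norm_num))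
    (continuous_fourierInv hf).locallyIntegrable fun g hg hgc => ?_
  let G : 𝓢(E, ℂ) := HasCompactSupport.toSchwartzMap (f := Complex.ofRealCLM ∘ g)
    (hgc.comp_left rfl) (Complex.ofRealCLM.contDiff.comp hg)
  have hG (h : E → ℂ) : ∫ x, g x • h x = ∫ x, G x • h x := by simp [G]
  have hdistr := congrArg (fun T => T G) (Lp.fourierInv_toTemperedDistribution_eq f)
  simp only [TemperedDistribution.fourierInv_apply,
    Lp.toTemperedDistribution_apply (μ := volume)] at hdistr
  rw [hG, hG, ← hdistr, integral_fourierInv_smul_eq G hf]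

end FourierInv

section FourierProd

variable {p q : Type*} [Fintype p] [Fintype q]

/-- The character `ζ ↦ exp (2πi ⟨ξ, ζ⟩)` of `ℝ^p × ℝ^q`. -/
noncomputable def prodChar (ξ ζ : (p → ℝ) × (q → ℝ)) : ℂ :=
  Complex.exp (2 * Real.pi * Complex.I * ((ξ.1 ⬝ᵥ ζ.1 + ξ.2 ⬝ᵥ ζ.2 : ℝ) : ℂ))

theorem prodChar_comm (ξ ζ : (p → ℝ) × (q → ℝ)) : prodChar ξ ζ = prodChar ζ ξ := by
  unfold prodChar
  rw [dotProduct_comm ξ.1, dotProduct_comm ξ.2]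

theorem continuous_prodChar :
    Continuous fun w : ((p → ℝ) × (q → ℝ)) × ((p → ℝ) × (q → ℝ)) => prodChar w.1 w.2 := by
  unfold prodChar dotProduct; fun_prop

/-- The identification of the Euclidean space `ℝ^(p ⊕ q)` with `ℝ^p × ℝ^q`. -/
noncomputable def euclideanSplit : EuclideanSpace ℝ (p ⊕ q) ≃ᵐ (p → ℝ) × (q → ℝ) :=
  (MeasurableEquiv.toLp 2 (p ⊕ q → ℝ)).symm.trans
    (MeasurableEquiv.sumPiEquivProdPi fun _ : p ⊕ q => ℝ)

theorem measurePreserving_euclideanSplit :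
    MeasurePreserving (euclideanSplit : EuclideanSpace ℝ (p ⊕ q) ≃ᵐ (p → ℝ) × (q → ℝ)) :=
  (volume_measurePreserving_sumPiEquivProdPi (fun _ : p ⊕ q => ℝ)).comp
    (PiLp.volume_preserving_ofLp (p ⊕ q))

theorem inner_euclideanSplit_symm (w : EuclideanSpace ℝ (p ⊕ q)) (ξ : (p → ℝ) × (q → ℝ)) :
    inner ℝ w (euclideanSplit.symm ξ) =
      ξ.1 ⬝ᵥ (euclideanSplit w).1 + ξ.2 ⬝ᵥ (euclideanSplit w).2 := by
  rw [PiLp.inner_apply, Fintype.sum_sum_type]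
  rfl

/-- The transport of `L²(ℝ^p × ℝ^q)` to the Euclidean space `ℝ^(p ⊕ q)`. -/
noncomputable def splitEquiv :
    Lp ℂ 2 (volume : Measure ((p → ℝ) × (q → ℝ))) ≃ₗᵢ[ℂ]
      Lp ℂ 2 (volume : Measure (EuclideanSpace ℝ (p ⊕ q))) :=
  compMeasurePreservingEquiv euclideanSplit measurePreserving_euclideanSplit euclideanSplit.symm
    euclideanSplit.symm.measurable (.of_forall euclideanSplit.symm_apply_apply)

theorem coeFn_splitEquiv (f : Lp ℂ 2 (volume : Measure ((p → ℝ) × (q → ℝ)))) :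
    splitEquiv f =ᵐ[volume] fun w => f (euclideanSplit w) :=
  coeFn_compMeasurePreservingEquiv _ _ _ _ _ f

theorem coeFn_splitEquiv_symm (f : Lp ℂ 2 (volume : Measure (EuclideanSpace ℝ (p ⊕ q)))) :
    splitEquiv.symm f =ᵐ[volume] fun ζ => f (euclideanSplit.symm ζ) := by
  have h := (measurePreserving_euclideanSplit (p := p) (q := q)).symm
    |>.quasiMeasurePreserving.ae_eq_comp (coeFn_splitEquiv (splitEquiv.symm f))
  rw [LinearIsometryEquiv.apply_symm_apply] at h
  filter_upwards [h] with ζ hζ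
  simpa using hζ.symm

/-- The Fourier transform on `L²(ℝ^p × ℝ^q)`, with the kernel `exp (2πi ⟨ξ, ζ⟩)`. -/
noncomputable def fourierProd :
    Lp ℂ 2 (volume : Measure ((p → ℝ) × (q → ℝ))) ≃ₗᵢ[ℂ]
      Lp ℂ 2 (volume : Measure ((p → ℝ) × (q → ℝ))) :=
  splitEquiv.trans
    ((Lp.fourierTransformₗᵢ (EuclideanSpace ℝ (p ⊕ q)) ℂ).symm.trans splitEquiv.symm)

theorem coeFn_fourierProd (f : Lp ℂ 2 (volume : Measure ((p → ℝ) × (q → ℝ))))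
    (hf : Integrable f) : fourierProd f =ᵐ[volume] fun ξ => ∫ ζ, prodChar ξ ζ * f ζ := by
  have hint : Integrable (splitEquiv f) := (integrable_congr (coeFn_splitEquiv f)).2
    (measurePreserving_euclideanSplit.integrable_comp_of_integrable hf)
  refine (coeFn_splitEquiv_symm _).trans
    ((measurePreserving_euclideanSplit.symm.quasiMeasurePreserving.ae_eq_comp
      (coeFn_Lp_fourierInv _ hint)).trans (.of_forall fun ξ => ?_))
  beta_reduce
  rw [Function.comp_apply, Real.fourierInv_eq', ← measurePreserving_euclideanSplit.integral_comp
    euclideanSplit.measurableEmbedding fun ζ => prodChar ξ ζ * f ζ]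
  refine integral_congr_ae ?_
  filter_upwards [coeFn_splitEquiv f] with w hw
  simp only [prodChar, smul_eq_mul, hw, inner_euclideanSplit_symm]
  push_cast
  ring_nf

theorem lintegral_enorm_sq_integral_prodChar_mul {h : (p → ℝ) × (q → ℝ) → ℂ} (h1 : Integrable h)
    (h2 : MemLp h 2) :
    ∫⁻ ξ, ‖∫ ζ, prodChar ξ ζ * h ζ‖ₑ ^ 2 = ∫⁻ ζ, ‖h ζ‖ₑ ^ 2 := by
  have hnorm : ‖h2.toLp‖ₑ = ‖fourierProd h2.toLp‖ₑ := by
    rw [← ofReal_norm, ← ofReal_norm, LinearIsometryEquiv.norm_map]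
  rw [← enorm_sq_toLp h2, hnorm, ← lintegral_enorm_sq_coeFn]
  refine lintegral_congr_ae ?_
  filter_upwards [coeFn_fourierProd h2.toLp ((integrable_congr h2.coeFn_toLp).2 h1)] with ξ hξ
  rw [hξ, integral_congr_ae (h2.coeFn_toLp.mono fun ζ hζ => congrArg (prodChar ξ ζ * ·) hζ)]

end FourierProd

section FourierSeries

variable {ι : Type*}

/-- The half-open unit cube with lower corner `a`. -/
def unitCube (a : ι → ℝ) : Set (ι → ℝ) := {x | ∀ i, x i ∈ Set.Ioc (a i) (a i + 1)}

theorem mem_unitCube_intCast_iff {k : ι → ℤ} {x : ι → ℝ} :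
    x ∈ unitCube (fun i => (k i : ℝ)) ↔ ∀ i, ⌈x i⌉ - 1 = k i := by
  simp only [unitCube, Set.mem_ofPred_eq, Set.mem_Ioc]
  refine forall_congr' fun i => ?_
  rw [sub_eq_iff_eq_add, Int.ceil_eq_iff]
  push_cast
  simp

theorem iUnion_unitCube_intCast :
    ⋃ k : ι → ℤ, unitCube (fun i => (k i : ℝ)) = (Set.univ : Set (ι → ℝ)) :=
  Set.eq_univ_of_forall fun x => Set.mem_iUnion.2
    ⟨fun i => ⌈x i⌉ - 1, mem_unitCube_intCast_iff.2 fun _ => rfl⟩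

theorem pairwise_disjoint_unitCube_intCast :
    Pairwise (Function.onFun Disjoint fun k : ι → ℤ => unitCube fun i => (k i : ℝ)) :=
  fun _ _ hkl => Set.disjoint_left.2 fun _ hk hl => hkl (funext fun i =>
    (mem_unitCube_intCast_iff.1 hk i).symm.trans (mem_unitCube_intCast_iff.1 hl i))

theorem preimage_add_right_unitCube (a : ι → ℝ) :
    (fun x : ι → ℝ => x + a) ⁻¹' unitCube a = unitCube 0 := by
  ext x
  simp [unitCube, add_comm (x _)]

theorem measurableSet_unitCube [Countable ι] (a : ι → ℝ) : MeasurableSet (unitCube a) :=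
  MeasurableSet.univ_pi' fun _ => measurableSet_Ioc

variable [Fintype ι]

theorem measurePreserving_add_right_unitCube (a : ι → ℝ) :
    MeasurePreserving (fun x : ι → ℝ => x + a)
      (volume.restrict (unitCube 0)) (volume.restrict (unitCube a)) := by
  have h := (measurePreserving_add_right (volume : Measure (ι → ℝ)) a).restrict_preimage
    (measurableSet_unitCube a)
  rwa [preimage_add_right_unitCube] at h

theorem lintegral_eq_lintegral_unitCube_tsum {g : (ι → ℝ) → ℝ≥0∞} (hg : AEMeasurable g) :
    ∫⁻ x, g x = ∫⁻ x in unitCube 0, ∑' k : ι → ℤ, g (x + fun i => (k i : ℝ)) := by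
  have hgk (k : ι → ℤ) : AEMeasurable fun x : ι → ℝ => g (x + fun i => (k i : ℝ)) :=
    hg.comp_quasiMeasurePreserving
      (measurePreserving_add_right volume _).quasiMeasurePreserving
  rw [lintegral_tsum fun k => (hgk k).restrict, ← setLIntegral_univ, ← iUnion_unitCube_intCast,
    lintegral_iUnion (fun _ => measurableSet_unitCube _) pairwise_disjoint_unitCube_intCast]
  refine tsum_congr fun k => ?_
  have hT := measurePreserving_add_right_unitCube fun i => (k i : ℝ)
  rw [← hT.map_eq, lintegral_map' (hT.map_eq ▸ hg.restrict) hT.measurable.aemeasurable]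

theorem integral_eq_integral_unitCube_tsum {g : (ι → ℝ) → ℂ} (hg : Integrable g) :
    ∫ x, g x = ∫ x in unitCube 0, ∑' k : ι → ℤ, g (x + fun i => (k i : ℝ)) := by
  have hgk (k : ι → ℤ) : AEStronglyMeasurable fun x : ι → ℝ => g (x + fun i => (k i : ℝ)) :=
    hg.1.comp_quasiMeasurePreserving
      (measurePreserving_add_right volume _).quasiMeasurePreserving
  have hfin : ∑' k : ι → ℤ, ∫⁻ x in unitCube 0, ‖g (x + fun i => (k i : ℝ))‖ₑ ≠ ∞ := by
    rw [← lintegral_tsum fun k => (hgk k).enorm.restrict,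
      ← lintegral_eq_lintegral_unitCube_tsum hg.1.enorm]
    exact hg.2.ne
  rw [integral_tsum (fun k => (hgk k).restrict) hfin, ← setIntegral_univ,
    ← iUnion_unitCube_intCast, ← (hasSum_integral_iUnion (fun _ => measurableSet_unitCube _)
      pairwise_disjoint_unitCube_intCast hg.integrableOn).tsum_eq]
  refine tsum_congr fun k => ?_
  have hT := measurePreserving_add_right_unitCube fun i => (k i : ℝ)
  rw [← hT.map_eq, integral_map hT.measurable.aemeasurable (hT.map_eq ▸ hg.1.restrict)]

/-- The `ℤ^ι`-periodic function `∑ₖ h (· + k)`. -/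
noncomputable def periodize (h : (ι → ℝ) → ℂ) (x : ι → ℝ) : ℂ :=
  ∑' k : ι → ℤ, h (x + fun i => (k i : ℝ))

/-- The translates of `h` by integer vectors have almost everywhere disjoint supports. -/
def IsPacking (h : (ι → ℝ) → ℂ) : Prop :=
  ∀ᵐ x, ∀ k : ι → ℤ, k ≠ 0 → h x = 0 ∨ h (x + fun i => (k i : ℝ)) = 0

theorem IsPacking.ae_exists_forall_ne_eq_zero {h : (ι → ℝ) → ℂ} (hp : IsPacking h) :
    ∀ᵐ x, ∃ k₀ : ι → ℤ, ∀ k : ι → ℤ, k ≠ k₀ → h (x + fun i => (k i : ℝ)) = 0 := by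
  have htrans : ∀ᵐ x, ∀ l k : ι → ℤ, k ≠ 0 → h (x + fun i => (l i : ℝ)) = 0 ∨
      h (x + (fun i => (l i : ℝ)) + fun i => (k i : ℝ)) = 0 :=
    ae_all_iff.2 fun l => (measurePreserving_add_right (volume : Measure (ι → ℝ))
      (fun i => (l i : ℝ))).quasiMeasurePreserving.ae hp
  filter_upwards [htrans] with x hx
  by_cases hz : ∃ l : ι → ℤ, h (x + fun i => (l i : ℝ)) ≠ 0
  · obtain ⟨l, hl⟩ := hz
    refine ⟨l, fun k hk => ?_⟩
    convert (hx l (k - l) (sub_ne_zero.2 hk)).resolve_left hl using 2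
    ext i
    simp
  · push Not at hz
    exact ⟨0, fun k _ => hz k⟩

theorem IsPacking.aestronglyMeasurable_periodize {h : (ι → ℝ) → ℂ} (hp : IsPacking h)
    (hm : AEStronglyMeasurable h) : AEStronglyMeasurable (periodize h) := by
  refine aestronglyMeasurable_of_tendsto_ae (u := (atTop : Filter (Finset (ι → ℤ))))
    (f := fun s x => ∑ k ∈ s, h (x + fun i => (k i : ℝ))) (fun s => ?_) ?_
  · exact Finset.aestronglyMeasurable_fun_sum s fun k _ => hm.comp_quasiMeasurePreserving
      (measurePreserving_add_right volume _).quasiMeasurePreserving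
  · filter_upwards [hp.ae_exists_forall_ne_eq_zero] with x ⟨k₀, hk⟩
    exact (hasSum_single k₀ hk).summable.hasSum

theorem IsPacking.enorm_sq_periodize {h : (ι → ℝ) → ℂ} (hp : IsPacking h) :
    ∀ᵐ x, ‖periodize h x‖ₑ ^ 2 = ∑' k : ι → ℤ, ‖h (x + fun i => (k i : ℝ))‖ₑ ^ 2 := by
  filter_upwards [hp.ae_exists_forall_ne_eq_zero] with x ⟨k₀, hk⟩
  rw [periodize, tsum_eq_single k₀ hk, tsum_eq_single k₀ fun k hk' => by simp [hk k hk']]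

noncomputable local instance : MeasureSpace UnitAddCircle := ⟨AddCircle.haarAddCircle⟩

theorem mFourier_coe (n : ι → ℤ) (x : ι → ℝ) :
    UnitAddTorus.mFourier n (fun i => (x i : UnitAddCircle)) =
      Complex.exp (2 * Real.pi * Complex.I * ((∑ i, n i * x i : ℝ) : ℂ)) := by
  simp only [UnitAddTorus.mFourier, ContinuousMap.coe_mk, fourier_coe_apply]
  rw [← Complex.exp_sum]
  push_cast
  rw [Finset.mul_sum]
  exact congrArg Complex.exp (Finset.sum_congr rfl fun i _ => by ring)

theorem mFourier_coe_add_int (n k : ι → ℤ) (x : ι → ℝ) :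
    UnitAddTorus.mFourier n (fun i => ((x i + k i : ℝ) : UnitAddCircle)) =
      UnitAddTorus.mFourier n (fun i => (x i : UnitAddCircle)) := by
  congr 1
  ext i
  have hk : ((k i : ℝ) : UnitAddCircle) = 0 := (AddCircle.coe_eq_zero_iff 1).2 ⟨k i, by simp⟩
  rw [AddCircle.coe_add, hk, add_zero]

theorem tsum_enorm_sq_mFourierCoeff (f : Lp ℂ 2 (volume : Measure (UnitAddTorus ι))) :
    ∑' n, ‖UnitAddTorus.mFourierCoeff f n‖ₑ ^ 2 = ∫⁻ θ, ‖f θ‖ₑ ^ 2 := by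
  have hsum := UnitAddTorus.hasSum_sq_mFourierCoeff f
  have henorm (z : ℂ) : ‖z‖ₑ ^ 2 = ENNReal.ofReal (‖z‖ ^ 2) := by
    rw [ENNReal.ofReal_pow (norm_nonneg _), ofReal_norm]
  simp only [henorm]
  rw [← ENNReal.ofReal_tsum_of_nonneg (fun _ => by positivity) hsum.summable, hsum.tsum_eq,
    ofReal_integral_eq_lintegral_ofReal _ (.of_forall fun _ => by positivity)]
  exact (memLp_two_iff_integrable_sq_norm (Lp.aestronglyMeasurable _)).1 (Lp.memLp _)

/-- The section of the quotient map `ℝ^ι → ℝ^ι / ℤ^ι` with values in `unitCube 0`. -/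
noncomputable def torusSection (θ : UnitAddTorus ι) : ι → ℝ :=
  (UnitAddTorus.measurableEquivPiIoc (0 : ι → ℝ) θ).1

omit [Fintype ι] in
theorem torusSection_coe {x : ι → ℝ} (hx : x ∈ unitCube (0 : ι → ℝ)) :
    torusSection (fun i => (x i : UnitAddCircle)) = x :=
  congrArg Subtype.val
    ((UnitAddTorus.measurableEquivPiIoc (0 : ι → ℝ)).apply_symm_apply ⟨x, hx⟩)

theorem measurePreserving_torusSection :
    MeasurePreserving (torusSection : UnitAddTorus ι → ι → ℝ) volume
      (volume.restrict (unitCube 0)) := by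
  have hval : MeasurePreserving (Subtype.val : unitCube (0 : ι → ℝ) → ι → ℝ)
      (Measure.comap Subtype.val volume) (volume.restrict (unitCube 0)) :=
    ⟨measurable_subtype_coe, map_comap_subtype_coe (measurableSet_unitCube 0) _⟩
  exact hval.comp (UnitAddTorus.measurePreserving_equivPiIoc (0 : ι → ℝ))

theorem IsPacking.lintegral_enorm_sq_periodize_torusSection {h : (ι → ℝ) → ℂ}
    (hp : IsPacking h) (hm : AEStronglyMeasurable h) :
    ∫⁻ θ, ‖periodize h (torusSection θ)‖ₑ ^ 2 = ∫⁻ x, ‖h x‖ₑ ^ 2 := by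
  rw [UnitAddTorus.lintegral_preimage _ 0,
    lintegral_eq_lintegral_unitCube_tsum (hm.enorm.pow_const 2)]
  refine setLIntegral_congr_fun_ae (measurableSet_unitCube 0) ?_
  filter_upwards [hp.enorm_sq_periodize] with x hx hxQ
  rw [torusSection_coe hxQ, hx]

theorem mFourierCoeff_periodize_torusSection {h : (ι → ℝ) → ℂ} (h1 : Integrable h) (n : ι → ℤ) :
    UnitAddTorus.mFourierCoeff (fun θ => periodize h (torusSection θ)) n =
      ∫ x, UnitAddTorus.mFourier (-n) (fun i => (x i : UnitAddCircle)) * h x := by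
  have hint : Integrable fun x : ι → ℝ =>
      UnitAddTorus.mFourier (-n) (fun i => (x i : UnitAddCircle)) * h x := by
    refine h1.bdd_mul (c := 1) ?_ (.of_forall fun x =>
      ((UnitAddTorus.mFourier (-n)).norm_coe_le_norm _).trans UnitAddTorus.mFourier_norm.le)
    exact ((map_continuous _).comp (continuous_pi fun i =>
      (AddCircle.continuous_mk' 1).comp (continuous_apply i))).aestronglyMeasurable
  rw [UnitAddTorus.mFourierCoeff_eq_integral _ n 0, integral_eq_integral_unitCube_tsum hint]
  refine setIntegral_congr_fun (measurableSet_unitCube 0) fun x hx => ?_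
  rw [torusSection_coe hx, smul_eq_mul, periodize, ← tsum_mul_left]
  refine tsum_congr fun k => ?_
  rw [← mFourier_coe_add_int (-n) k x]
  rfl

/-- Parseval's identity for the periodization, whose square norm over the torus is that of `h`
because the translates of `h` do not overlap. -/
theorem IsPacking.tsum_enorm_sq_fourier {h : (ι → ℝ) → ℂ} (hp : IsPacking h) (h1 : Integrable h)
    (h2 : MemLp h 2) :
    ∑' n : ι → ℤ, ‖∫ x, Complex.exp (2 * Real.pi * Complex.I * ((∑ i, n i * x i : ℝ) : ℂ)) * h x‖ₑ
      ^ 2 = ∫⁻ x, ‖h x‖ₑ ^ 2 := by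
  have hm : AEStronglyMeasurable fun θ : UnitAddTorus ι => periodize h (torusSection θ) :=
    (hp.aestronglyMeasurable_periodize h1.1).restrict.comp_quasiMeasurePreserving
      measurePreserving_torusSection.quasiMeasurePreserving
  have hL2 := hp.lintegral_enorm_sq_periodize_torusSection h1.1
  have hmem : MemLp (fun θ => periodize h (torusSection θ)) 2 := by
    rw [memLp_two_iff_lintegral_enorm_sq hm, hL2]
    exact (memLp_two_iff_lintegral_enorm_sq h1.1).1 h2
  have hcoeff (n : ι → ℤ) : UnitAddTorus.mFourierCoeff hmem.toLp n =
      UnitAddTorus.mFourierCoeff (fun θ => periodize h (torusSection θ)) n :=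
    integral_congr_ae (hmem.coeFn_toLp.mono fun θ hθ => by simp only [hθ])
  rw [← hL2, ← enorm_sq_toLp hmem, ← lintegral_enorm_sq_coeFn, ← tsum_enorm_sq_mFourierCoeff,
    ← (Equiv.neg (ι → ℤ)).tsum_eq]
  refine tsum_congr fun n => ?_
  rw [hcoeff n, mFourierCoeff_periodize_torusSection h1]
  simp only [mFourier_coe]
  rfl

end FourierSeries

section FourierSeriesProd

variable {p q : Type*}

/-- The dilation `ℝ^(p ⊕ q) → ℝ^p × ℝ^q` by the factors `a` and `c`. -/
def dilate (a : p → ℝ) (c : q → ℝ) (x : p ⊕ q → ℝ) : (p → ℝ) × (q → ℝ) :=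
  (fun i => a i * x (Sum.inl i), fun j => c j * x (Sum.inr j))

theorem measurable_dilate (a : p → ℝ) (c : q → ℝ) : Measurable (dilate a c) := by
  unfold dilate; fun_prop

theorem dilate_add_intCast (a : p → ℝ) (c : q → ℝ) (x : p ⊕ q → ℝ) (k : p ⊕ q → ℤ) :
    dilate a c (x + fun i => (k i : ℝ)) =
      dilate a c x + (fun i => k (Sum.inl i) * a i, fun j => k (Sum.inr j) * c j) := by
  apply Prod.ext <;> ext i <;> simp [dilate] <;> ring

variable [Fintype p] [Fintype q] {a : p → ℝ} {c : q → ℝ}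

theorem prodChar_dilate (ha : ∀ i, a i ≠ 0) (hc : ∀ j, c j ≠ 0) (n : p ⊕ q → ℤ)
    (x : p ⊕ q → ℝ) :
    prodChar (dilate a c x) (fun i => n (Sum.inl i) / a i, fun j => n (Sum.inr j) / c j) =
      Complex.exp (2 * Real.pi * Complex.I * ((∑ i, n i * x i : ℝ) : ℂ)) := by
  have hp (i : p) :
      a i * x (Sum.inl i) * (n (Sum.inl i) / a i) = n (Sum.inl i) * x (Sum.inl i) := by
    have := ha i
    field_simp
  have hq (j : q) :
      c j * x (Sum.inr j) * (n (Sum.inr j) / c j) = n (Sum.inr j) * x (Sum.inr j) := by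
    have := hc j
    field_simp
  simp only [prodChar, dilate, dotProduct, hp, hq, Fintype.sum_sum_type]

theorem smul_map_dilate (ha : ∀ i, 0 < a i) (hc : ∀ j, 0 < c j) :
    ENNReal.ofReal ((∏ i, a i) * ∏ j, c j) • Measure.map (dilate a c) volume = volume := by
  classical
  have hdet : (Matrix.diagonal (Sum.elim a c)).det = (∏ i, a i) * ∏ j, c j := by
    rw [Matrix.det_diagonal, Fintype.prod_sum_type]
    rfl
  have hpos : 0 < (∏ i, a i) * ∏ j, c j :=
    mul_pos (Finset.prod_pos fun i _ => ha i) (Finset.prod_pos fun j _ => hc j)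
  have hdiag := Real.smul_map_diagonal_volume_pi (D := Sum.elim a c) (by rw [hdet]; exact hpos.ne')
  rw [hdet, abs_of_pos hpos] at hdiag
  have hsplit := (volume_measurePreserving_sumPiEquivProdPi (fun _ : p ⊕ q => ℝ)).map_eq
  rw [← hdiag, Measure.map_smul, Measure.map_map (MeasurableEquiv.measurable _)
    (LinearMap.continuous_of_finiteDimensional
      (Matrix.toLin' (Matrix.diagonal (Sum.elim a c)))).measurable] at hsplit
  rw [← hsplit]
  congr 2
  funext x
  apply Prod.ext <;> ext i <;>
  simp [dilate, MeasurableEquiv.coe_sumPiEquivProdPi, Matrix.mulVec_diagonal]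

theorem ofReal_prod_mul_prod_ne_zero (ha : ∀ i, 0 < a i) (hc : ∀ j, 0 < c j) :
    ENNReal.ofReal ((∏ i, a i) * ∏ j, c j) ≠ 0 :=
  (ENNReal.ofReal_pos.2
    (mul_pos (Finset.prod_pos fun i _ => ha i) (Finset.prod_pos fun j _ => hc j))).ne'

theorem map_dilate (ha : ∀ i, 0 < a i) (hc : ∀ j, 0 < c j) :
    Measure.map (dilate a c) volume = (ENNReal.ofReal ((∏ i, a i) * ∏ j, c j))⁻¹ • volume := by
  conv_rhs => rw [← smul_map_dilate ha hc, smul_smul,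
    ENNReal.inv_mul_cancel (ofReal_prod_mul_prod_ne_zero ha hc) ENNReal.ofReal_ne_top, one_smul]

theorem quasiMeasurePreserving_dilate (ha : ∀ i, 0 < a i) (hc : ∀ j, 0 < c j) :
    Measure.QuasiMeasurePreserving (dilate a c) := by
  refine ⟨measurable_dilate a c, ?_⟩
  rw [map_dilate ha hc]
  exact Measure.smul_absolutelyContinuous

theorem memLp_comp_dilate (ha : ∀ i, 0 < a i) (hc : ∀ j, 0 < c j) {r : ℝ≥0∞}
    {h : (p → ℝ) × (q → ℝ) → ℂ} (hh : MemLp h r) : MemLp (fun x => h (dilate a c x)) r := by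
  refine MemLp.comp_of_map ?_ (measurable_dilate a c).aemeasurable
  rw [map_dilate ha hc]
  exact hh.smul_measure (ENNReal.inv_ne_top.2 (ofReal_prod_mul_prod_ne_zero ha hc))

theorem lintegral_eq_mul_lintegral_dilate (ha : ∀ i, 0 < a i) (hc : ∀ j, 0 < c j)
    {g : (p → ℝ) × (q → ℝ) → ℝ≥0∞} (hg : AEMeasurable g) :
    ∫⁻ ξ, g ξ = ENNReal.ofReal ((∏ i, a i) * ∏ j, c j) * ∫⁻ x, g (dilate a c x) := by
  conv_lhs => rw [← smul_map_dilate ha hc]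
  rw [lintegral_smul_measure, smul_eq_mul, lintegral_map' _ (measurable_dilate a c).aemeasurable]
  rw [map_dilate ha hc]
  exact hg.smul_measure _

theorem integral_eq_smul_integral_dilate (ha : ∀ i, 0 < a i) (hc : ∀ j, 0 < c j)
    {g : (p → ℝ) × (q → ℝ) → ℂ} (hg : AEStronglyMeasurable g) :
    ∫ ξ, g ξ = ((∏ i, a i) * ∏ j, c j) • ∫ x, g (dilate a c x) := by
  have hpos : 0 ≤ (∏ i, a i) * ∏ j, c j :=
    mul_nonneg (Finset.prod_nonneg fun i _ => (ha i).le) (Finset.prod_nonneg fun j _ => (hc j).le)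
  conv_lhs => rw [← smul_map_dilate ha hc]
  rw [integral_smul_measure, ENNReal.toReal_ofReal hpos,
    integral_map (measurable_dilate a c).aemeasurable]
  rw [map_dilate ha hc]
  exact hg.smul_measure _

theorem isPacking_comp_dilate (ha : ∀ i, 0 < a i) (hc : ∀ j, 0 < c j)
    {h : (p → ℝ) × (q → ℝ) → ℂ}
    (hp : ∀ᵐ ξ, ∀ n : (p → ℤ) × (q → ℤ), n ≠ 0 →
      h ξ = 0 ∨ h (ξ + (fun i => n.1 i * a i, fun j => n.2 j * c j)) = 0) :
    IsPacking fun x => h (dilate a c x) := by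
  filter_upwards [(quasiMeasurePreserving_dilate ha hc).ae hp] with x hx k hk
  rw [dilate_add_intCast]
  refine hx (Equiv.sumArrowEquivProdArrow p q ℤ k) fun h0 => hk ?_
  exact (Equiv.sumArrowEquivProdArrow p q ℤ).injective h0

theorem tsum_enorm_sq_integral_prodChar_mul (ha : ∀ i, 0 < a i) (hc : ∀ j, 0 < c j)
    {h : (p → ℝ) × (q → ℝ) → ℂ} (h1 : Integrable h) (h2 : MemLp h 2)
    (hp : ∀ᵐ ξ, ∀ n : (p → ℤ) × (q → ℤ), n ≠ 0 →
      h ξ = 0 ∨ h (ξ + (fun i => n.1 i * a i, fun j => n.2 j * c j)) = 0) :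
    ∑' n : (p → ℤ) × (q → ℤ),
      ‖∫ ξ, prodChar ξ (fun i => n.1 i / a i, fun j => n.2 j / c j) * h ξ‖ₑ ^ 2 =
      ENNReal.ofReal ((∏ i, a i) * ∏ j, c j) * ∫⁻ ξ, ‖h ξ‖ₑ ^ 2 := by
  have hpos : 0 ≤ (∏ i, a i) * ∏ j, c j :=
    mul_nonneg (Finset.prod_nonneg fun i _ => (ha i).le) (Finset.prod_nonneg fun j _ => (hc j).le)
  have hcoeff (n : p ⊕ q → ℤ) :
      ∫ ξ, prodChar ξ (fun i => n (Sum.inl i) / a i, fun j => n (Sum.inr j) / c j) * h ξ =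
        ((∏ i, a i) * ∏ j, c j) • ∫ x,
          Complex.exp (2 * Real.pi * Complex.I * ((∑ i, n i * x i : ℝ) : ℂ)) *
            h (dilate a c x) := by
    rw [integral_eq_smul_integral_dilate ha hc]
    · simp only [prodChar_dilate (fun i => (ha i).ne') fun j => (hc j).ne']
    · exact (continuous_prodChar.comp
        (continuous_id.prodMk continuous_const)).aestronglyMeasurable.mul h1.1
  have hparseval := (isPacking_comp_dilate ha hc hp).tsum_enorm_sq_fourier
    (memLp_one_iff_integrable.1 (memLp_comp_dilate ha hc (memLp_one_iff_integrable.2 h1)))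
    (memLp_comp_dilate ha hc h2)
  rw [lintegral_eq_mul_lintegral_dilate ha hc (h1.1.enorm.pow_const 2), ← hparseval, ← mul_assoc,
    ← ENNReal.tsum_mul_left, ← (Equiv.sumArrowEquivProdArrow p q ℤ).tsum_eq]
  refine tsum_congr fun n => (congrArg (‖·‖ₑ ^ 2) (hcoeff n)).trans ?_
  rw [enorm_smul, mul_pow, Real.enorm_of_nonneg hpos, ← sq]

end FourierSeriesProd

section MaximalPacking

variable {X G H : Type*} [AddGroup G] [AddGroup H]

/-- The set `E` meets every orbit of `α` at most once, and every point of `E` has trivial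
stabilizer. The family of maps `α` is meant to be an action of the group `G`. -/
def PacksUnder (α : G → X → X) (E : Set X) : Prop :=
  ∀ ⦃x g⦄, x ∈ E → α g x ∈ E → g = 0

theorem PacksUnder.union {α : G → X → X} (hα : ∀ g x, α (-g) (α g x) = x) {E F : Set X}
    (hE : PacksUnder α E) (hF : PacksUnder α F) (hFE : ∀ x ∈ F, ∀ g, α g x ∉ E) :
    PacksUnder α (E ∪ F) := by
  rintro x g (hx | hx) (hgx | hgx)
  · exact hE hx hgx
  · exact absurd (by rwa [hα]) (hFE _ hgx (-g))
  · exact absurd hgx (hFE x hx g)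
  · exact hF hx hgx

theorem PacksUnder.mono {α : G → X → X} {E F : Set X} (hF : PacksUnder α F) (hEF : E ⊆ F) :
    PacksUnder α E :=
  fun _ _ hx hgx => hF (hEF hx) (hEF hgx)

theorem PacksUnder.iUnion_of_monotone {α : G → X → X} {E : ℕ → Set X} (hE : Monotone E)
    (h : ∀ n, PacksUnder α (E n)) : PacksUnder α (⋃ n, E n) := by
  intro x g hx hgx
  obtain ⟨i, hi⟩ := Set.mem_iUnion.1 hx
  obtain ⟨j, hj⟩ := Set.mem_iUnion.1 hgx
  exact h (max i j) (hE (le_max_left i j) hi) (hE (le_max_right i j) hj)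

/-- The `n`-th stage of the greedy construction of a set that packs under both `α` and `β`: the
points of the `n`-th piece whose orbits avoid the set built so far are added. -/
def greedySet (α : G → X → X) (β : H → X → X) (piece : ℕ → Set X) : ℕ → Set X
  | 0 => ∅
  | n + 1 => greedySet α β piece n ∪ {x ∈ piece n |
      (∀ g, α g x ∉ greedySet α β piece n) ∧ ∀ r, β r x ∉ greedySet α β piece n}

variable {α : G → X → X} {β : H → X → X} {piece : ℕ → Set X}

omit [AddGroup G] [AddGroup H] in
theorem greedySet_mono (α : G → X → X) (β : H → X → X) (piece : ℕ → Set X) :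
    Monotone (greedySet α β piece) :=
  monotone_nat_of_le_succ fun _ => Set.subset_union_left

omit [AddGroup G] [AddGroup H] in
theorem greedySet_comm (α : G → X → X) (β : H → X → X) (piece : ℕ → Set X) (n : ℕ) :
    greedySet α β piece n = greedySet β α piece n := by
  induction n with
  | zero => rfl
  | succ n ih => simp only [greedySet, ih, and_comm]

omit [AddGroup H] in
theorem packsUnder_greedySet (hα : ∀ g x, α (-g) (α g x) = x) (hp : ∀ n, PacksUnder α (piece n))
    (n : ℕ) : PacksUnder α (greedySet α β piece n) := by
  induction n with
  | zero => exact fun x _ hx => absurd hx (Set.notMem_empty x)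
  | succ n ih => exact ih.union hα ((hp n).mono fun _ hx => hx.1) fun _ hx => hx.2.1

omit [AddGroup G] [AddGroup H] in
theorem measurableSet_greedySet [MeasurableSpace X] [Countable G] [Countable H]
    (hα : ∀ g, Measurable (α g)) (hβ : ∀ r, Measurable (β r))
    (hp : ∀ n, MeasurableSet (piece n)) (n : ℕ) : MeasurableSet (greedySet α β piece n) := by
  induction n with
  | zero => exact MeasurableSet.empty
  | succ n ih =>
    have hαm : MeasurableSet {x | ∀ g, α g x ∉ greedySet α β piece n} := by
      rw [Set.ofPred_forall]
      exact .iInter fun g => (hα g ih).compl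
    have hβm : MeasurableSet {x | ∀ r, β r x ∉ greedySet α β piece n} := by
      rw [Set.ofPred_forall]
      exact .iInter fun r => (hβ r ih).compl
    exact ih.union ((hp n).inter (hαm.inter hβm))

theorem exists_maximal_packing [MeasurableSpace X] [Countable G] [Countable H]
    (hα : ∀ g, Measurable (α g)) (hβ : ∀ r, Measurable (β r)) (hα0 : ∀ x, α 0 x = x)
    (hα' : ∀ g x, α (-g) (α g x) = x) (hβ' : ∀ r x, β (-r) (β r x) = x)
    (hpm : ∀ n, MeasurableSet (piece n)) (hpα : ∀ n, PacksUnder α (piece n))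
    (hpβ : ∀ n, PacksUnder β (piece n)) :
    ∃ E, MeasurableSet E ∧ PacksUnder α E ∧ PacksUnder β E ∧
      ∀ x ∈ ⋃ n, piece n, (∃ g, α g x ∈ E) ∨ ∃ r, β r x ∈ E := by
  have hmono := greedySet_mono α β piece
  refine ⟨⋃ n, greedySet α β piece n, .iUnion (measurableSet_greedySet hα hβ hpm),
    .iUnion_of_monotone hmono (packsUnder_greedySet hα' hpα),
    .iUnion_of_monotone hmono fun n => greedySet_comm α β piece n ▸ packsUnder_greedySet hβ' hpβ n,
    fun x hx => ?_⟩
  obtain ⟨n, hn⟩ := Set.mem_iUnion.1 hx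
  by_contra! hcon
  have hx : x ∈ greedySet α β piece (n + 1) :=
    .inr ⟨hn, fun g hg => hcon.1 g (Set.mem_iUnion.2 ⟨n, hg⟩),
      fun r hr => hcon.2 r (Set.mem_iUnion.2 ⟨n, hr⟩)⟩
  exact hcon.1 0 (by rw [hα0]; exact Set.mem_iUnion.2 ⟨_, hx⟩)

end MaximalPacking

section Density

variable {V : Type*} [AddCommGroup V] {L L' : AddSubgroup V}

/-- The union of the translates of `A` by the elements of `L`. -/
def saturation (L : AddSubgroup V) (A : Set V) : Set V := {x | ∃ k : L, k +ᵥ x ∈ A}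

theorem subset_saturation (L : AddSubgroup V) (A : Set V) : A ⊆ saturation L A :=
  fun x hx => ⟨0, by rwa [zero_vadd]⟩

theorem vadd_mem_saturation_iff (A : Set V) (k : L) (x : V) :
    k +ᵥ x ∈ saturation L A ↔ x ∈ saturation L A := by
  constructor
  · rintro ⟨l, hl⟩
    exact ⟨l + k, by rwa [add_vadd]⟩
  · rintro ⟨l, hl⟩
    exact ⟨l - k, by rwa [vadd_vadd, sub_add_cancel]⟩

theorem vadd_mem_saturation_iff_of_invariant {A : Set V} (hA : ∀ (k : L) x, k +ᵥ x ∈ A ↔ x ∈ A)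
    (k : L) (x : V) : k +ᵥ x ∈ saturation L' A ↔ x ∈ saturation L' A :=
  exists_congr fun l => by rw [vadd_comm, hA]

theorem saturation_inter_of_invariant (E : Set V) {A : Set V}
    (hA : ∀ (k : L) x, k +ᵥ x ∈ A ↔ x ∈ A) : saturation L (E ∩ A) = saturation L E ∩ A := by
  ext x
  simp only [saturation, Set.mem_inter_iff, hA, exists_and_right, Set.mem_ofPred_eq]

theorem saturation_subset_saturation {A B : Set V} (h : A ⊆ saturation L B) :
    saturation L A ⊆ saturation L B :=
  fun _ ⟨k, hk⟩ => (vadd_mem_saturation_iff B k _).1 (h hk)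

variable [MeasurableSpace V] [MeasurableAdd₂ V] {μ : Measure V}
  [Countable L] [Countable L'] {D D' : Set V}

theorem measurableSet_saturation {A : Set V} (hA : MeasurableSet A) :
    MeasurableSet (saturation L A) := by
  simp only [saturation, Set.ofPred_exists]
  exact .iUnion fun k => measurable_const_vadd k hA

variable [μ.IsAddLeftInvariant]

theorem measure_eq_measure_saturation_inter (hD : IsAddFundamentalDomain L D μ) {F : Set V}
    (hF : MeasurableSet F) (hp : PacksUnder (fun (k : L) x => k +ᵥ x) F) :
    μ F = μ (saturation L F ∩ D) := by
  have hunion : saturation L F ∩ D = ⋃ k : L, (k +ᵥ F) ∩ D := by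
    ext x
    simp only [saturation, Set.mem_inter_iff, Set.mem_iUnion, Set.mem_vadd_set_iff_neg_vadd_mem,
      Set.mem_ofPred_eq, exists_and_right]
    exact and_congr_left fun _ => (Equiv.neg L).exists_congr_right.symm
  rw [hD.measure_eq_tsum, hunion, measure_iUnion₀]
  · refine fun k l hkl => Disjoint.aedisjoint (Set.disjoint_left.2 ?_)
    rintro x ⟨hk, -⟩ ⟨hl, -⟩
    rw [Set.mem_vadd_set_iff_neg_vadd_mem] at hk hl
    refine hkl (neg_add_eq_zero.1 (hp (g := -k + l) hl ?_))
    change (-k + l) +ᵥ (-l +ᵥ x) ∈ F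
    rwa [vadd_vadd, add_neg_cancel_right]
  · exact fun k => (hF.const_vadd k).nullMeasurableSet.inter hD.nullMeasurableSet

theorem measure_inter_preimage_add_right (hD : IsAddFundamentalDomain L D μ) {A : Set V}
    (hA : MeasurableSet A) (hL : ∀ (k : L) x, k +ᵥ x ∈ A ↔ x ∈ A) (y : V) :
    μ ((fun x => x + y) ⁻¹' A ∩ D) = μ (A ∩ D) := by
  have hshift : (fun x => x + y) ⁻¹' (A ∩ (y +ᵥ D)) = (fun x => x + y) ⁻¹' A ∩ D := by
    ext x
    simp [Set.mem_vadd_set_iff_neg_vadd_mem, add_comm x]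
  rw [← (hD.vadd_of_comm y).measure_set_eq hD hA fun k => Set.ext (hL k), ← hshift]
  exact measure_preimage_add_right μ y _

theorem measure_inter_mul_eq [SFinite μ] (hD : IsAddFundamentalDomain L D μ)
    (hD' : IsAddFundamentalDomain L' D' μ) {A : Set V} (hA : MeasurableSet A)
    (hL : ∀ (k : L) x, k +ᵥ x ∈ A ↔ x ∈ A) (hL' : ∀ (k : L') x, k +ᵥ x ∈ A ↔ x ∈ A) :
    μ (A ∩ D) * μ D' = μ (A ∩ D') * μ D := by
  have hconst {L : AddSubgroup V} [Countable L] {D : Set V} (hD : IsAddFundamentalDomain L D μ)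
      (hL : ∀ (k : L) x, k +ᵥ x ∈ A ↔ x ∈ A) (y : V) :
      ∫⁻ x in D, A.indicator 1 (x + y) ∂μ = μ (A ∩ D) := by
    rw [← measure_inter_preimage_add_right hD hA hL y,
      ← Measure.restrict_apply (measurable_add_const y hA),
      ← lintegral_indicator_one (measurable_add_const y hA)]
    rfl
  have hswap := lintegral_lintegral_swap (μ := μ.restrict D) (ν := μ.restrict D')
    (f := fun x y => A.indicator (1 : V → ℝ≥0∞) (x + y))
    ((measurable_one.indicator hA).comp (measurable_fst.add measurable_snd)).aemeasurable
  have hconst' (x : V) : ∫⁻ y in D', A.indicator 1 (x + y) ∂μ = μ (A ∩ D') := by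
    simp only [add_comm x]
    exact hconst hD' hL' x
  simp only [hconst', hconst hD hL, lintegral_const, Measure.restrict_apply_univ] at hswap
  exact hswap.symm

theorem measure_compl_saturation_inter_eq_zero [SFinite μ] (hD : IsAddFundamentalDomain L D μ)
    (hD' : IsAddFundamentalDomain L' D' μ) (hle : μ D ≤ μ D') (hD0 : μ D ≠ 0)
    (hfin' : μ D' ≠ ∞) {E : Set V} (hE : MeasurableSet E)
    (hp : PacksUnder (fun (k : L) x => k +ᵥ x) E) (hp' : PacksUnder (fun (k : L') x => k +ᵥ x) E)
    (hmax : (saturation L E)ᶜ ⊆ saturation L' E) :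
    μ ((saturation L E)ᶜ ∩ D) = 0 := by
  set A := (saturation L E)ᶜ with hA
  set A' := saturation L' A
  have hAm : MeasurableSet A := (measurableSet_saturation hE).compl
  have hA'm : MeasurableSet A' := measurableSet_saturation hAm
  have hAL (k : L) (x : V) : k +ᵥ x ∈ A ↔ x ∈ A := not_congr (vadd_mem_saturation_iff E k x)
  have hA'L : ∀ (k : L) x, k +ᵥ x ∈ A' ↔ x ∈ A' := vadd_mem_saturation_iff_of_invariant hAL
  have hA'L' : ∀ (k : L') x, k +ᵥ x ∈ A' ↔ x ∈ A' := vadd_mem_saturation_iff A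
  have hfull : μ (E ∩ A') = μ (A' ∩ D') := by
    rw [measure_eq_measure_saturation_inter hD' (hE.inter hA'm)
      (hp'.mono Set.inter_subset_left), saturation_inter_of_invariant E hA'L',
      Set.inter_eq_right.2 (saturation_subset_saturation hmax)]
  have hpart : μ (E ∩ A') + μ (A ∩ D) = μ (A' ∩ D) := by
    have hinter : A' ∩ D ∩ A = A ∩ D := by
      rw [Set.inter_right_comm, Set.inter_eq_right.2 (subset_saturation L' A)]
    have hdiff : (A' ∩ D) \ A = saturation L E ∩ A' ∩ D := by
      rw [Set.sdiff_eq, hA, compl_compl, Set.inter_comm, Set.inter_assoc]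
    rw [measure_eq_measure_saturation_inter hD (hE.inter hA'm) (hp.mono Set.inter_subset_left),
      saturation_inter_of_invariant E hA'L, ← hdiff, ← hinter, measure_sdiff_add_inter _ hAm]
  have hdens : μ (A' ∩ D) ≤ μ (A' ∩ D') := by
    refine (ENNReal.mul_le_mul_iff_left hD0 (ne_top_of_le_ne_top hfin' hle)).1 ?_
    exact (mul_le_mul_right hle _).trans (measure_inter_mul_eq hD hD' hA'm hA'L hA'L').le
  have hfin : μ (A' ∩ D') ≠ ∞ := ne_top_of_le_ne_top hfin' (measure_mono Set.inter_subset_right)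
  refine le_antisymm ((ENNReal.add_le_add_iff_left hfin).1 ?_) bot_le
  rwa [← hfull, hpart, hfull, add_zero]

/-- The smaller covolume of `L` is what makes the maximal packing cover: on the part of the space
that it leaves uncovered modulo `L`, it would be a fundamental domain of the sparser `L'`. -/
theorem isAddFundamentalDomain_of_maximal_packing [SFinite μ] (hD : IsAddFundamentalDomain L D μ)
    (hD' : IsAddFundamentalDomain L' D' μ) (hle : μ D ≤ μ D') (hD0 : μ D ≠ 0)
    (hfin' : μ D' ≠ ∞) {E : Set V} (hE : MeasurableSet E)
    (hp : PacksUnder (fun (k : L) x => k +ᵥ x) E) (hp' : PacksUnder (fun (k : L') x => k +ᵥ x) E)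
    (hmax : (saturation L E)ᶜ ⊆ saturation L' E) :
    IsAddFundamentalDomain L E μ := by
  have hnull : μ (saturation L E)ᶜ = 0 := by
    refine hD.measure_zero_of_invariant _ (fun k => Set.ext fun x => ?_)
      (measure_compl_saturation_inter_eq_zero hD hD' hle hD0 hfin' hE hp hp' hmax)
    rw [Set.mem_vadd_set_iff_neg_vadd_mem]
    exact not_congr (vadd_mem_saturation_iff E (-k) x)
  refine .mk'' hE.nullMeasurableSet ?_ (fun k hk => ?_) fun k =>
    (measurePreserving_vadd k μ).quasiMeasurePreserving
  · filter_upwards [measure_eq_zero_iff_ae_notMem.1 hnull] with x hx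
    exact not_not.1 hx
  · refine Disjoint.aedisjoint (Set.disjoint_left.2 fun x hx hxE => hk ?_)
    rw [Set.mem_vadd_set_iff_neg_vadd_mem] at hx
    exact neg_eq_zero.1 (hp hxE hx)

end Density

section MatrixLattice

variable {ι : Type*}

/-- The lattice `C ℤ^ι`. -/
def matrixLattice (C : Matrix ι ι ℝ) : AddSubgroup (ι → ℝ) :=
  (Submodule.span ℤ (Set.range C.col)).toAddSubgroup

theorem mem_matrixLattice [Fintype ι] {C : Matrix ι ι ℝ} {x : ι → ℝ} :
    x ∈ matrixLattice C ↔ ∃ n : ι → ℤ, C *ᵥ (fun i => (n i : ℝ)) = x := by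
  simp only [matrixLattice, Submodule.mem_toAddSubgroup, Submodule.mem_span_range_iff_exists_fun,
    Matrix.mulVec_eq_sum, op_smul_eq_smul, ← Int.cast_smul_eq_zsmul ℝ]
  rfl

instance countable_matrixLattice [Finite ι] (C : Matrix ι ι ℝ) : Countable (matrixLattice C) :=
  have := Fintype.ofFinite ι
  Function.Surjective.countable (f := fun n : ι → ℤ => (⟨_, mem_matrixLattice.2 ⟨n, rfl⟩⟩ :
    matrixLattice C)) fun x => (mem_matrixLattice.1 x.2).imp fun _ => Subtype.ext

variable [Fintype ι]

theorem mulVec_intCast_neg (C : Matrix ι ι ℝ) (n : ι → ℤ) :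
    (C *ᵥ fun i => (((-n) i : ℤ) : ℝ)) = -(C *ᵥ fun i => (n i : ℝ)) := by
  rw [← Matrix.mulVec_neg]
  exact congrArg _ (funext fun i => Int.cast_neg (n i))

theorem mulVec_intCast_sub (C : Matrix ι ι ℝ) (n l : ι → ℤ) :
    (C *ᵥ fun i => (((n - l) i : ℤ) : ℝ)) =
      (C *ᵥ fun i => (n i : ℝ)) - C *ᵥ fun i => (l i : ℝ) := by
  rw [← Matrix.mulVec_sub]
  exact congrArg _ (funext fun i => Int.cast_sub (n i) (l i))

variable [DecidableEq ι]

theorem exists_isAddFundamentalDomain_matrixLattice {C : Matrix ι ι ℝ} (hC : C.det ≠ 0) :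
    ∃ D : Set (ι → ℝ), IsAddFundamentalDomain (matrixLattice C) D ∧
      volume D = ENNReal.ofReal |C.det| := by
  have hli : LinearIndependent ℝ C.col :=
    Matrix.linearIndependent_cols_iff_isUnit.2 ((Matrix.isUnit_iff_isUnit_det C).2 hC.isUnit)
  classical
  let e := basisOfPiSpaceOfLinearIndependent hli
  have he : (e : ι → ι → ℝ) = C.col := coe_basisOfPiSpaceOfLinearIndependent hli
  refine ⟨ZSpan.fundamentalDomain e, ?_, ?_⟩
  · rw [matrixLattice, ← he]
    exact ZSpan.isAddFundamentalDomain' e volume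
  · rw [ZSpan.volume_fundamentalDomain, he, ← Matrix.det_transpose]
    rfl

theorem volume_eq_of_isAddFundamentalDomain {C : Matrix ι ι ℝ} (hC : C.det ≠ 0) {F : Set (ι → ℝ)}
    (hF : IsAddFundamentalDomain (matrixLattice C) F) : volume F = ENNReal.ofReal |C.det| := by
  obtain ⟨D, hD, hDv⟩ := exists_isAddFundamentalDomain_matrixLattice hC
  exact (hF.measure_eq hD).trans hDv

theorem PacksUnder.eq_zero_of_mulVec {C : Matrix ι ι ℝ} (hC : C.det ≠ 0) {F : Set (ι → ℝ)}
    (hF : PacksUnder (fun (k : matrixLattice C) x => k +ᵥ x) F) {x x' : ι → ℝ} {n : ι → ℤ}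
    (hx : x ∈ F) (hx' : x' ∈ F) (h : x' = x + C *ᵥ fun i => (n i : ℝ)) : n = 0 := by
  have hmem : ((⟨_, mem_matrixLattice.2 ⟨n, rfl⟩⟩ : matrixLattice C) +ᵥ x) ∈ F := by
    rwa [AddSubgroup.vadd_def, vadd_eq_add, add_comm, ← h]
  have hzero : (C *ᵥ fun i => (n i : ℝ)) = 0 := congrArg Subtype.val (hF hx hmem)
  have hn := Matrix.eq_zero_of_mulVec_eq_zero hC hzero
  exact funext fun i => Int.cast_eq_zero.1 (congrFun hn i)

theorem ae_existsUnique_sub_mulVec_mem {C : Matrix ι ι ℝ} (hC : C.det ≠ 0) {F : Set (ι → ℝ)}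
    (hF : IsAddFundamentalDomain (matrixLattice C) F)
    (hp : PacksUnder (fun (k : matrixLattice C) x => k +ᵥ x) F) :
    ∀ᵐ x, ∃! n : ι → ℤ, x - (C *ᵥ fun i => (n i : ℝ)) ∈ F := by
  filter_upwards [hF.ae_covers] with x ⟨k, hk⟩
  obtain ⟨n, hn⟩ := mem_matrixLattice.1 k.2
  have hmem : x - (C *ᵥ fun i => (((-n) i : ℤ) : ℝ)) ∈ F := by
    rwa [mulVec_intCast_neg, hn, sub_neg_eq_add, add_comm]
  refine ⟨-n, hmem, fun l hl => sub_eq_zero.1 (hp.eq_zero_of_mulVec hC hl hmem ?_)⟩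
  rw [mulVec_intCast_sub, sub_add_sub_cancel]

end MatrixLattice

section Tile

variable {ι Λ : Type*} [Fintype ι]

/-- The translation by the lattice vector `C l n` in the fibre over `l`. -/
def latticeTranslate (C : Λ → Matrix ι ι ℝ) (n : ι → ℤ) (w : Λ × (ι → ℝ)) : Λ × (ι → ℝ) :=
  (w.1, w.2 + C w.1 *ᵥ fun i => (n i : ℝ))

theorem latticeTranslate_zero (C : Λ → Matrix ι ι ℝ) (w : Λ × (ι → ℝ)) :
    latticeTranslate C 0 w = w := by
  simp [latticeTranslate, ← Pi.zero_def]

theorem latticeTranslate_neg (C : Λ → Matrix ι ι ℝ) (n : ι → ℤ) (w : Λ × (ι → ℝ)) :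
    latticeTranslate C (-n) (latticeTranslate C n w) = w := by
  simp only [latticeTranslate, mulVec_intCast_neg, add_neg_cancel_right]

theorem PacksUnder.matrixLattice {C : Λ → Matrix ι ι ℝ} {E : Set (Λ × (ι → ℝ))}
    (hE : PacksUnder (latticeTranslate C) E) (l : Λ) :
    PacksUnder (fun (k : BandLimited.matrixLattice (C l)) x => k +ᵥ x) {x | (l, x) ∈ E} := by
  rintro x ⟨k, hk⟩ hx hkx
  obtain ⟨n, rfl⟩ := mem_matrixLattice.1 hk
  have hn : n = 0 := hE (x := (l, x)) (g := n) hx (by rwa [latticeTranslate, add_comm])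
  subst hn
  ext i
  simp [← Pi.zero_def]

variable [MeasurableSpace Λ] {C C' : Λ → Matrix ι ι ℝ}

theorem measurable_mulVec (hC : ∀ i j, Measurable fun l => C l i j) :
    Measurable fun w : Λ × (ι → ℝ) => C w.1 *ᵥ w.2 := by
  refine measurable_pi_lambda _ fun i => ?_
  simp only [Matrix.mulVec, dotProduct]
  exact Finset.measurable_fun_sum _ fun j _ =>
    ((hC i j).comp measurable_fst).mul ((measurable_pi_apply j).comp measurable_snd)

theorem measurable_latticeTranslate (hC : ∀ i j, Measurable fun l => C l i j) (n : ι → ℤ) :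
    Measurable (latticeTranslate C n) :=
  measurable_fst.prodMk (measurable_snd.add
    ((measurable_mulVec hC).comp (measurable_fst.prodMk measurable_const)))

variable [DecidableEq ι]

theorem measurable_det (hC : ∀ i j, Measurable fun l => C l i j) :
    Measurable fun l => (C l).det := by
  simp only [Matrix.det_apply]
  exact Finset.measurable_fun_sum _ fun s _ =>
    (Finset.measurable_fun_prod _ fun i _ => hC _ _).const_smul _

theorem measurable_matrix_inv (hC : ∀ i j, Measurable fun l => C l i j) (i j : ι) :
    Measurable fun l => (C l)⁻¹ i j := by
  simp only [Matrix.inv_def, Matrix.smul_apply, Ring.inverse_eq_inv', smul_eq_mul,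
    Matrix.adjugate_apply]
  refine (measurable_det hC).inv.mul (measurable_det fun i' j' => ?_)
  by_cases h : i' = j
  · subst h
    simp
  · simpa [Matrix.updateRow_ne h] using hC i' j'

/-- The part over the invertible `C l` of the cells `C l (n + [0, 1)^ι)`. -/
def latticeCell (C : Λ → Matrix ι ι ℝ) (n : ι → ℤ) : Set (Λ × (ι → ℝ)) :=
  {w | (C w.1).det ≠ 0 ∧ ∀ i, ⌊((C w.1)⁻¹ *ᵥ w.2) i⌋ = n i}

theorem measurableSet_latticeCell (hC : ∀ i j, Measurable fun l => C l i j) (n : ι → ℤ) :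
    MeasurableSet (latticeCell C n) := by
  have hfloor (i : ι) : Measurable fun w : Λ × (ι → ℝ) => ⌊((C w.1)⁻¹ *ᵥ w.2) i⌋ :=
    Int.measurable_floor.comp
      ((measurable_pi_apply i).comp (measurable_mulVec (measurable_matrix_inv hC)))
  rw [latticeCell, Set.ofPred_and, Set.ofPred_forall]
  exact ((measurable_det hC).comp measurable_fst (measurableSet_singleton 0).compl).inter
    (.iInter fun i => hfloor i (measurableSet_singleton (n i)))

omit [MeasurableSpace Λ] in
theorem packsUnder_latticeCell (C : Λ → Matrix ι ι ℝ) (n : ι → ℤ) :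
    PacksUnder (latticeTranslate C) (latticeCell C n) := by
  rintro ⟨l, x⟩ g ⟨hl, hx⟩ ⟨-, hgx⟩
  ext i
  have hi := hgx i
  rw [latticeTranslate, Matrix.mulVec_add, Matrix.mulVec_mulVec,
    Matrix.nonsing_inv_mul _ (isUnit_iff_ne_zero.2 hl), Matrix.one_mulVec, Pi.add_apply,
    Int.floor_add_intCast, hx i] at hi
  simpa using hi

omit [MeasurableSpace Λ] in
theorem exists_mem_latticeCell {w : Λ × (ι → ℝ)} (hw : (C w.1).det ≠ 0) :
    ∃ n, w ∈ latticeCell C n :=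
  ⟨_, hw, fun _ => rfl⟩

theorem exists_maximal_lattice_packing (hC : ∀ i j, Measurable fun l => C l i j)
    (hC' : ∀ i j, Measurable fun l => C' l i j) :
    ∃ E : Set (Λ × (ι → ℝ)), MeasurableSet E ∧ PacksUnder (latticeTranslate C) E ∧
      PacksUnder (latticeTranslate C') E ∧
      ∀ w : Λ × (ι → ℝ), (C w.1).det ≠ 0 → (C' w.1).det ≠ 0 →
        (∃ n, latticeTranslate C n w ∈ E) ∨ ∃ n, latticeTranslate C' n w ∈ E := by
  obtain ⟨f, hf⟩ := exists_surjective_nat ((ι → ℤ) × (ι → ℤ))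
  obtain ⟨E, hEm, hE, hE', hmax⟩ := exists_maximal_packing
    (piece := fun k => latticeCell C (f k).1 ∩ latticeCell C' (f k).2)
    (measurable_latticeTranslate hC) (measurable_latticeTranslate hC')
    (latticeTranslate_zero C) (latticeTranslate_neg C) (latticeTranslate_neg C')
    (fun k => (measurableSet_latticeCell hC _).inter (measurableSet_latticeCell hC' _))
    (fun k => (packsUnder_latticeCell C _).mono Set.inter_subset_left)
    (fun k => (packsUnder_latticeCell C' _).mono Set.inter_subset_right)
  refine ⟨E, hEm, hE, hE', fun w hw hw' => hmax w (Set.mem_iUnion.2 ?_)⟩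
  obtain ⟨n, hn⟩ := exists_mem_latticeCell hw
  obtain ⟨n', hn'⟩ := exists_mem_latticeCell hw'
  obtain ⟨k, hk⟩ := hf (n, n')
  exact ⟨k, by rw [hk]; exact ⟨hn, hn'⟩⟩

theorem exists_measurable_tile (hC : ∀ i j, Measurable fun l => C l i j)
    (hC' : ∀ i j, Measurable fun l => C' l i j) :
    ∃ E : Set (Λ × (ι → ℝ)), MeasurableSet E ∧
      (∀ l, PacksUnder (fun (k : matrixLattice (C l)) x => k +ᵥ x) {x | (l, x) ∈ E}) ∧
      (∀ l, PacksUnder (fun (k : matrixLattice (C' l)) x => k +ᵥ x) {x | (l, x) ∈ E}) ∧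
      ∀ l, (C l).det ≠ 0 → (C' l).det ≠ 0 → |(C l).det| ≤ |(C' l).det| →
        IsAddFundamentalDomain (matrixLattice (C l)) {x | (l, x) ∈ E} := by
  obtain ⟨E, hEm, hE, hE', hmax⟩ := exists_maximal_lattice_packing hC hC'
  refine ⟨E, hEm, hE.matrixLattice, hE'.matrixLattice, fun l hl hl' hle => ?_⟩
  obtain ⟨D, hD, hDv⟩ := exists_isAddFundamentalDomain_matrixLattice hl
  obtain ⟨D', hD', hDv'⟩ := exists_isAddFundamentalDomain_matrixLattice hl'
  refine isAddFundamentalDomain_of_maximal_packing hD hD' ?_ ?_ ?_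
    (measurable_prodMk_left hEm) (hE.matrixLattice l) (hE'.matrixLattice l) fun x hx => ?_
  · rw [hDv, hDv']
    exact ENNReal.ofReal_le_ofReal hle
  · rw [hDv]
    exact (ENNReal.ofReal_pos.2 (abs_pos.2 hl)).ne'
  · rw [hDv']
    exact ENNReal.ofReal_ne_top
  · obtain ⟨n, hn⟩ | ⟨n, hn⟩ := hmax (l, x) hl hl'
    · exact absurd ⟨⟨_, mem_matrixLattice.2 ⟨n, rfl⟩⟩, by rwa [latticeTranslate, add_comm] at hn⟩ hx
    · exact ⟨⟨_, mem_matrixLattice.2 ⟨n, rfl⟩⟩, by rwa [latticeTranslate, add_comm] at hn⟩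

end Tile

section FiberwiseMulVec

variable {ι Λ : Type*} [Fintype ι]

/-- The change of variables `(l, t) ↦ (l, M(l) t)`. -/
def fiberwiseMulVec (M : Λ → Matrix ι ι ℝ) (w : Λ × (ι → ℝ)) : Λ × (ι → ℝ) := (w.1, M w.1 *ᵥ w.2)

/-- The change of variables `(l, (t, s)) ↦ (t - s, (l, M(l) t))`. It carries the kernel of the
operator `∫ f(g) π_l(g) dg` to the partial Fourier transform of `f`. -/
def fiberwiseShear (M : Λ → Matrix ι ι ℝ) (w : Λ × ((ι → ℝ) × (ι → ℝ))) :
    (ι → ℝ) × (Λ × (ι → ℝ)) :=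
  (w.2.1 - w.2.2, fiberwiseMulVec M (w.1, w.2.1))

/-- The inverse of `fiberwiseShear M` when `M'(l)` is inverse to `M(l)` for all `l`. -/
def fiberwiseUnshear (M' : Λ → Matrix ι ι ℝ) (w : (ι → ℝ) × (Λ × (ι → ℝ))) :
    Λ × ((ι → ℝ) × (ι → ℝ)) :=
  (w.2.1, (M' w.2.1 *ᵥ w.2.2, M' w.2.1 *ᵥ w.2.2 - w.1))

theorem fiberwiseUnshear_fiberwiseShear [DecidableEq ι] {M : Λ → Matrix ι ι ℝ}
    {w : Λ × ((ι → ℝ) × (ι → ℝ))} (hw : (M w.1).det ≠ 0) :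
    fiberwiseUnshear (fun l => (M l)⁻¹) (fiberwiseShear M w) = w := by
  simp only [fiberwiseUnshear, fiberwiseShear, fiberwiseMulVec, Matrix.mulVec_mulVec,
    Matrix.nonsing_inv_mul _ (isUnit_iff_ne_zero.2 hw), Matrix.one_mulVec, sub_sub_cancel]

variable [MeasurableSpace Λ] {M : Λ → Matrix ι ι ℝ} (hM : ∀ i j, Measurable fun l => M l i j)
include hM

theorem measurable_fiberwiseMulVec : Measurable (fiberwiseMulVec M) :=
  measurable_fst.prodMk (measurable_mulVec hM)

theorem measurable_fiberwiseShear : Measurable (fiberwiseShear M) :=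
  (measurable_snd.fst.sub measurable_snd.snd).prodMk
    ((measurable_fiberwiseMulVec hM).comp (measurable_fst.prodMk measurable_snd.fst))

theorem measurable_fiberwiseUnshear : Measurable (fiberwiseUnshear M) :=
  have h := (measurable_mulVec hM).comp measurable_snd
  measurable_snd.fst.prodMk (h.prodMk (h.sub measurable_fst))

variable [DecidableEq ι] {ν : Measure Λ} (hdet : ∀ᵐ l ∂ν, (M l).det ≠ 0)
include hdet

theorem lintegral_comp_fiberwiseMulVec {g : Λ × (ι → ℝ) → ℝ≥0∞} (hg : Measurable g) :
    ∫⁻ w, g (fiberwiseMulVec M w)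
        ∂((ν.withDensity fun l => ENNReal.ofReal |(M l).det|).prod volume) =
      ∫⁻ w, g w ∂(ν.prod volume) := by
  have hgM : Measurable fun w => g (fiberwiseMulVec M w) := hg.comp (measurable_fiberwiseMulVec hM)
  have hdens : Measurable fun l => ENNReal.ofReal |(M l).det| :=
    (measurable_det hM).abs.ennreal_ofReal
  rw [lintegral_prod _ hgM.aemeasurable, lintegral_prod _ hg.aemeasurable,
    lintegral_withDensity_eq_lintegral_mul _ hdens hgM.lintegral_prod_right']
  refine lintegral_congr_ae ?_
  filter_upwards [hdet] with l hl
  have hlin : Measurable (Matrix.toLin' (M l)) :=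
    (LinearMap.continuous_of_finiteDimensional _).measurable
  have hcov : ∫⁻ t, g (l, M l *ᵥ t) = ENNReal.ofReal |(M l).det⁻¹| * ∫⁻ y, g (l, y) := by
    have h := lintegral_map (μ := volume) (hg.comp (measurable_prodMk_left (x := l))) hlin
    rw [Real.map_matrix_volume_pi_eq_smul_volume_pi hl, lintegral_smul_measure] at h
    exact h.symm
  simp only [Pi.mul_apply, fiberwiseMulVec]
  rw [hcov, ← mul_assoc, ← ENNReal.ofReal_mul (abs_nonneg _), ← abs_mul, mul_inv_cancel₀ hl,
    abs_one, ENNReal.ofReal_one, one_mul]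

theorem measurePreserving_fiberwiseMulVec :
    MeasurePreserving (fiberwiseMulVec M)
      ((ν.withDensity fun l => ENNReal.ofReal |(M l).det|).prod volume) (ν.prod volume) := by
  refine ⟨measurable_fiberwiseMulVec hM, Measure.ext_of_lintegral _ fun g hg => ?_⟩
  rw [lintegral_map hg (measurable_fiberwiseMulVec hM), lintegral_comp_fiberwiseMulVec hM hdet hg]

theorem measurePreserving_fiberwiseShear [SFinite ν] :
    MeasurePreserving (fiberwiseShear M)
      ((ν.withDensity fun l => ENNReal.ofReal |(M l).det|).prod volume)
      ((volume : Measure (ι → ℝ)).prod (ν.prod volume)) := by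
  refine ⟨measurable_fiberwiseShear hM, Measure.ext_of_lintegral _ fun g hg => ?_⟩
  have hgM : Measurable fun w => g (fiberwiseShear M w) := hg.comp (measurable_fiberwiseShear hM)
  have hinner : Measurable fun w => ∫⁻ x, g (x, w) := hg.lintegral_prod_left'
  have hts (l : Λ) : ∫⁻ ts : (ι → ℝ) × (ι → ℝ), g (fiberwiseShear M (l, ts)) =
      ∫⁻ t, ∫⁻ x, g (x, fiberwiseMulVec M (l, t)) := by
    rw [Measure.volume_eq_prod, lintegral_prod (fun ts => g (fiberwiseShear M (l, ts)))
      (hgM.comp measurable_prodMk_left).aemeasurable]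
    exact lintegral_congr fun t =>
      lintegral_sub_left_eq_self (fun x => g (x, fiberwiseMulVec M (l, t))) t
  rw [lintegral_map hg (measurable_fiberwiseShear hM), lintegral_prod _ hgM.aemeasurable]
  simp only [hts]
  rw [← lintegral_prod (fun w => ∫⁻ x, g (x, fiberwiseMulVec M w))
      (hinner.comp (measurable_fiberwiseMulVec hM)).aemeasurable,
    lintegral_comp_fiberwiseMulVec hM hdet hinner, lintegral_prod_symm _ hg.aemeasurable]

end FiberwiseMulVec

theorem finite_setOf_det_add_smul_eq_zero {ι K : Type*} [Fintype ι] [DecidableEq ι] [Field K]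
    (A : Matrix ι ι K) {A₀ : Matrix ι ι K} (h₀ : A₀.det ≠ 0) :
    {r : K | (A + r • A₀).det = 0}.Finite := by
  have hdet (r : K) : (A + r • A₀).det = A₀.det * (-(A₀⁻¹ * A)).charpoly.eval r := by
    rw [Matrix.eval_charpoly, ← Matrix.det_mul, sub_neg_eq_add, mul_add, ← mul_assoc,
      Matrix.mul_nonsing_inv _ h₀.isUnit, one_mul, add_comm, Matrix.scalar_apply,
      ← Matrix.smul_one_eq_diagonal, mul_smul_comm, mul_one]
  refine (Polynomial.finite_setOfPred_isRoot
    (Matrix.charpoly_monic (-(A₀⁻¹ * A))).ne_zero).subset fun r hr => ?_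
  rw [Set.mem_ofPred_eq, hdet] at hr
  exact (mul_eq_zero.1 hr).resolve_left h₀

namespace AdaptedBasis

variable {𝔫 : Type*} [LieRing 𝔫] [LieAlgebra ℝ 𝔫] {m d : ℕ} (β : AdaptedBasis 𝔫 m d)

theorem B_apply (lam : Fin m → ℝ) (i j : Fin d) :
    β.B lam i j = -∑ k, lam k * β.structConst i j k := by
  simp [B, functional, structConst, LinearMap.sum_apply]

theorem B_add_smul (lam lam' : Fin m → ℝ) (r : ℝ) :
    β.B (lam + r • lam') = β.B lam + r • β.B lam' := by
  ext i j
  simp only [B_apply, Matrix.add_apply, Matrix.smul_apply, Pi.add_apply, Pi.smul_apply, smul_eq_mul,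
    add_mul, Finset.sum_add_distrib, mul_neg, Finset.mul_sum, mul_assoc]
  ring

theorem continuous_B_apply (i j : Fin d) : Continuous fun lam => β.B lam i j := by
  simp only [B_apply]
  fun_prop

theorem measurable_B_transpose_apply (i j : Fin d) : Measurable fun lam => (β.B lam)ᵀ i j :=
  (β.continuous_B_apply j i).measurable

theorem continuous_det_B : Continuous fun lam => (β.B lam).det :=
  (continuous_matrix β.continuous_B_apply).matrix_det

theorem dotProduct_bracket (lam : Fin m → ℝ) (x y : Fin d → ℝ) :
    lam ⬝ᵥ β.bracket x y = -(x ⬝ᵥ β.B lam *ᵥ y) := by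
  simp only [dotProduct, bracket, Matrix.mulVec, B_apply, Finset.mul_sum, neg_mul,
    Finset.sum_neg_distrib, mul_neg, neg_neg, Finset.sum_mul]
  rw [Finset.sum_comm]
  refine Finset.sum_congr rfl fun i _ => ?_
  rw [Finset.sum_comm]
  refine Finset.sum_congr rfl fun j _ => Finset.sum_congr rfl fun k _ => ?_
  ring

theorem lie_Z (W : 𝔫) (j : Fin m) : ⁅W, β.Z j⁆ = 0 := by
  have hZ : β.Z j ∈ (LieAlgebra.center ℝ 𝔫).toSubmodule := by
    rw [β.center_eq]
    exact Submodule.subset_span ⟨j, rfl⟩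
  exact (LieModule.mem_maxTrivSubmodule ℝ 𝔫 𝔫 _).1 hZ W

theorem lie_sum_Y_X (y : Fin d → ℝ) (i : Fin d) :
    ⁅∑ j, y j • β.Y j, β.X i⁆ = -∑ k, β.bracket (Pi.single i 1) y k • β.Z k := by
  rw [← N.lie_sum_X_sum_Y, lie_skew]
  simp [Pi.single_apply]

theorem map_lie_sum_Y_X (ℓ : Module.Dual ℝ 𝔫) (y : Fin d → ℝ) (i : Fin d) :
    ℓ ⁅∑ j, y j • β.Y j, β.X i⁆ = (β.B (fun k => ℓ (β.Z k)) *ᵥ y) i := by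
  have h := β.dotProduct_bracket (fun k => ℓ (β.Z k)) (Pi.single i 1) y
  rw [single_one_dotProduct] at h
  rw [lie_sum_Y_X, map_neg, map_sum, ← neg_eq_iff_eq_neg.2 h, neg_inj, dotProduct]
  exact Finset.sum_congr rfl fun k _ => by rw [map_smul, smul_eq_mul, mul_comm]

theorem map_lie_sum_Y_eq_zero {ℓ : Module.Dual ℝ 𝔫} {y : Fin d → ℝ}
    (hy : β.B (fun k => ℓ (β.Z k)) *ᵥ y = 0) (V : 𝔫) : ℓ ⁅∑ j, y j • β.Y j, V⁆ = 0 := by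
  suffices h : ℓ ∘ₗ LieModule.toEnd ℝ 𝔫 𝔫 (∑ j, y j • β.Y j) = 0 from LinearMap.congr_fun h V
  refine β.basis.ext fun s => ?_
  simp only [LinearMap.comp_apply, LieModule.toEnd_apply_apply, LinearMap.zero_apply]
  rcases s with j | j | i
  · exact (congrArg ℓ (β.lie_Z _ j)).trans (map_zero ℓ)
  · simp [sum_lie, Y, β.lie_Y_Y]
  · exact (β.map_lie_sum_Y_X ℓ y i).trans (congrFun hy i)

theorem eq_zero_of_sum_Y_mem_center {y : Fin d → ℝ}
    (hy : ∑ j, y j • β.Y j ∈ LieAlgebra.center ℝ 𝔫) : y = 0 := by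
  rw [← LieSubmodule.mem_toSubmodule, β.center_eq] at hy
  obtain ⟨c, hc⟩ := (Submodule.mem_span_range_iff_exists_fun ℝ).1 hy
  ext j
  have hrepr := congrArg (fun W => β.basis.repr W (Sum.inr (Sum.inl j))) hc
  simpa [Y, Finsupp.single_apply] using hrepr.symm

theorem exists_det_B_ne_zero : ∃ lam, (β.B lam).det ≠ 0 := by
  obtain ⟨ℓ, hℓ⟩ := β.radical_eq_center
  refine ⟨fun k => ℓ (β.Z k), fun h0 => ?_⟩
  obtain ⟨y, hy0, hy⟩ := Matrix.exists_mulVec_eq_zero_iff.2 h0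
  exact hy0 (β.eq_zero_of_sum_Y_mem_center ((hℓ _).1 (β.map_lie_sum_Y_eq_zero hy)))

theorem ae_det_B_ne_zero : ∀ᵐ lam : Fin m → ℝ, (β.B lam).det ≠ 0 := by
  obtain ⟨lam₀, h₀⟩ := β.exists_det_B_ne_zero
  refine ae_mem_of_ae_add_linearMap_mem (LinearMap.toSpanSingleton ℝ _ lam₀) volume volume
    (s := {lam | (β.B lam).det ≠ 0})
    (β.continuous_det_B.measurable (measurableSet_singleton 0).compl) fun lam => ?_
  refine measure_mono_null (fun r hr => ?_)
    ((finite_setOf_det_add_smul_eq_zero (β.B lam) h₀).measure_zero volume)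
  simpa [B_add_smul] using hr

theorem ae_plancherelMeasure_det_B_ne_zero : ∀ᵐ lam ∂β.plancherelMeasure, (β.B lam).det ≠ 0 :=
  (withDensity_absolutelyContinuous _ _).ae_le β.ae_det_B_ne_zero

instance sigmaFinite_plancherelMeasure : SigmaFinite β.plancherelMeasure :=
  SigmaFinite.withDensity_ofReal _

theorem ae_det_B_transpose_ne_zero : ∀ᵐ lam : Fin m → ℝ, ((β.B lam)ᵀ).det ≠ 0 := by
  simpa only [Matrix.det_transpose] using β.ae_det_B_ne_zero

theorem plancherelMeasure_eq_withDensity_det_transpose :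
    β.plancherelMeasure = volume.withDensity fun lam => ENNReal.ofReal |((β.B lam)ᵀ).det| := by
  simp only [Matrix.det_transpose, plancherelMeasure]

/-- The change of variables `(lam, t) ↦ (lam, B(lam)ᵀ t)`. -/
noncomputable def dualCoord : (Fin m → ℝ) × (Fin d → ℝ) → (Fin m → ℝ) × (Fin d → ℝ) :=
  fiberwiseMulVec fun lam => (β.B lam)ᵀ

theorem measurePreserving_dualCoord :
    MeasurePreserving β.dualCoord (β.plancherelMeasure.prod volume) volume := by
  rw [plancherelMeasure_eq_withDensity_det_transpose]
  exact measurePreserving_fiberwiseMulVec β.measurable_B_transpose_apply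
    β.ae_det_B_transpose_ne_zero

/-- The change of variables `(lam, (t, s)) ↦ (t - s, (lam, B(lam)ᵀ t))`. -/
noncomputable def kernelCoord :
    (Fin m → ℝ) × ((Fin d → ℝ) × (Fin d → ℝ)) → (Fin d → ℝ) × ((Fin m → ℝ) × (Fin d → ℝ)) :=
  fiberwiseShear fun lam => (β.B lam)ᵀ

theorem measurePreserving_kernelCoord :
    MeasurePreserving β.kernelCoord (β.plancherelMeasure.prod volume)
      ((volume : Measure (Fin d → ℝ)).prod (volume : Measure ((Fin m → ℝ) × (Fin d → ℝ)))) := by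
  rw [plancherelMeasure_eq_withDensity_det_transpose]
  exact measurePreserving_fiberwiseShear β.measurable_B_transpose_apply
    β.ae_det_B_transpose_ne_zero

/-- The map `(x, (z, y)) ↦ (z, y, x)`. -/
def groupCoord (w : (Fin d → ℝ) × ((Fin m → ℝ) × (Fin d → ℝ))) : β.N := N.mk w.2.1 w.2.2 w.1

/-- The inverse of `groupCoord`. -/
def groupCoordInv (g : β.N) : (Fin d → ℝ) × ((Fin m → ℝ) × (Fin d → ℝ)) :=
  (N.xc g, (N.zc g, N.yc g))

theorem measurePreserving_groupCoord :
    MeasurePreserving β.groupCoord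
      ((volume : Measure (Fin d → ℝ)).prod (volume : Measure ((Fin m → ℝ) × (Fin d → ℝ))))
      volume :=
  (measurePreserving_prodAssoc (volume : Measure (Fin m → ℝ)) (volume : Measure (Fin d → ℝ))
    (volume : Measure (Fin d → ℝ))).comp Measure.measurePreserving_swap

theorem measurable_zc : Measurable (N.zc : β.N → _) :=
  (measurable_fst : Measurable (Prod.fst : (Fin m → ℝ) × (Fin d → ℝ) × (Fin d → ℝ) → _))

theorem measurable_yc : Measurable (N.yc : β.N → _) :=
  (measurable_snd.fst : Measurable fun g : (Fin m → ℝ) × (Fin d → ℝ) × (Fin d → ℝ) => g.2.1)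

theorem measurable_xc : Measurable (N.xc : β.N → _) :=
  (measurable_snd.snd : Measurable fun g : (Fin m → ℝ) × (Fin d → ℝ) × (Fin d → ℝ) => g.2.2)

theorem measurable_groupCoordInv : Measurable β.groupCoordInv :=
  β.measurable_xc.prodMk (β.measurable_zc.prodMk β.measurable_yc)

/-- Transport of `L²(N)` to the coordinates `(x, (z, y))`. -/
noncomputable def groupCoordEquiv :
    β.L2N ≃ₗᵢ[ℂ] Lp ℂ 2 ((volume : Measure (Fin d → ℝ)).prod
      (volume : Measure ((Fin m → ℝ) × (Fin d → ℝ)))) :=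
  compMeasurePreservingEquiv β.groupCoord β.measurePreserving_groupCoord β.groupCoordInv
    β.measurable_groupCoordInv (.of_forall fun _ => rfl)

/-- Transport to the coordinates `(lam, (t, s))` of the kernels of the Fourier transform. -/
noncomputable def kernelCoordEquiv :
    Lp ℂ 2 ((volume : Measure (Fin d → ℝ)).prod
      (volume : Measure ((Fin m → ℝ) × (Fin d → ℝ)))) ≃ₗᵢ[ℂ] β.HSField :=
  compMeasurePreservingEquiv β.kernelCoord β.measurePreserving_kernelCoord
    (fiberwiseUnshear fun lam => ((β.B lam)ᵀ)⁻¹)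
    (measurable_fiberwiseUnshear (measurable_matrix_inv β.measurable_B_transpose_apply)) <| by
      filter_upwards [Measure.quasiMeasurePreserving_fst.ae β.ae_plancherelMeasure_det_B_ne_zero]
        with w hw
      exact fiberwiseUnshear_fiberwiseShear (by rwa [Matrix.det_transpose])

/-- The Plancherel transform. -/
noncomputable def plancherel : β.L2N ≃ₗᵢ[ℂ] β.HSField :=
  β.groupCoordEquiv.trans ((sliceMap fourierProd volume).trans β.kernelCoordEquiv)

end AdaptedBasis

section Integration

variable {α γ : Type*} [MeasurableSpace α] [MeasurableSpace γ] {μ : Measure α} {ν : Measure γ}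

theorem enorm_eq_one_of_norm_eq_one {E : Type*} [NormedAddCommGroup E] {x : E} (h : ‖x‖ = 1) :
    ‖x‖ₑ = 1 := by
  rw [← ofReal_norm, h, ENNReal.ofReal_one]

theorem integral_comp_measurePreserving {E : Type*} [NormedAddCommGroup E] [NormedSpace ℝ E]
    {τ : α → γ} (hτ : MeasurePreserving τ μ ν) {g : γ → E} (hg : AEStronglyMeasurable g ν) :
    ∫ x, g (τ x) ∂μ = ∫ y, g y ∂ν := by
  rw [← hτ.map_eq] at hg ⊢
  exact (integral_map hτ.measurable.aemeasurable hg).symm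

theorem dense_setOf_integrable_Lp {E : Type*} [NormedAddCommGroup E] {p : ℝ≥0∞} [Fact (1 ≤ p)]
    (hp : p ≠ ∞) (μ : Measure α) : Dense {f : Lp E p μ | Integrable f μ} := by
  have hp0 : p ≠ 0 := (zero_lt_one.trans_le Fact.out).ne'
  refine (Lp.simpleFunc.denseRange (E := E) (μ := μ) hp).mono ?_
  rintro _ ⟨f, rfl⟩
  exact ((SimpleFunc.memLp_iff_integrable hp0 hp).1 (Lp.simpleFunc.memLp f)).congr
    (Lp.simpleFunc.toSimpleFunc_eq_toFun f)

theorem inner_toLp_star {κ : α → ℂ} (hκ : MemLp κ 2 μ) (v : Lp ℂ 2 μ) :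
    inner ℂ hκ.star.toLp v = ∫ s, κ s * v s ∂μ := by
  rw [L2.inner_def]
  refine integral_congr_ae ?_
  filter_upwards [hκ.star.coeFn_toLp] with s hs
  simp [hs, RCLike.inner_apply, mul_comm]

theorem ae_eq_of_forall_mem_dense_integral_mul_eq {D : Set (Lp ℂ 2 μ)} (hD : Dense D)
    {κ κ' : α → ℂ} (hκ : MemLp κ 2 μ) (hκ' : MemLp κ' 2 μ)
    (h : ∀ v ∈ D, ∫ s, κ s * v s ∂μ = ∫ s, κ' s * v s ∂μ) : κ =ᵐ[μ] κ' := by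
  have hstar : hκ.star.toLp = hκ'.star.toLp :=
    hD.eq_of_inner_left ℂ fun v hv => by
      rw [inner_toLp_star hκ, inner_toLp_star hκ', h v hv]
  filter_upwards [(MemLp.toLp_eq_toLp_iff hκ.star hκ'.star).1 hstar] with s hs
  exact star_injective hs

theorem memLp_mul_of_norm_eq_one {θ : α → ℂ} (hθ : Measurable θ) (h1 : ∀ x, ‖θ x‖ = 1)
    (f : Lp ℂ 2 μ) : MemLp (fun x => θ x * f x) 2 μ :=
  (Lp.memLp f).of_le (hθ.aestronglyMeasurable.mul (Lp.aestronglyMeasurable f))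
    (.of_forall fun x => by simp [h1])

/-- Multiplication by a function of absolute value one, as an isometry of `L²`. -/
noncomputable def unimodularMul (θ : α → ℂ) (hθ : Measurable θ) (h1 : ∀ x, ‖θ x‖ = 1) :
    Lp ℂ 2 μ →ₗᵢ[ℂ] Lp ℂ 2 μ where
  toFun f := (memLp_mul_of_norm_eq_one hθ h1 f).toLp
  map_add' f g := by
    rw [← MemLp.toLp_add]
    refine MemLp.toLp_congr _ _ ?_
    filter_upwards [Lp.coeFn_add f g] with x hx
    simp only [hx, Pi.add_apply, mul_add]
  map_smul' c f := by
    rw [RingHom.id_apply, ← MemLp.toLp_const_smul]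
    refine MemLp.toLp_congr _ _ ?_
    filter_upwards [Lp.coeFn_smul c f] with x hx
    simp only [hx, Pi.smul_apply, smul_eq_mul, mul_left_comm]
  norm_map' f := by
    refine norm_eq_of_enorm_sq_eq ?_
    simp only [LinearMap.coe_mk, AddHom.coe_mk]
    rw [enorm_sq_toLp, ← lintegral_enorm_sq_coeFn]
    refine lintegral_congr fun x => ?_
    rw [enorm_mul, enorm_eq_one_of_norm_eq_one (h1 x), one_mul]

theorem coeFn_unimodularMul (θ : α → ℂ) (hθ : Measurable θ) (h1 : ∀ x, ‖θ x‖ = 1)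
    (f : Lp ℂ 2 μ) : unimodularMul θ hθ h1 f =ᵐ[μ] fun x => θ x * f x :=
  MemLp.coeFn_toLp (memLp_mul_of_norm_eq_one hθ h1 f)

end Integration

section SliceFourier

variable {α : Type*} {p q : Type*} [Fintype p] [Fintype q]

/-- The partial Fourier transform in the second variable, for functions whose slices are
integrable. -/
noncomputable def sliceFourier (F : α × ((p → ℝ) × (q → ℝ)) → ℂ)
    (w : α × ((p → ℝ) × (q → ℝ))) : ℂ :=
  ∫ ζ, prodChar w.2 ζ * F (w.1, ζ)

variable [MeasurableSpace α] {μ : Measure α}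

theorem stronglyMeasurable_sliceFourier {F : α × ((p → ℝ) × (q → ℝ)) → ℂ}
    (hF : StronglyMeasurable F) : StronglyMeasurable (sliceFourier F) := by
  have hchar : StronglyMeasurable fun w : (α × ((p → ℝ) × (q → ℝ))) × ((p → ℝ) × (q → ℝ)) =>
      prodChar w.1.2 w.2 :=
    (continuous_prodChar.measurable.comp
      (measurable_fst.snd.prodMk measurable_snd)).stronglyMeasurable
  exact (hchar.mul (hF.comp_measurable
    (measurable_fst.fst.prodMk measurable_snd))).integral_prod_right'

theorem sliceFourier_congr_ae {F G : α × ((p → ℝ) × (q → ℝ)) → ℂ}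
    (h : F =ᵐ[μ.prod volume] G) : sliceFourier F =ᵐ[μ.prod volume] sliceFourier G := by
  filter_upwards [Measure.quasiMeasurePreserving_fst.ae (Measure.ae_ae_of_ae_prod h)] with w hw
  exact integral_congr_ae (hw.mono fun ζ hζ => congrArg (prodChar w.2 ζ * ·) hζ)

theorem coeFn_sliceMap_fourierProd [SFinite μ]
    (f : Lp ℂ 2 (μ.prod (volume : Measure ((p → ℝ) × (q → ℝ)))))
    (hf : Integrable f (μ.prod volume)) :
    sliceMap fourierProd μ f =ᵐ[μ.prod volume] sliceFourier f := by
  refine ae_eq_prod_of_ae_ae (Lp.aestronglyMeasurable _)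
    (stronglyMeasurable_sliceFourier (Lp.stronglyMeasurable f)).aestronglyMeasurable ?_
  filter_upwards [ae_coeFn_sliceMap fourierProd f, ae_memLp_prodMk_left (Lp.memLp f),
    hf.prod_right_ae] with x hmap hmem hint
  refine (hmap hmem.toLp hmem.coeFn_toLp).trans
    ((coeFn_fourierProd _ (hint.congr hmem.coeFn_toLp.symm)).trans (.of_forall fun ξ => ?_))
  exact integral_congr_ae (hmem.coeFn_toLp.mono fun ζ hζ => congrArg (prodChar ξ ζ * ·) hζ)

end SliceFourier

namespace AdaptedBasis

variable {𝔫 : Type*} [LieRing 𝔫] [LieAlgebra ℝ 𝔫] {m d : ℕ} {β : AdaptedBasis 𝔫 m d}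

theorem HasKernel.congr {T : L2R d → L2R d} {k k' : (Fin d → ℝ) × (Fin d → ℝ) → ℂ}
    (h : HasKernel T k) (hk : k =ᵐ[volume] k') : HasKernel T k' := by
  intro v
  refine (h v).trans ?_
  filter_upwards [Measure.ae_ae_of_ae_prod hk] with t ht
  exact integral_congr_ae (ht.mono fun s hs => congrArg (· * v s) hs)

theorem HasKernel.ae_eq {T : L2R d → L2R d} {k k' : (Fin d → ℝ) × (Fin d → ℝ) → ℂ}
    (h : HasKernel T k) (h' : HasKernel T k') (hk : MemLp k 2 volume) (hk' : MemLp k' 2 volume) :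
    k =ᵐ[volume] k' := by
  refine ae_eq_prod_of_ae_ae hk.1 hk'.1 ?_
  have hseq : ∀ᵐ t : Fin d → ℝ, ∀ n, ∫ s, k (t, s) * TopologicalSpace.denseSeq (L2R d) n s =
      ∫ s, k' (t, s) * TopologicalSpace.denseSeq (L2R d) n s :=
    ae_all_iff.2 fun n => EventuallyEq.trans (h _).symm (h' _)
  filter_upwards [hseq, ae_memLp_prodMk_left hk, ae_memLp_prodMk_left hk'] with t ht hkt hkt'
  exact ae_eq_of_forall_mem_dense_integral_mul_eq (TopologicalSpace.denseRange_denseSeq (L2R d))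
    hkt hkt' (Set.forall_mem_range.2 ht)

variable (β)

instance sigmaFinite_volume_N : SigmaFinite (volume : Measure β.N) :=
  inferInstanceAs (SigmaFinite (volume : Measure ((Fin m → ℝ) × (Fin d → ℝ) × (Fin d → ℝ))))

theorem coeFn_groupCoordEquiv (f : β.L2N) :
    β.groupCoordEquiv f =ᵐ[volume.prod volume] fun v => f (β.groupCoord v) :=
  coeFn_compMeasurePreservingEquiv _ _ _ _ _ f

theorem coeFn_kernelCoordEquiv (f : Lp ℂ 2 ((volume : Measure (Fin d → ℝ)).prod
      (volume : Measure ((Fin m → ℝ) × (Fin d → ℝ))))) :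
    β.kernelCoordEquiv f =ᵐ[β.plancherelMeasure.prod volume] fun v => f (β.kernelCoord v) :=
  coeFn_compMeasurePreservingEquiv _ _ _ _ _ f

theorem coeFn_plancherel (f : β.L2N) (hf : Integrable (f : β.N → ℂ)) :
    β.plancherel f =ᵐ[β.plancherelMeasure.prod volume]
      fun w => sliceFourier (fun v => f (β.groupCoord v)) (β.kernelCoord w) := by
  have hcoord := β.coeFn_groupCoordEquiv f
  have hint : Integrable (β.groupCoordEquiv f) (volume.prod volume) :=
    (β.measurePreserving_groupCoord.integrable_comp_of_integrable hf).congr hcoord.symm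
  exact (β.coeFn_kernelCoordEquiv _).trans
    (β.measurePreserving_kernelCoord.quasiMeasurePreserving.ae_eq_comp
      ((coeFn_sliceMap_fourierProd _ hint).trans (sliceFourier_congr_ae hcoord)))

theorem norm_phase (lam : Fin m → ℝ) (g : β.N) (t : Fin d → ℝ) : ‖β.phase lam g t‖ = 1 := by
  unfold phase
  rw [← Complex.norm_exp_ofReal_mul_I (2 * Real.pi * (lam ⬝ᵥ N.zc g + t ⬝ᵥ β.B lam *ᵥ N.yc g))]
  congr 2
  push_cast
  ring

theorem measurable_phase :
    Measurable fun w : (Fin m → ℝ) × (β.N × (Fin d → ℝ)) => β.phase w.1 w.2.1 w.2.2 := by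
  have hz (j : Fin m) : Measurable fun w : (Fin m → ℝ) × (β.N × (Fin d → ℝ)) => N.zc w.2.1 j :=
    (measurable_pi_apply j).comp (β.measurable_zc.comp measurable_snd.fst)
  have hy (j : Fin d) : Measurable fun w : (Fin m → ℝ) × (β.N × (Fin d → ℝ)) => N.yc w.2.1 j :=
    (measurable_pi_apply j).comp (β.measurable_yc.comp measurable_snd.fst)
  have hB (i j : Fin d) :
      Measurable fun w : (Fin m → ℝ) × (β.N × (Fin d → ℝ)) => β.B w.1 i j :=
    (β.continuous_B_apply i j).measurable.comp measurable_fst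
  unfold phase Matrix.mulVec dotProduct
  fun_prop

theorem phase_groupCoord (lam : Fin m → ℝ) (x t : Fin d → ℝ) (ζ : (Fin m → ℝ) × (Fin d → ℝ)) :
    β.phase lam (β.groupCoord (x, ζ)) t = prodChar (β.dualCoord (lam, t)) ζ := by
  simp only [phase, prodChar, groupCoord, dualCoord, fiberwiseMulVec, N.zc_mk, N.yc_mk]
  rw [Matrix.mulVec_transpose, ← Matrix.dotProduct_mulVec]

theorem stronglyMeasurable_phase_mul (lam : Fin m → ℝ) (v : L2R d) :
    StronglyMeasurable fun w : β.N × (Fin d → ℝ) =>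
      β.phase lam w.1 w.2 * v (w.2 - N.xc w.1) :=
  (β.measurable_phase.comp (measurable_const.prodMk measurable_id)).stronglyMeasurable.mul
    ((Lp.stronglyMeasurable v).comp_measurable
      (measurable_snd.sub (β.measurable_xc.comp measurable_fst)))

theorem norm_rep (lam : Fin m → ℝ) (g : β.N) (v : L2R d) : ‖β.rep lam g v‖ = ‖v‖ := by
  refine norm_eq_of_enorm_sq_eq ?_
  rw [rep, enorm_sq_toLp, ← lintegral_enorm_sq_coeFn,
    ← lintegral_sub_right_eq_self (fun t => ‖v t‖ₑ ^ 2) (N.xc g)]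
  refine lintegral_congr fun t => ?_
  rw [enorm_mul, enorm_eq_one_of_norm_eq_one (β.norm_phase lam g t), one_mul]

theorem integrable_smul_rep (lam : Fin m → ℝ) (v : L2R d) {f : β.N → ℂ} (hf : Integrable f) :
    Integrable fun g : β.N => f g • β.rep lam g v := by
  have hrep : StronglyMeasurable fun g : β.N => β.rep lam g v :=
    stronglyMeasurable_toLp (β.stronglyMeasurable_phase_mul lam v) fun g => β.memLp_rep lam g v
  refine (hf.norm.mul_const ‖v‖).mono' (hf.1.smul hrep.aestronglyMeasurable)
    (.of_forall fun g => ?_)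
  rw [norm_smul, norm_rep]

theorem coeFn_smul_rep (c : ℂ) (lam : Fin m → ℝ) (g : β.N) (v : L2R d) :
    (c • β.rep lam g v : L2R d) =ᵐ[volume] fun t => c * (β.phase lam g t * v (t - N.xc g)) := by
  filter_upwards [Lp.coeFn_smul c (β.rep lam g v), (β.memLp_rep lam g v).coeFn_toLp]
    with t hsmul hrep
  rw [hsmul, Pi.smul_apply, rep, hrep, smul_eq_mul]

theorem integral_mul_phase_mul_eq (f : β.N → ℂ) (lam : Fin m → ℝ) (v : (Fin d → ℝ) → ℂ)
    {t : Fin d → ℝ}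
    (h : Integrable fun g : β.N => f g * (β.phase lam g t * v (t - N.xc g))) :
    ∫ g : β.N, f g * (β.phase lam g t * v (t - N.xc g)) =
      ∫ s, sliceFourier (fun w => f (β.groupCoord w)) (β.kernelCoord (lam, (t, s))) * v s := by
  have hfiber (x : Fin d → ℝ) :
      ∫ ζ, f (β.groupCoord (x, ζ)) * (β.phase lam (β.groupCoord (x, ζ)) t *
        v (t - N.xc (β.groupCoord (x, ζ)))) =
      sliceFourier (fun w => f (β.groupCoord w)) (x, β.dualCoord (lam, t)) * v (t - x) := by
    rw [sliceFourier, ← integral_mul_const]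
    refine integral_congr_ae (.of_forall fun ζ => ?_)
    simp only [phase_groupCoord]
    simp only [groupCoord, N.xc_mk]
    ring
  rw [← integral_comp_measurePreserving β.measurePreserving_groupCoord h.1, integral_prod
      (fun w => f (β.groupCoord w) * (β.phase lam (β.groupCoord w) t *
        v (t - N.xc (β.groupCoord w))))
      (β.measurePreserving_groupCoord.integrable_comp_of_integrable h)]
  simp only [hfiber]
  rw [← integral_sub_left_eq_self _ volume t]
  simp only [sub_sub_cancel]
  rfl

theorem hasKernel_fourier (f : β.L2N) (hf : Integrable (f : β.N → ℂ)) (lam : Fin m → ℝ) :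
    HasKernel (β.fourier f lam)
      fun ts => sliceFourier (fun v => f (β.groupCoord v)) (β.kernelCoord (lam, ts)) := by
  intro v
  have hint := β.integrable_smul_rep lam v hf
  have hmeas : StronglyMeasurable fun w : β.N × (Fin d → ℝ) =>
      f w.1 * (β.phase lam w.1 w.2 * v (w.2 - N.xc w.1)) :=
    ((Lp.stronglyMeasurable f).comp_measurable measurable_fst).mul
      (β.stronglyMeasurable_phase_mul lam v)
  have hcoe : ∀ᵐ g : β.N, (fun t => f g * (β.phase lam g t * v (t - N.xc g))) =ᵐ[volume]
      (f g • β.rep lam g v : L2R d) :=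
    .of_forall fun g => (β.coeFn_smul_rep (f g) lam g v).symm
  refine (coeFn_integral hint hmeas hcoe).trans ?_
  filter_upwards [ae_integrable_of_integrable_Lp hint hmeas hcoe] with t ht
  exact β.integral_mul_phase_mul_eq f lam v ht

theorem ae_hasKernel_plancherel (f : β.L2N) (hf : Integrable (f : β.N → ℂ)) :
    ∀ᵐ lam ∂β.plancherelMeasure,
      HasKernel (β.fourier f lam) fun ts => β.plancherel f (lam, ts) := by
  filter_upwards [Measure.ae_ae_of_ae_prod (β.coeFn_plancherel f hf)] with lam h
  exact (β.hasKernel_fourier f hf lam).congr (EventuallyEq.symm h)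

theorem plancherel_eq_of_hasKernel (f : β.L2N) (K : β.HSField) (hf : Integrable (f : β.N → ℂ))
    (hK : ∀ᵐ lam ∂β.plancherelMeasure, HasKernel (β.fourier f lam) fun ts => K (lam, ts)) :
    β.plancherel f = K := by
  refine Lp.ext (ae_eq_prod_of_ae_ae (Lp.aestronglyMeasurable _) (Lp.aestronglyMeasurable _) ?_)
  filter_upwards [hK, β.ae_hasKernel_plancherel f hf, ae_memLp_prodMk_left (Lp.memLp K),
    ae_memLp_prodMk_left (Lp.memLp (β.plancherel f))] with lam hK hf hmemK hmemf
  exact hf.ae_eq hK hmemf hmemK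

theorem isPlancherelTransform_iff (f : β.L2N) (K : β.HSField) :
    β.IsPlancherelTransform f K ↔ β.plancherel f = K := by
  refine ⟨fun h => ?_, ?_⟩
  · have hclosed : IsClosed {p : β.L2N × β.HSField | β.plancherel p.1 = p.2} :=
      isClosed_eq (β.plancherel.continuous.comp continuous_fst) continuous_snd
    have hmem : (f, K) ∈ {p : β.L2N × β.HSField | β.plancherel p.1 = p.2} :=
      closure_minimal (fun p hp => β.plancherel_eq_of_hasKernel p.1 p.2 hp.1 hp.2) hclosed h
    exact hmem
  · rintro rfl
    have hmaps : Set.MapsTo (fun f : β.L2N => (f, β.plancherel f)) {f | Integrable (f : β.N → ℂ)}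
        {p : β.L2N × β.HSField | Integrable (p.1 : β.N → ℂ) ∧
          ∀ᵐ lam ∂β.plancherelMeasure, HasKernel (β.fourier p.1 lam) fun ts => p.2 (lam, ts)} :=
      fun f hf => ⟨hf, β.ae_hasKernel_plancherel f hf⟩
    have hcont : Continuous fun f : β.L2N => (f, β.plancherel f) :=
      continuous_id.prodMk β.plancherel.continuous
    exact hmaps.closure hcont (dense_setOf_integrable_Lp (by norm_num) _ f)

end AdaptedBasis

namespace AdaptedBasis

variable {𝔫 : Type*} [LieRing 𝔫] [LieAlgebra ℝ 𝔫] {m d : ℕ} (β : AdaptedBasis 𝔫 m d)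

/-- The effect of left translation by `g` on the coordinates `(z, y)`. -/
noncomputable def shear (g : β.N) (ζ : (Fin m → ℝ) × (Fin d → ℝ)) : (Fin m → ℝ) × (Fin d → ℝ) :=
  (N.zc g + β.bracket (N.xc g) ζ.2 + ζ.1, N.yc g + ζ.2)

theorem continuous_bracket_right (x : Fin d → ℝ) : Continuous fun y => β.bracket x y := by
  unfold bracket; fun_prop

theorem measurePreserving_shear (g : β.N) : MeasurePreserving (β.shear g) := by
  have hskew : MeasurePreserving
      (fun p : (Fin d → ℝ) × (Fin m → ℝ) =>
        (N.yc g + p.1, (N.zc g + β.bracket (N.xc g) p.1) + p.2))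
      (volume.prod volume) (volume.prod volume) := by
    refine (measurePreserving_add_left volume (N.yc g)).skew_product
      (g := fun (y : Fin d → ℝ) (z : Fin m → ℝ) => (N.zc g + β.bracket (N.xc g) y) + z) ?_
      (.of_forall fun _ => (measurePreserving_add_left volume _).map_eq)
    have := β.continuous_bracket_right (N.xc g)
    apply Continuous.measurable
    simp only [Function.uncurry_def]
    fun_prop
  have hswap := (Measure.measurePreserving_swap.comp hskew).comp
    (Measure.measurePreserving_swap (μ := (volume : Measure (Fin m → ℝ)))
      (ν := (volume : Measure (Fin d → ℝ))))
  exact hswap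

theorem inv_mul_groupCoord_shear (g : β.N) (x : Fin d → ℝ) (ζ : (Fin m → ℝ) × (Fin d → ℝ)) :
    g⁻¹ * β.groupCoord (x, β.shear g ζ) = β.groupCoord (x - N.xc g, ζ) := by
  apply N.ext
  · simp only [groupCoord, shear, N.zc_mul, N.zc_inv, N.zc_mk, N.xc_inv, N.yc_mk,
      N.bracket_neg_left, N.bracket_add_right]
    abel
  · simp only [groupCoord, shear, N.yc_mul, N.yc_inv, N.yc_mk]
    abel
  · simp only [groupCoord, N.xc_mul, N.xc_inv, N.xc_mk]
    abel

theorem prodChar_dualCoord_shear (g : β.N) (lam : Fin m → ℝ) (t : Fin d → ℝ)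
    (ζ : (Fin m → ℝ) × (Fin d → ℝ)) :
    prodChar (β.dualCoord (lam, t)) (β.shear g ζ) =
      β.phase lam g t * prodChar (β.dualCoord (lam, t - N.xc g)) ζ := by
  simp only [phase, prodChar, shear, dualCoord, fiberwiseMulVec]
  rw [← Complex.exp_add, Matrix.mulVec_transpose, Matrix.mulVec_transpose,
    ← Matrix.dotProduct_mulVec, ← Matrix.dotProduct_mulVec, Matrix.mulVec_add]
  simp only [dotProduct_add, sub_dotProduct, β.dotProduct_bracket lam (N.xc g) ζ.2]
  congr 1
  push_cast
  ring

theorem sliceFourier_inv_mul {F : β.N → ℂ} (hF : StronglyMeasurable F) (g : β.N)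
    (lam : Fin m → ℝ) (t s : Fin d → ℝ) :
    sliceFourier (fun v => F (g⁻¹ * β.groupCoord v)) (β.kernelCoord (lam, (t, s))) =
      β.phase lam g t *
        sliceFourier (fun v => F (β.groupCoord v)) (β.kernelCoord (lam, (t - N.xc g, s))) := by
  change ∫ ζ, prodChar (β.dualCoord (lam, t)) ζ * F (g⁻¹ * β.groupCoord (t - s, ζ)) =
    β.phase lam g t * ∫ ζ, prodChar (β.dualCoord (lam, t - N.xc g)) ζ *
      F (β.groupCoord (t - N.xc g - s, ζ))
  have hchar : Continuous fun ζ => prodChar (β.dualCoord (lam, t)) ζ :=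
    continuous_prodChar.comp (continuous_const.prodMk continuous_id)
  have htrans : StronglyMeasurable fun ζ => F (g⁻¹ * β.groupCoord (t - s, ζ)) :=
    hF.comp_measurable ((N.measurePreserving_mul_left g⁻¹).measurable.comp
      (β.measurePreserving_groupCoord.measurable.comp measurable_prodMk_left))
  have hmeas : AEStronglyMeasurable fun ζ =>
      prodChar (β.dualCoord (lam, t)) ζ * F (g⁻¹ * β.groupCoord (t - s, ζ)) :=
    hchar.aestronglyMeasurable.mul htrans.aestronglyMeasurable
  rw [← integral_comp_measurePreserving (β.measurePreserving_shear g) hmeas, ← integral_const_mul]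
  refine integral_congr_ae (.of_forall fun ζ => ?_)
  simp only [inv_mul_groupCoord_shear, prodChar_dualCoord_shear]
  rw [sub_right_comm, mul_assoc]

theorem measurePreserving_kernelShift (x : Fin d → ℝ) :
    MeasurePreserving
      (fun w : (Fin m → ℝ) × ((Fin d → ℝ) × (Fin d → ℝ)) => (w.1, (w.2.1 - x, w.2.2)))
      (β.plancherelMeasure.prod volume) (β.plancherelMeasure.prod volume) :=
  (MeasurePreserving.id β.plancherelMeasure).prod
    ((measurePreserving_sub_right (volume : Measure (Fin d → ℝ)) x).prod
      (MeasurePreserving.id (volume : Measure (Fin d → ℝ))))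

theorem measurable_phase_kernel (g : β.N) :
    Measurable fun w : (Fin m → ℝ) × ((Fin d → ℝ) × (Fin d → ℝ)) => β.phase w.1 g w.2.1 := by
  have hmap : Measurable fun w : (Fin m → ℝ) × ((Fin d → ℝ) × (Fin d → ℝ)) =>
      (w.1, (g, w.2.1)) :=
    measurable_fst.prodMk (measurable_const.prodMk measurable_snd.fst)
  simpa only [Function.comp_def] using β.measurable_phase.comp hmap

/-- The action of `N` on fields of Hilbert-Schmidt kernels that `plancherel` intertwines with the
left regular representation: `π_lam(g)` acts on the first variable. -/
noncomputable def kernelLeftReg (g : β.N) : β.HSField →ₗᵢ[ℂ] β.HSField :=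
  (unimodularMul _ (β.measurable_phase_kernel g) fun w => β.norm_phase w.1 g w.2.1).comp
    (Lp.compMeasurePreservingₗᵢ ℂ _ (β.measurePreserving_kernelShift (N.xc g)))

theorem coeFn_kernelLeftReg (g : β.N) (K : β.HSField) :
    β.kernelLeftReg g K =ᵐ[β.plancherelMeasure.prod volume]
      fun w => β.phase w.1 g w.2.1 * K (w.1, (w.2.1 - N.xc g, w.2.2)) := by
  refine (coeFn_unimodularMul _ (β.measurable_phase_kernel g)
    (fun w => β.norm_phase w.1 g w.2.1) _).trans ?_
  filter_upwards [Lp.coeFn_compMeasurePreserving K (β.measurePreserving_kernelShift (N.xc g))]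
    with w hw
  exact congrArg (β.phase w.1 g w.2.1 * ·) hw

theorem coeFn_leftReg (g : β.N) (f : β.L2N) :
    β.leftReg g f =ᵐ[volume] fun h => f (g⁻¹ * h) :=
  Lp.coeFn_compMeasurePreserving f (N.measurePreserving_mul_left g⁻¹)

theorem plancherel_leftReg_of_integrable (g : β.N) (f : β.L2N) (hf : Integrable (f : β.N → ℂ)) :
    β.plancherel (β.leftReg g f) = β.kernelLeftReg g (β.plancherel f) := by
  have hgf : Integrable (β.leftReg g f : β.N → ℂ) :=
    ((N.measurePreserving_mul_left g⁻¹).integrable_comp_of_integrable hf).congr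
      (β.coeFn_leftReg g f).symm
  have htrans := β.measurePreserving_kernelCoord.quasiMeasurePreserving.ae_eq_comp
    (sliceFourier_congr_ae
      (β.measurePreserving_groupCoord.quasiMeasurePreserving.ae_eq_comp (β.coeFn_leftReg g f)))
  have hshift := (β.measurePreserving_kernelShift (N.xc g)).quasiMeasurePreserving.ae_eq_comp
    (β.coeFn_plancherel f hf)
  refine Lp.ext ((β.coeFn_plancherel _ hgf).trans (htrans.trans
    (EventuallyEq.trans ?_ (β.coeFn_kernelLeftReg g (β.plancherel f)).symm)))
  filter_upwards [hshift] with w hw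
  simp only [Function.comp_apply] at hw
  rw [hw]
  exact β.sliceFourier_inv_mul (Lp.stronglyMeasurable f) g w.1 w.2.1 w.2.2

theorem plancherel_leftReg (g : β.N) (f : β.L2N) :
    β.plancherel (β.leftReg g f) = β.kernelLeftReg g (β.plancherel f) := by
  have hclosed : IsClosed {f : β.L2N |
      β.plancherel (β.leftReg g f) = β.kernelLeftReg g (β.plancherel f)} :=
    isClosed_eq (β.plancherel.continuous.comp (β.leftReg g).continuous)
      ((β.kernelLeftReg g).continuous.comp β.plancherel.continuous)
  exact hclosed.closure_subset_iff.2 (β.plancherel_leftReg_of_integrable g)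
    (dense_setOf_integrable_Lp (by norm_num) _ f)

end AdaptedBasis

section Tensor

variable {α T : Type*} {S : Set α} {U V V' : α × T → ℂ}

/-- The field over `S` of the rank-one kernels `V(a, t) * conj (U(a, s))`. -/
noncomputable def tensorFun (S : Set α) (U V : α × T → ℂ) (w : α × (T × T)) : ℂ :=
  S.indicator (fun _ => 1) w.1 * (V (w.1, w.2.1) * (starRingEnd ℂ) (U (w.1, w.2.2)))

theorem tensorFun_of_mem {a : α} (ha : a ∈ S) (U V : α × T → ℂ) (ts : T × T) :
    tensorFun S U V (a, ts) = V (a, ts.1) * (starRingEnd ℂ) (U (a, ts.2)) := by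
  simp [tensorFun, ha]

theorem tensorFun_of_notMem {a : α} (ha : a ∉ S) (U V : α × T → ℂ) (ts : T × T) :
    tensorFun S U V (a, ts) = 0 := by
  simp [tensorFun, ha]

variable [MeasurableSpace α] [MeasurableSpace T] {μ : Measure α} {ν : Measure T}

theorem stronglyMeasurable_tensorFun (hS : MeasurableSet S) (hU : StronglyMeasurable U)
    (hV : StronglyMeasurable V) : StronglyMeasurable (tensorFun S U V) := by
  have hfst : Measurable fun w : α × (T × T) => (w.1, w.2.1) :=
    measurable_fst.prodMk measurable_snd.fst
  have hsnd : Measurable fun w : α × (T × T) => (w.1, w.2.2) :=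
    measurable_fst.prodMk measurable_snd.snd
  exact ((stronglyMeasurable_const.indicator hS).comp_measurable measurable_fst).mul
    ((hV.comp_measurable hfst).mul
      (Complex.continuous_conj.comp_stronglyMeasurable (hU.comp_measurable hsnd)))

theorem integral_conj_mul_self {f : T → ℂ} (hf : AEStronglyMeasurable f ν) :
    ∫ s, (starRingEnd ℂ) (f s) * f s ∂ν = ((∫⁻ s, ‖f s‖ₑ ^ 2 ∂ν).toReal : ℂ) := by
  simp only [Complex.conj_mul', ← Complex.ofReal_pow]
  rw [integral_complex_ofReal, integral_eq_lintegral_of_nonneg_ae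
    (.of_forall fun s => sq_nonneg ‖f s‖) (hf.norm.pow 2)]
  simp only [ENNReal.ofReal_pow (norm_nonneg _), ofReal_norm]

variable [SFinite ν]

theorem ae_ae_of_ae_restrict_prod {P : α → T → Prop} (hS : MeasurableSet S)
    (h : ∀ᵐ w ∂((μ.restrict S).prod ν), P w.1 w.2) :
    ∀ᵐ a ∂μ, a ∈ S → ∀ᵐ t ∂ν, P a t :=
  (ae_restrict_iff' hS).1 (Measure.ae_ae_of_ae_prod h)

theorem tensorFun_congr (hS : MeasurableSet S) (hU : StronglyMeasurable U)
    (hV : StronglyMeasurable V) (hV' : StronglyMeasurable V')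
    (h : V =ᵐ[(μ.restrict S).prod ν] V') :
    tensorFun S U V =ᵐ[μ.prod (ν.prod ν)] tensorFun S U V' := by
  refine ae_eq_prod_of_ae_ae (stronglyMeasurable_tensorFun hS hU hV).aestronglyMeasurable
    (stronglyMeasurable_tensorFun hS hU hV').aestronglyMeasurable ?_
  filter_upwards [ae_ae_of_ae_restrict_prod (P := fun a t => V (a, t) = V' (a, t)) hS h] with a ha
  by_cases haS : a ∈ S
  · filter_upwards [Measure.quasiMeasurePreserving_fst.ae (ha haS)] with ts hts
    rw [tensorFun_of_mem haS, tensorFun_of_mem haS, hts]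
  · exact .of_forall fun ts => by simp only [tensorFun_of_notMem haS]

theorem lintegral_enorm_sq_tensorFun_slice {a : α} (ha : a ∈ S) (hU : StronglyMeasurable U)
    (hV : StronglyMeasurable V) (hUa : ∫⁻ s, ‖U (a, s)‖ₑ ^ 2 ∂ν = 1) :
    ∫⁻ ts, ‖tensorFun S U V (a, ts)‖ₑ ^ 2 ∂(ν.prod ν) = ∫⁻ t, ‖V (a, t)‖ₑ ^ 2 ∂ν := by
  have hUm := ((hU.comp_measurable (measurable_prodMk_left (x := a))).enorm.pow_const 2)
  have hVm := ((hV.comp_measurable (measurable_prodMk_left (x := a))).enorm.pow_const 2)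
  simp only [Function.comp_def] at hUm hVm
  simp only [tensorFun_of_mem ha, enorm_mul, mul_pow, RCLike.enorm_conj]
  rw [lintegral_prod_mul hVm.aemeasurable hUm.aemeasurable, hUa, mul_one]

theorem lintegral_enorm_sq_tensorFun (hS : MeasurableSet S) (hU : StronglyMeasurable U)
    (hU1 : ∀ᵐ a ∂μ.restrict S, ∫⁻ s, ‖U (a, s)‖ₑ ^ 2 ∂ν = 1) (hV : StronglyMeasurable V) :
    ∫⁻ w, ‖tensorFun S U V w‖ₑ ^ 2 ∂(μ.prod (ν.prod ν)) =
      ∫⁻ w, ‖V w‖ₑ ^ 2 ∂((μ.restrict S).prod ν) := by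
  rw [lintegral_prod _
      ((stronglyMeasurable_tensorFun hS hU hV).enorm.pow_const 2).aemeasurable,
    lintegral_prod _ (hV.enorm.pow_const 2).aemeasurable, ← lintegral_indicator hS]
  refine lintegral_congr_ae ?_
  filter_upwards [(ae_restrict_iff' hS).1 hU1] with a ha
  by_cases haS : a ∈ S
  · rw [Set.indicator_of_mem haS, lintegral_enorm_sq_tensorFun_slice haS hU hV (ha haS)]
  · simp [haS, tensorFun_of_notMem haS]

theorem memLp_tensorFun_iff (hS : MeasurableSet S) (hU : StronglyMeasurable U)
    (hU1 : ∀ᵐ a ∂μ.restrict S, ∫⁻ s, ‖U (a, s)‖ₑ ^ 2 ∂ν = 1) (hV : StronglyMeasurable V) :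
    MemLp (tensorFun S U V) 2 (μ.prod (ν.prod ν)) ↔ MemLp V 2 ((μ.restrict S).prod ν) := by
  rw [memLp_two_iff_lintegral_enorm_sq
      (stronglyMeasurable_tensorFun hS hU hV).aestronglyMeasurable,
    memLp_two_iff_lintegral_enorm_sq hV.aestronglyMeasurable,
    lintegral_enorm_sq_tensorFun hS hU hU1 hV]

theorem memLp_tensorFun (hS : MeasurableSet S) (hU : StronglyMeasurable U)
    (hU1 : ∀ᵐ a ∂μ.restrict S, ∫⁻ s, ‖U (a, s)‖ₑ ^ 2 ∂ν = 1)
    (V : Lp ℂ 2 ((μ.restrict S).prod ν)) :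
    MemLp (tensorFun S U V) 2 (μ.prod (ν.prod ν)) :=
  (memLp_tensorFun_iff hS hU hU1 (Lp.stronglyMeasurable V)).2 (Lp.memLp V)

variable (μ ν) in
/-- The isometry `V ↦ V ⊗ U` onto the fields over `S` of operators of rank one along `U`. -/
noncomputable def tensorMap (hS : MeasurableSet S) (hU : StronglyMeasurable U)
    (hU1 : ∀ᵐ a ∂μ.restrict S, ∫⁻ s, ‖U (a, s)‖ₑ ^ 2 ∂ν = 1) :
    Lp ℂ 2 ((μ.restrict S).prod ν) →ₗᵢ[ℂ] Lp ℂ 2 (μ.prod (ν.prod ν)) where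
  toFun V := (memLp_tensorFun hS hU hU1 V).toLp
  map_add' V V' := by
    rw [← MemLp.toLp_add]
    refine MemLp.toLp_congr _ _ ((tensorFun_congr hS hU (Lp.stronglyMeasurable _)
      ((Lp.stronglyMeasurable V).add (Lp.stronglyMeasurable V')) (Lp.coeFn_add V V')).trans
      (.of_forall fun w => ?_))
    simp only [tensorFun, Pi.add_apply]
    ring
  map_smul' c V := by
    rw [RingHom.id_apply, ← MemLp.toLp_const_smul]
    refine MemLp.toLp_congr _ _ ((tensorFun_congr hS hU (Lp.stronglyMeasurable _)
      ((Lp.stronglyMeasurable V).const_smul c) (Lp.coeFn_smul c V)).trans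
      (.of_forall fun w => ?_))
    simp only [tensorFun, Pi.smul_apply, smul_eq_mul]
    ring
  norm_map' V := norm_eq_of_enorm_sq_eq <| by
    simp only [LinearMap.coe_mk, AddHom.coe_mk]
    rw [enorm_sq_toLp, lintegral_enorm_sq_tensorFun hS hU hU1 (Lp.stronglyMeasurable V),
      lintegral_enorm_sq_coeFn]

theorem coeFn_tensorMap (hS : MeasurableSet S) (hU : StronglyMeasurable U)
    (hU1 : ∀ᵐ a ∂μ.restrict S, ∫⁻ s, ‖U (a, s)‖ₑ ^ 2 ∂ν = 1)
    {V : Lp ℂ 2 ((μ.restrict S).prod ν)} (hV' : StronglyMeasurable V')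
    (h : V =ᵐ[(μ.restrict S).prod ν] V') :
    tensorMap μ ν hS hU hU1 V =ᵐ[μ.prod (ν.prod ν)] tensorFun S U V' :=
  (memLp_tensorFun hS hU hU1 V).coeFn_toLp.trans
    (tensorFun_congr hS hU (Lp.stronglyMeasurable V) hV' h)

variable (ν) in
/-- The field `a ↦ K(a) U(a)` obtained by applying a field of integral operators to a field of
vectors; it recovers `V` from `K = V ⊗ U`. -/
noncomputable def applyKernel (K : α × (T × T) → ℂ) (U : α × T → ℂ) (w : α × T) : ℂ :=
  ∫ s, K (w.1, (w.2, s)) * U (w.1, s) ∂ν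

theorem stronglyMeasurable_applyKernel {K : α × (T × T) → ℂ} (hK : StronglyMeasurable K)
    (hU : StronglyMeasurable U) : StronglyMeasurable (applyKernel ν K U) := by
  have hleft : Measurable fun w : (α × T) × T => (w.1.1, (w.1.2, w.2)) :=
    measurable_fst.fst.prodMk (measurable_fst.snd.prodMk measurable_snd)
  have hright : Measurable fun w : (α × T) × T => (w.1.1, w.2) :=
    measurable_fst.fst.prodMk measurable_snd
  exact ((hK.comp_measurable hleft).mul (hU.comp_measurable hright)).integral_prod_right'

theorem applyKernel_ae_eq {K : α × (T × T) → ℂ} {a : α} {w : T → ℂ} (hU : StronglyMeasurable U)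
    (hUa : ∫⁻ s, ‖U (a, s)‖ₑ ^ 2 ∂ν = 1)
    (hw : (fun ts => K (a, ts)) =ᵐ[ν.prod ν] fun ts => w ts.1 * (starRingEnd ℂ) (U (a, ts.2))) :
    ∀ᵐ t ∂ν, applyKernel ν K U (a, t) = w t := by
  filter_upwards [Measure.ae_ae_of_ae_prod hw] with t ht
  calc applyKernel ν K U (a, t)
      = ∫ s, w t * ((starRingEnd ℂ) (U (a, s)) * U (a, s)) ∂ν := by
        refine integral_congr_ae ?_
        filter_upwards [ht] with s hs
        rw [hs, mul_assoc]
    _ = w t := by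
        rw [integral_const_mul, integral_conj_mul_self (f := fun s => U (a, s))
          (hU.comp_measurable measurable_prodMk_left).aestronglyMeasurable, hUa]
        simp

theorem tensorFun_applyKernel_ae_eq {K : α × (T × T) → ℂ} (hS : MeasurableSet S)
    (hU : StronglyMeasurable U) (hK : StronglyMeasurable K)
    (hU1 : ∀ᵐ a ∂μ.restrict S, ∫⁻ s, ‖U (a, s)‖ₑ ^ 2 ∂ν = 1)
    (hrank : ∀ᵐ a ∂μ,
      (a ∈ S → ∃ w : Lp ℂ 2 ν, (fun ts => K (a, ts)) =ᵐ[ν.prod ν]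
        fun ts => w ts.1 * (starRingEnd ℂ) (U (a, ts.2))) ∧
      (a ∉ S → (fun ts => K (a, ts)) =ᵐ[ν.prod ν] 0)) :
    tensorFun S U (applyKernel ν K U) =ᵐ[μ.prod (ν.prod ν)] K := by
  refine ae_eq_prod_of_ae_ae (stronglyMeasurable_tensorFun hS hU
    (stronglyMeasurable_applyKernel hK hU)).aestronglyMeasurable hK.aestronglyMeasurable ?_
  filter_upwards [hrank, (ae_restrict_iff' hS).1 hU1] with a ha hUa
  by_cases haS : a ∈ S
  · obtain ⟨w, hw⟩ := ha.1 haS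
    filter_upwards [hw, Measure.quasiMeasurePreserving_fst.ae
      (applyKernel_ae_eq hU (hUa haS) hw)] with ts hK hV
    rw [tensorFun_of_mem haS, hK, hV]
  · filter_upwards [ha.2 haS] with ts hts
    rw [tensorFun_of_notMem haS, hts, Pi.zero_apply]

theorem ae_tensorMap_eq_mul (hS : MeasurableSet S) (hU : StronglyMeasurable U)
    (hU1 : ∀ᵐ a ∂μ.restrict S, ∫⁻ s, ‖U (a, s)‖ₑ ^ 2 ∂ν = 1)
    (V : Lp ℂ 2 ((μ.restrict S).prod ν)) :
    ∀ᵐ a ∂μ,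
      (a ∈ S → ∃ w : Lp ℂ 2 ν, (fun ts => tensorMap μ ν hS hU hU1 V (a, ts)) =ᵐ[ν.prod ν]
        fun ts => w ts.1 * (starRingEnd ℂ) (U (a, ts.2))) ∧
      (a ∉ S → (fun ts => tensorMap μ ν hS hU hU1 V (a, ts)) =ᵐ[ν.prod ν] 0) := by
  have hcoe := coeFn_tensorMap hS hU hU1 (Lp.stronglyMeasurable V) (.refl _ _)
  filter_upwards [Measure.ae_ae_of_ae_prod hcoe,
    (ae_restrict_iff' hS).1 (ae_memLp_prodMk_left (Lp.memLp V))] with a ha hVa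
  refine ⟨fun haS => ⟨(hVa haS).toLp, ?_⟩, fun haS => ?_⟩
  · filter_upwards [ha, Measure.quasiMeasurePreserving_fst.ae (hVa haS).coeFn_toLp] with ts hts hV
    rw [hts, hV, tensorFun_of_mem haS]
  · filter_upwards [ha] with ts hts
    rw [hts, tensorFun_of_notMem haS, Pi.zero_apply]

theorem exists_tensorMap_eq_iff (hS : MeasurableSet S) (hU : StronglyMeasurable U)
    (hU1 : ∀ᵐ a ∂μ.restrict S, ∫⁻ s, ‖U (a, s)‖ₑ ^ 2 ∂ν = 1) (K : Lp ℂ 2 (μ.prod (ν.prod ν))) :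
    (∃ V, tensorMap μ ν hS hU hU1 V = K) ↔ ∀ᵐ a ∂μ,
      (a ∈ S → ∃ w : Lp ℂ 2 ν, (fun ts => K (a, ts)) =ᵐ[ν.prod ν]
        fun ts => w ts.1 * (starRingEnd ℂ) (U (a, ts.2))) ∧
      (a ∉ S → (fun ts => K (a, ts)) =ᵐ[ν.prod ν] 0) := by
  constructor
  · rintro ⟨V, rfl⟩
    exact ae_tensorMap_eq_mul hS hU hU1 V
  · intro hrank
    have hV := stronglyMeasurable_applyKernel (ν := ν) (Lp.stronglyMeasurable K) hU
    have hK := tensorFun_applyKernel_ae_eq hS hU (Lp.stronglyMeasurable K) hU1 hrank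
    have hVL : MemLp (applyKernel ν K U) 2 ((μ.restrict S).prod ν) :=
      (memLp_tensorFun_iff hS hU hU1 hV).1 ((memLp_congr_ae hK).2 (Lp.memLp K))
    exact ⟨hVL.toLp, Lp.ext ((coeFn_tensorMap hS hU hU1 hV hVL.coeFn_toLp).trans hK)⟩

end Tensor

section SquareSummable

variable {ι : Type*}

theorem memℓp_two_of_tsum_enorm_sq_ne_top {f : ι → ℂ} (h : ∑' i, ‖f i‖ₑ ^ 2 ≠ ∞) :
    Memℓp f 2 := by
  have hpow : ∀ i, ‖f i‖ ^ (2 : ℝ≥0∞).toReal = (‖f i‖ₑ ^ 2).toReal := fun i => by simp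
  refine memℓp_gen ?_
  simp only [hpow]
  exact ENNReal.summable_toReal h

theorem enorm_sq_lp_two (f : lp (fun _ : ι => ℂ) 2) : ‖f‖ₑ ^ 2 = ∑' i, ‖f i‖ₑ ^ 2 := by
  have hsum := lp.hasSum_norm (p := 2) (by norm_num) f
  have hpow : ∀ i, ‖f i‖ₑ ^ 2 = ENNReal.ofReal (‖f i‖ ^ (2 : ℝ≥0∞).toReal) := fun i => by
    rw [← ofReal_norm, ← ENNReal.ofReal_pow (norm_nonneg _)]
    norm_num
  simp only [hpow]
  rw [← ENNReal.ofReal_tsum_of_nonneg (fun i => by positivity) hsum.summable, hsum.tsum_eq,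
    ← ofReal_norm, ← ENNReal.ofReal_pow (norm_nonneg _)]
  norm_num

end SquareSummable

section Restrict

variable {α T : Type*} [MeasurableSpace α] [MeasurableSpace T]
  {μ : Measure α} {ν : Measure T} {S : Set α}

theorem ae_fst_mem_restrict_prod (hS : MeasurableSet S) :
    ∀ᵐ w ∂((μ.restrict S).prod ν), w.1 ∈ S :=
  Measure.quasiMeasurePreserving_fst.ae (ae_restrict_mem hS)

variable [SFinite μ] [SFinite ν]

theorem restrict_prod (S : Set α) :
    (μ.restrict S).prod ν = (μ.prod ν).restrict (Prod.fst ⁻¹' S) := by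
  conv_lhs => rw [← Measure.restrict_univ (μ := ν)]
  rw [Measure.prod_restrict, Set.prod_univ]

theorem lintegral_restrict_prod (hS : MeasurableSet S) (f : α × T → ℝ≥0∞) :
    ∫⁻ w, f w ∂((μ.restrict S).prod ν) =
      ∫⁻ w, S.indicator (fun _ => 1) w.1 * f w ∂(μ.prod ν) := by
  rw [restrict_prod, ← lintegral_indicator (measurable_fst hS)]
  refine lintegral_congr fun w => ?_
  by_cases h : w.1 ∈ S <;> simp [h]

theorem integral_restrict_prod (hS : MeasurableSet S) (f : α × T → ℂ) :
    ∫ w, f w ∂((μ.restrict S).prod ν) =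
      ∫ w, S.indicator (fun _ => 1) w.1 * f w ∂(μ.prod ν) := by
  rw [restrict_prod, ← integral_indicator (measurable_fst hS)]
  refine integral_congr_ae (.of_forall fun w => ?_)
  by_cases h : w.1 ∈ S <;> simp [h]

end Restrict

theorem int_eq_zero_of_mem_Ioo_of_add_mul_mem_Icc {a r : ℝ} {n : ℤ} (hr : r ∈ Set.Ioo 0 a)
    (hn : r + n * a ∈ Set.Icc 0 a) : n = 0 := by
  have hlt : (n : ℝ) < 1 := by nlinarith [hr.1, hr.2, hn.2]
  have hgt : (-1 : ℝ) < n := by nlinarith [hr.1, hr.2, hn.1]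
  have hlt' : n < 1 := by exact_mod_cast hlt
  have hgt' : -1 < n := by exact_mod_cast hgt
  lia

section UnitField

variable {m d : ℕ}

/-- A bounded measurable field over `S` of unit vectors of `L²(ℝ^d)`, as a function of
`(lam, t)`. -/
structure IsBoundedUnitField (S : Set (Fin m → ℝ)) (v : (Fin m → ℝ) × (Fin d → ℝ) → ℂ) :
    Prop where
  stronglyMeasurable : StronglyMeasurable v
  lintegral_enorm_sq : ∀ lam ∈ S, ∫⁻ t, ‖v (lam, t)‖ₑ ^ 2 = 1
  bounded : ∃ C : ℝ, ∀ w, ‖v w‖ ≤ C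

theorem measurable_prod_sub_const (x : Fin d → ℝ) :
    Measurable fun w : (Fin m → ℝ) × (Fin d → ℝ) => (w.1, w.2 - x) :=
  measurable_fst.prodMk (measurable_snd.sub_const x)

end UnitField

namespace AdaptedBasis

variable {𝔫 : Type*} [LieRing 𝔫] [LieAlgebra ℝ 𝔫] {m d : ℕ} (β : AdaptedBasis 𝔫 m d)

/-- The measure on `S × ℝ^d` whose `L²` space parametrizes the band-limited space: Plancherel
measure on `S` times Lebesgue measure. -/
noncomputable abbrev bandMeasure (S : Set (Fin m → ℝ)) : Measure ((Fin m → ℝ) × (Fin d → ℝ)) :=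
  (β.plancherelMeasure.restrict S).prod volume

/-- The inverse of `dualCoord` over the cross-section. -/
noncomputable def dualCoordInv : (Fin m → ℝ) × (Fin d → ℝ) → (Fin m → ℝ) × (Fin d → ℝ) :=
  fiberwiseMulVec fun lam => ((β.B lam)ᵀ)⁻¹

theorem measurable_dualCoordInv : Measurable β.dualCoordInv :=
  measurable_fiberwiseMulVec (measurable_matrix_inv β.measurable_B_transpose_apply)

theorem dualCoordInv_dualCoord {lam : Fin m → ℝ} (hlam : lam ∈ β.crossSection) (t : Fin d → ℝ) :
    β.dualCoordInv (β.dualCoord (lam, t)) = (lam, t) := by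
  have hdet : IsUnit ((β.B lam)ᵀ).det := by
    rw [Matrix.det_transpose]; exact hlam.isUnit
  simp only [dualCoordInv, dualCoord, fiberwiseMulVec, Matrix.mulVec_mulVec,
    Matrix.nonsing_inv_mul _ hdet, Matrix.one_mulVec]

theorem mulVec_dualCoordInv_snd {ξ : (Fin m → ℝ) × (Fin d → ℝ)} (hξ : ξ.1 ∈ β.crossSection) :
    (β.B ξ.1)ᵀ *ᵥ (β.dualCoordInv ξ).2 = ξ.2 := by
  have hdet : IsUnit ((β.B ξ.1)ᵀ).det := by
    rw [Matrix.det_transpose]; exact hξ.isUnit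
  simp only [dualCoordInv, fiberwiseMulVec, Matrix.mulVec_mulVec,
    Matrix.mul_nonsing_inv _ hdet, Matrix.one_mulVec]

/-- The product of `conj V` with the translate by `x` of a window `v`, in the coordinates
`(lam, B(lam)ᵀ t)`. Its Fourier transform in the second variable is the matrix coefficient of the
vectors parametrized by `v` and `V`. -/
noncomputable def windowed (S : Set (Fin m → ℝ)) (v V : (Fin m → ℝ) × (Fin d → ℝ) → ℂ)
    (w : (Fin d → ℝ) × ((Fin m → ℝ) × (Fin d → ℝ))) : ℂ :=
  S.indicator (fun _ => 1) w.2.1 *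
    ((starRingEnd ℂ) (V (β.dualCoordInv w.2)) * v (w.2.1, (β.dualCoordInv w.2).2 - w.1))

variable {S : Set (Fin m → ℝ)} {v V : (Fin m → ℝ) × (Fin d → ℝ) → ℂ}

theorem windowed_dualCoord {lam : Fin m → ℝ} (hlam : lam ∈ β.crossSection) (x t : Fin d → ℝ) :
    β.windowed S v V (x, β.dualCoord (lam, t)) =
      S.indicator (fun _ => 1) lam * ((starRingEnd ℂ) (V (lam, t)) * v (lam, t - x)) := by
  simp only [windowed, β.dualCoordInv_dualCoord hlam]
  rfl

theorem of_windowed_ne_zero {x : Fin d → ℝ} {ξ : (Fin m → ℝ) × (Fin d → ℝ)}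
    (h : β.windowed S v V (x, ξ) ≠ 0) : ξ.1 ∈ S ∧ v (ξ.1, (β.dualCoordInv ξ).2 - x) ≠ 0 :=
  ⟨Set.mem_of_indicator_ne_zero (left_ne_zero_of_mul h),
    right_ne_zero_of_mul (right_ne_zero_of_mul h)⟩

theorem stronglyMeasurable_windowed (hS : MeasurableSet S) (hv : StronglyMeasurable v)
    (hV : StronglyMeasurable V) : StronglyMeasurable (β.windowed S v V) := by
  have hinv : Measurable fun w : (Fin d → ℝ) × ((Fin m → ℝ) × (Fin d → ℝ)) =>
      β.dualCoordInv w.2 :=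
    β.measurable_dualCoordInv.comp measurable_snd
  have htrans : Measurable fun w : (Fin d → ℝ) × ((Fin m → ℝ) × (Fin d → ℝ)) =>
      (w.2.1, (β.dualCoordInv w.2).2 - w.1) :=
    measurable_snd.fst.prodMk (hinv.snd.sub measurable_fst)
  exact ((stronglyMeasurable_const.indicator hS).comp_measurable measurable_snd.fst).mul
    ((Complex.continuous_conj.comp_stronglyMeasurable (hV.comp_measurable hinv)).mul
      (hv.comp_measurable htrans))

theorem aestronglyMeasurable_windowed (hS : MeasurableSet S) (hv : StronglyMeasurable v)
    (hV : StronglyMeasurable V) (x : Fin d → ℝ) :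
    AEStronglyMeasurable fun ξ => β.windowed S v V (x, ξ) :=
  ((β.stronglyMeasurable_windowed hS hv hV).comp_measurable
    measurable_prodMk_left).aestronglyMeasurable

theorem lintegral_enorm_pow_windowed (hS : MeasurableSet S) (hv : StronglyMeasurable v)
    (hV : StronglyMeasurable V) (x : Fin d → ℝ) {k : ℕ} (hk : k ≠ 0) :
    ∫⁻ ξ, ‖β.windowed S v V (x, ξ)‖ₑ ^ k =
      ∫⁻ w, ‖V w‖ₑ ^ k * ‖v (w.1, w.2 - x)‖ₑ ^ k ∂β.bandMeasure S := by
  have hm := (β.stronglyMeasurable_windowed hS hv hV).comp_measurable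
    (measurable_prodMk_left (x := x))
  rw [← β.measurePreserving_dualCoord.lintegral_comp (f := fun ξ => ‖β.windowed S v V (x, ξ)‖ₑ ^ k)
    (hm.enorm.pow_const k), lintegral_restrict_prod hS]
  refine lintegral_congr_ae ?_
  filter_upwards [Measure.quasiMeasurePreserving_fst.ae β.ae_plancherelMeasure_det_B_ne_zero]
    with ⟨lam, t⟩ hlam
  rw [β.windowed_dualCoord hlam]
  by_cases h : lam ∈ S
  · simp only [Set.indicator_of_mem h, one_mul, enorm_mul, mul_pow, RCLike.enorm_conj]
  · simp [h, hk]

theorem lintegral_enorm_sq_unitField (hS : MeasurableSet S) (hv : IsBoundedUnitField S v)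
    (x : Fin d → ℝ) :
    ∫⁻ w, ‖v (w.1, w.2 - x)‖ₑ ^ 2 ∂β.bandMeasure S = β.plancherelMeasure S := by
  rw [lintegral_prod (fun w : (Fin m → ℝ) × (Fin d → ℝ) => ‖v (w.1, w.2 - x)‖ₑ ^ 2)
    ((hv.stronglyMeasurable.comp_measurable
      (measurable_prod_sub_const x)).enorm.pow_const 2).aemeasurable]
  have htrans (lam : Fin m → ℝ) :
      ∫⁻ t : Fin d → ℝ, ‖v (lam, t - x)‖ₑ ^ 2 = ∫⁻ t, ‖v (lam, t)‖ₑ ^ 2 :=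
    lintegral_sub_right_eq_self (fun t => ‖v (lam, t)‖ₑ ^ 2) x
  simp only [htrans]
  rw [setLIntegral_congr_fun hS hv.lintegral_enorm_sq, setLIntegral_one]

theorem memLp_unitField (hS : MeasurableSet S) (hSf : β.plancherelMeasure S < ∞)
    (hv : IsBoundedUnitField S v) (x : Fin d → ℝ) :
    MemLp (fun w : (Fin m → ℝ) × (Fin d → ℝ) => v (w.1, w.2 - x)) 2 (β.bandMeasure S) :=
  (memLp_two_iff_lintegral_enorm_sq (hv.stronglyMeasurable.comp_measurable
    (measurable_prod_sub_const x)).aestronglyMeasurable).2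
    ((β.lintegral_enorm_sq_unitField hS hv x).trans_lt hSf)

theorem integrable_windowed (hS : MeasurableSet S) (hSf : β.plancherelMeasure S < ∞)
    (hv : IsBoundedUnitField S v) (hV : StronglyMeasurable V) (hV2 : MemLp V 2 (β.bandMeasure S))
    (x : Fin d → ℝ) : Integrable fun ξ => β.windowed S v V (x, ξ) := by
  have hnorm := β.lintegral_enorm_pow_windowed hS hv.stronglyMeasurable hV x one_ne_zero
  have hmul := (hV2.integrable_mul (β.memLp_unitField hS hSf hv x)).hasFiniteIntegral
  refine ⟨β.aestronglyMeasurable_windowed hS hv.stronglyMeasurable hV x, ?_⟩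
  simp only [pow_one] at hnorm
  rw [hasFiniteIntegral_iff_enorm] at hmul ⊢
  simpa only [hnorm, Pi.mul_apply, enorm_mul] using hmul

theorem memLp_windowed (hS : MeasurableSet S) (hv : IsBoundedUnitField S v)
    (hV : StronglyMeasurable V) (hV2 : MemLp V 2 (β.bandMeasure S)) (x : Fin d → ℝ) :
    MemLp (fun ξ => β.windowed S v V (x, ξ)) 2 := by
  obtain ⟨C, hC⟩ := hv.bounded
  have hC' (w) : ‖v w‖ₑ ≤ ENNReal.ofReal C := by
    rw [← ofReal_norm]; exact ENNReal.ofReal_le_ofReal (hC w)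
  rw [memLp_two_iff_lintegral_enorm_sq
    (β.aestronglyMeasurable_windowed hS hv.stronglyMeasurable hV x),
    β.lintegral_enorm_pow_windowed hS hv.stronglyMeasurable hV x two_ne_zero]
  calc ∫⁻ w, ‖V w‖ₑ ^ 2 * ‖v (w.1, w.2 - x)‖ₑ ^ 2 ∂β.bandMeasure S
      ≤ ∫⁻ w, ‖V w‖ₑ ^ 2 * ENNReal.ofReal C ^ 2 ∂β.bandMeasure S :=
        lintegral_mono fun w => by gcongr; exact hC' _
    _ = (∫⁻ w, ‖V w‖ₑ ^ 2 ∂β.bandMeasure S) * ENNReal.ofReal C ^ 2 :=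
        lintegral_mul_const _ (hV.enorm.pow_const 2)
    _ < ∞ := ENNReal.mul_lt_top ((memLp_two_iff_lintegral_enorm_sq hV2.1).1 hV2) (by simp)

theorem lintegral_lintegral_unitField (hS : MeasurableSet S) (hv : IsBoundedUnitField S v)
    (hV : StronglyMeasurable V) :
    ∫⁻ x, ∫⁻ w, ‖V w‖ₑ ^ 2 * ‖v (w.1, w.2 - x)‖ₑ ^ 2 ∂β.bandMeasure S =
      ∫⁻ w, ‖V w‖ₑ ^ 2 ∂β.bandMeasure S := by
  have hsub : Measurable fun p : (Fin d → ℝ) × ((Fin m → ℝ) × (Fin d → ℝ)) =>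
      (p.2.1, p.2.2 - p.1) :=
    measurable_snd.fst.prodMk (measurable_snd.snd.sub measurable_fst)
  have hmul : Measurable fun p : (Fin d → ℝ) × ((Fin m → ℝ) × (Fin d → ℝ)) =>
      ‖V p.2‖ₑ ^ 2 * ‖v (p.2.1, p.2.2 - p.1)‖ₑ ^ 2 :=
    ((hV.comp_measurable measurable_snd).enorm.pow_const 2).mul
      ((hv.stronglyMeasurable.comp_measurable hsub).enorm.pow_const 2)
  rw [lintegral_lintegral_swap hmul.aemeasurable]
  refine lintegral_congr_ae ?_
  filter_upwards [ae_fst_mem_restrict_prod hS] with w hw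
  have hsub' : Measurable fun x : Fin d → ℝ => (w.1, w.2 - x) :=
    measurable_const.prodMk (measurable_const.sub measurable_id)
  rw [lintegral_const_mul (f := fun x => ‖v (w.1, w.2 - x)‖ₑ ^ 2) _
    ((hv.stronglyMeasurable.comp_measurable hsub').enorm.pow_const 2),
    lintegral_sub_left_eq_self (fun t => ‖v (w.1, t)‖ₑ ^ 2), hv.lintegral_enorm_sq w.1 hw,
    mul_one]

theorem lintegral_comp_groupCoordInv
    {F : (Fin d → ℝ) × ((Fin m → ℝ) × (Fin d → ℝ)) → ℝ≥0∞} (hF : Measurable F) :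
    ∫⁻ g : β.N, F (β.groupCoordInv g) = ∫⁻ w, F w := by
  rw [← β.measurePreserving_groupCoord.lintegral_comp (f := fun g => F (β.groupCoordInv g))
    (hF.comp β.measurable_groupCoordInv)]
  rfl

theorem lintegral_enorm_sq_sliceFourier_windowed (hS : MeasurableSet S)
    (hSf : β.plancherelMeasure S < ∞) (hv : IsBoundedUnitField S v)
    (hV : StronglyMeasurable V) (hV2 : MemLp V 2 (β.bandMeasure S)) :
    ∫⁻ g : β.N, ‖sliceFourier (β.windowed S v V) (β.groupCoordInv g)‖ₑ ^ 2 =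
      ∫⁻ w, ‖V w‖ₑ ^ 2 ∂β.bandMeasure S := by
  have hm := stronglyMeasurable_sliceFourier
    (β.stronglyMeasurable_windowed hS hv.stronglyMeasurable hV)
  have hslice (x : Fin d → ℝ) : ∫⁻ ξ, ‖sliceFourier (β.windowed S v V) (x, ξ)‖ₑ ^ 2 =
      ∫⁻ w, ‖V w‖ₑ ^ 2 * ‖v (w.1, w.2 - x)‖ₑ ^ 2 ∂β.bandMeasure S := by
    rw [← β.lintegral_enorm_pow_windowed hS hv.stronglyMeasurable hV x two_ne_zero]
    simp only [sliceFourier]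
    exact lintegral_enorm_sq_integral_prodChar_mul (β.integrable_windowed hS hSf hv hV hV2 x)
      (β.memLp_windowed hS hv hV hV2 x)
  calc ∫⁻ g : β.N, ‖sliceFourier (β.windowed S v V) (β.groupCoordInv g)‖ₑ ^ 2
      = ∫⁻ w, ‖sliceFourier (β.windowed S v V) w‖ₑ ^ 2 :=
        β.lintegral_comp_groupCoordInv (hm.enorm.pow_const 2)
    _ = ∫⁻ x, ∫⁻ w, ‖V w‖ₑ ^ 2 * ‖v (w.1, w.2 - x)‖ₑ ^ 2 ∂β.bandMeasure S := by
        rw [Measure.volume_eq_prod, lintegral_prod _ (hm.enorm.pow_const 2).aemeasurable]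
        simp only [hslice]
    _ = ∫⁻ w, ‖V w‖ₑ ^ 2 ∂β.bandMeasure S := β.lintegral_lintegral_unitField hS hv hV

/-- A window adapted to the quasi-lattice with parameters `q` and `b`: the supports of the fibres
pack under the lattice dual to the modulations `π_lam(exp((k_j / q_j) Y_j))`, and the translates of
the fibres by `∏ (1 / b_j) ℤ` have constant square sum. -/
structure IsTilingWindow (S : Set (Fin m → ℝ)) (q b : Fin d → ℝ)
    (v : (Fin m → ℝ) × (Fin d → ℝ) → ℂ) : Prop extends IsBoundedUnitField S v where
  packs : ∀ lam ∈ S, ∀ t t', ∀ n : Fin d → ℤ, v (lam, t) ≠ 0 → v (lam, t') ≠ 0 →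
    (β.B lam)ᵀ *ᵥ t' = (β.B lam)ᵀ *ᵥ t + (fun i => n i * q i) → n = 0
  tsum_translate : ∀ lam ∈ S, ∀ᵐ t : Fin d → ℝ,
    ∑' p : Fin d → ℤ, ‖v (lam, t - fun i => p i / b i)‖ₑ ^ 2 = ENNReal.ofReal (∏ i, b i)

variable {a : Fin m → ℝ} {q b : Fin d → ℝ}

theorem ae_windowed_eq_zero_or (hSc : S ⊆ β.crossSection) (hSa : S ⊆ Set.Icc 0 a)
    (hv : β.IsTilingWindow S q b v) (x : Fin d → ℝ) :
    ∀ᵐ ξ : (Fin m → ℝ) × (Fin d → ℝ), ∀ n : (Fin m → ℤ) × (Fin d → ℤ), n ≠ 0 →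
      β.windowed S v V (x, ξ) = 0 ∨
      β.windowed S v V (x, ξ + (fun i => n.1 i * a i, fun j => n.2 j * q j)) = 0 := by
  have hinterior : ∀ᵐ lam : Fin m → ℝ, lam ∈ Set.univ.pi (fun i => Set.Ioo 0 (a i)) ↔
      lam ∈ Set.Icc 0 a :=
    Measure.univ_pi_Ioo_ae_eq_Icc.mem_iff
  have hinterior' : ∀ᵐ ξ : (Fin m → ℝ) × (Fin d → ℝ),
      ξ.1 ∈ Set.univ.pi (fun i => Set.Ioo 0 (a i)) ↔ ξ.1 ∈ Set.Icc 0 a :=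
    Measure.quasiMeasurePreserving_fst.ae hinterior
  filter_upwards [hinterior'] with ⟨lam, η⟩ hξ ⟨n₁, n₂⟩ hn
  by_contra! hne
  obtain ⟨hlam, hvt⟩ := β.of_windowed_ne_zero hne.1
  obtain ⟨hlam', hvt'⟩ := β.of_windowed_ne_zero hne.2
  simp only [Prod.mk_add_mk] at hlam hvt hlam' hvt'
  have hn₁ : n₁ = 0 := funext fun i => int_eq_zero_of_mem_Ioo_of_add_mul_mem_Icc
    (hξ.2 (hSa hlam) i (Set.mem_univ i)) ⟨(hSa hlam').1 i, (hSa hlam').2 i⟩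
  have hzero : (fun i => (n₁ i : ℝ) * a i) = 0 := by
    funext i; simp [hn₁]
  rw [hzero, add_zero] at hvt'
  refine hn (Prod.ext hn₁ (hv.packs lam hlam _ _ n₂ hvt hvt' ?_))
  rw [Matrix.mulVec_sub, Matrix.mulVec_sub,
    β.mulVec_dualCoordInv_snd (ξ := (lam, η)) (hSc hlam),
    β.mulVec_dualCoordInv_snd (ξ := (lam, η + fun j => (n₂ j : ℝ) * q j)) (hSc hlam),
    sub_add_eq_add_sub]

theorem tsum_enorm_sq_sliceFourier_windowed_right (ha : ∀ i, 0 < a i) (hq : ∀ i, 0 < q i)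
    (hS : MeasurableSet S) (hSf : β.plancherelMeasure S < ∞) (hSc : S ⊆ β.crossSection)
    (hSa : S ⊆ Set.Icc 0 a) (hv : β.IsTilingWindow S q b v) (hV : StronglyMeasurable V)
    (hV2 : MemLp V 2 (β.bandMeasure S)) (x : Fin d → ℝ) :
    ∑' n : (Fin m → ℤ) × (Fin d → ℤ), ‖sliceFourier (β.windowed S v V)
        (x, (fun i => n.1 i / a i, fun j => n.2 j / q j))‖ₑ ^ 2 =
      ENNReal.ofReal ((∏ i, a i) * ∏ j, q j) *
        ∫⁻ w, ‖V w‖ₑ ^ 2 * ‖v (w.1, w.2 - x)‖ₑ ^ 2 ∂β.bandMeasure S := by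
  rw [← β.lintegral_enorm_pow_windowed hS hv.stronglyMeasurable hV x two_ne_zero,
    ← tsum_enorm_sq_integral_prodChar_mul ha hq
      (β.integrable_windowed hS hSf hv.toIsBoundedUnitField hV hV2 x)
      (β.memLp_windowed hS hv.toIsBoundedUnitField hV hV2 x)
      (β.ae_windowed_eq_zero_or hSc hSa hv x)]
  simp only [sliceFourier, prodChar_comm]

theorem ae_tsum_translate (hS : MeasurableSet S) (hv : β.IsTilingWindow S q b v) :
    ∀ᵐ w ∂β.bandMeasure S, ∑' p : Fin d → ℤ, ‖v (w.1, w.2 - fun i => p i / b i)‖ₑ ^ 2 =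
      ENNReal.ofReal (∏ i, b i) := by
  have hm : Measurable fun w : (Fin m → ℝ) × (Fin d → ℝ) =>
      ∑' p : Fin d → ℤ, ‖v (w.1, w.2 - fun i => p i / b i)‖ₑ ^ 2 :=
    Measurable.tsum fun p => (hv.stronglyMeasurable.comp_measurable
      (measurable_prod_sub_const _)).enorm.pow_const 2
  rw [Measure.ae_prod_iff_ae_ae (measurableSet_eq_fun hm measurable_const)]
  filter_upwards [ae_restrict_mem hS] with lam hlam
  exact hv.tsum_translate lam hlam

theorem tsum_enorm_sq_sliceFourier_windowed (ha : ∀ i, 0 < a i) (hq : ∀ i, 0 < q i)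
    (hS : MeasurableSet S) (hSf : β.plancherelMeasure S < ∞) (hSc : S ⊆ β.crossSection)
    (hSa : S ⊆ Set.Icc 0 a) (hv : β.IsTilingWindow S q b v) (hV : StronglyMeasurable V)
    (hV2 : MemLp V 2 (β.bandMeasure S)) :
    ∑' p : Fin d → ℤ, ∑' n : (Fin m → ℤ) × (Fin d → ℤ), ‖sliceFourier (β.windowed S v V)
        (fun i => p i / b i, (fun i => n.1 i / a i, fun j => n.2 j / q j))‖ₑ ^ 2 =
      ENNReal.ofReal ((∏ i, a i) * ∏ j, q j) * (ENNReal.ofReal (∏ i, b i) *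
        ∫⁻ w, ‖V w‖ₑ ^ 2 ∂β.bandMeasure S) := by
  have hm (x : Fin d → ℝ) : Measurable fun w : (Fin m → ℝ) × (Fin d → ℝ) =>
      ‖V w‖ₑ ^ 2 * ‖v (w.1, w.2 - x)‖ₑ ^ 2 :=
    (hV.enorm.pow_const 2).mul ((hv.stronglyMeasurable.comp_measurable
      (measurable_prod_sub_const x)).enorm.pow_const 2)
  simp only [β.tsum_enorm_sq_sliceFourier_windowed_right ha hq hS hSf hSc hSa hv hV hV2]
  rw [ENNReal.tsum_mul_left, ← lintegral_tsum fun p => (hm _).aemeasurable,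
    ← lintegral_const_mul _ (hV.enorm.pow_const 2)]
  simp only [ENNReal.tsum_mul_left]
  congr 1
  refine lintegral_congr_ae ?_
  filter_upwards [β.ae_tsum_translate hS hv] with w hw
  rw [hw, mul_comm]

end AdaptedBasis

namespace AdaptedBasis

variable {𝔫 : Type*} [LieRing 𝔫] [LieAlgebra ℝ 𝔫] {m d : ℕ} (β : AdaptedBasis 𝔫 m d)
  {S : Set (Fin m → ℝ)} {U v : (Fin m → ℝ) × (Fin d → ℝ) → ℂ}

/-- The isometry of `L²(S × ℝ^d)` onto the multiplicity-free band-limited space with unit field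
`U`: the Plancherel transform of the image of `V` has the fibres `V(lam) ⊗ U(lam)`. -/
noncomputable def bandLimited (hS : MeasurableSet S) (hU : StronglyMeasurable U)
    (hU1 : ∀ᵐ lam ∂β.plancherelMeasure.restrict S, ∫⁻ s, ‖U (lam, s)‖ₑ ^ 2 = 1) :
    Lp ℂ 2 (β.bandMeasure S) →ₗᵢ[ℂ] β.L2N :=
  β.plancherel.symm.toLinearIsometry.comp (tensorMap β.plancherelMeasure volume hS hU hU1)

variable (hS : MeasurableSet S) (hU : StronglyMeasurable U)
  (hU1 : ∀ᵐ lam ∂β.plancherelMeasure.restrict S, ∫⁻ s, ‖U (lam, s)‖ₑ ^ 2 = 1)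

theorem plancherel_bandLimited (V : Lp ℂ 2 (β.bandMeasure S)) :
    β.plancherel (β.bandLimited hS hU hU1 V) =
      tensorMap β.plancherelMeasure volume hS hU hU1 V :=
  β.plancherel.apply_symm_apply _

theorem memMultiplicityFree_iff {u : (Fin m → ℝ) → L2R d}
    (hUu : ∀ᵐ lam ∂β.plancherelMeasure.restrict S, (fun s => U (lam, s)) =ᵐ[volume] u lam)
    (K : β.HSField) :
    β.MemMultiplicityFree S u K ↔
      ∃ V, tensorMap β.plancherelMeasure volume hS hU hU1 V = K := by
  refine Iff.trans (eventually_congr ?_) (exists_tensorMap_eq_iff hS hU hU1 K).symm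
  filter_upwards [(ae_restrict_iff' hS).1 hUu] with lam hlam
  refine and_congr_left' (imp_congr_right fun hlamS => exists_congr fun w => ?_)
  have htensor : (fun ts : (Fin d → ℝ) × (Fin d → ℝ) =>
      w ts.1 * (starRingEnd ℂ) (u lam ts.2)) =ᵐ[volume]
        fun ts => w ts.1 * (starRingEnd ℂ) (U (lam, ts.2)) := by
    have hsnd : ∀ᵐ ts : (Fin d → ℝ) × (Fin d → ℝ), U (lam, ts.2) = u lam ts.2 :=
      Measure.quasiMeasurePreserving_snd.ae (hlam hlamS)
    filter_upwards [hsnd] with ts hts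
    rw [hts]
  exact ⟨fun hw => EventuallyEq.trans hw htensor, fun hw => EventuallyEq.trans hw htensor.symm⟩

theorem mem_range_bandLimited_iff {u : (Fin m → ℝ) → L2R d}
    (hUu : ∀ᵐ lam ∂β.plancherelMeasure.restrict S, (fun s => U (lam, s)) =ᵐ[volume] u lam)
    (f : β.L2N) :
    (∃ V, β.bandLimited hS hU hU1 V = f) ↔
      ∃ K : β.HSField, β.IsPlancherelTransform f K ∧ β.MemMultiplicityFree S u K := by
  simp only [β.isPlancherelTransform_iff, β.memMultiplicityFree_iff hS hU hU1 hUu,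
    exists_eq_left', ← β.plancherel_bandLimited hS hU hU1, β.plancherel.injective.eq_iff]

theorem measurable_phase_mk (g : β.N) :
    Measurable fun w : (Fin m → ℝ) × (Fin d → ℝ) => β.phase w.1 g w.2 := by
  simpa only [Function.comp_def] using β.measurable_phase.comp
    (measurable_fst.prodMk (measurable_const.prodMk measurable_snd))

theorem stronglyMeasurable_translate (hv : StronglyMeasurable v) (g : β.N) :
    StronglyMeasurable fun w : (Fin m → ℝ) × (Fin d → ℝ) =>
      β.phase w.1 g w.2 * v (w.1, w.2 - N.xc g) :=
  (β.measurable_phase_mk g).stronglyMeasurable.mul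
    (hv.comp_measurable (measurable_prod_sub_const _))

theorem memLp_translate (hS : MeasurableSet S) (hSf : β.plancherelMeasure S < ∞)
    (hv : IsBoundedUnitField S v) (g : β.N) :
    MemLp (fun w : (Fin m → ℝ) × (Fin d → ℝ) => β.phase w.1 g w.2 * v (w.1, w.2 - N.xc g)) 2
      (β.bandMeasure S) :=
  (β.memLp_unitField hS hSf hv (N.xc g)).of_le
    (β.stronglyMeasurable_translate hv.stronglyMeasurable g).aestronglyMeasurable
    (.of_forall fun w => by rw [norm_mul, norm_phase, one_mul])

variable (hSf : β.plancherelMeasure S < ∞) (hv : IsBoundedUnitField S v)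
  {V₀ : Lp ℂ 2 (β.bandMeasure S)} (hV₀ : V₀ =ᵐ[β.bandMeasure S] v)

include hSf hv hV₀

theorem leftReg_bandLimited (g : β.N) :
    β.leftReg g (β.bandLimited hS hU hU1 V₀) =
      β.bandLimited hS hU hU1 (β.memLp_translate hS hSf hv g).toLp := by
  apply β.plancherel.injective
  rw [plancherel_leftReg, plancherel_bandLimited, plancherel_bandLimited]
  have htranslate := coeFn_tensorMap hS hU hU1
    (β.stronglyMeasurable_translate hv.stronglyMeasurable g)
    (β.memLp_translate hS hSf hv g).coeFn_toLp
  have hshift := (β.measurePreserving_kernelShift (N.xc g)).quasiMeasurePreserving.ae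
    (coeFn_tensorMap hS hU hU1 hv.stronglyMeasurable hV₀)
  refine Lp.ext (((β.coeFn_kernelLeftReg g _).trans ?_).trans htranslate.symm)
  filter_upwards [hshift] with w hw
  rw [hw]
  simp only [tensorFun]
  ring

theorem inner_leftReg_bandLimited (g : β.N) (V : Lp ℂ 2 (β.bandMeasure S)) :
    inner ℂ (β.leftReg g (β.bandLimited hS hU hU1 V₀)) (β.bandLimited hS hU hU1 V) =
      (starRingEnd ℂ) (sliceFourier (β.windowed S v V) (β.groupCoordInv g)) := by
  rw [β.leftReg_bandLimited hS hU hU1 hSf hv hV₀, LinearIsometry.inner_map_map,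
    ← inner_conj_symm]
  congr 1
  have hmeas : AEStronglyMeasurable fun ζ =>
      prodChar (β.groupCoordInv g).2 ζ * β.windowed S v V ((β.groupCoordInv g).1, ζ) :=
    (continuous_prodChar.comp (continuous_const.prodMk continuous_id)).aestronglyMeasurable.mul
      (β.aestronglyMeasurable_windowed hS hv.stronglyMeasurable (Lp.stronglyMeasurable V) _)
  calc inner ℂ V ((β.memLp_translate hS hSf hv g).toLp _)
      = ∫ w, β.phase w.1 g w.2 * ((starRingEnd ℂ) (V w) * v (w.1, w.2 - N.xc g))
          ∂β.bandMeasure S := by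
        rw [L2.inner_def]
        refine integral_congr_ae ?_
        filter_upwards [(β.memLp_translate hS hSf hv g).coeFn_toLp] with w hw
        rw [hw, RCLike.inner_apply]
        ring
    _ = sliceFourier (β.windowed S v V) (β.groupCoordInv g) := by
        rw [integral_restrict_prod hS, sliceFourier,
          ← integral_comp_measurePreserving β.measurePreserving_dualCoord hmeas]
        refine integral_congr_ae ?_
        filter_upwards [Measure.quasiMeasurePreserving_fst.ae
          β.ae_plancherelMeasure_det_B_ne_zero] with ⟨lam, t⟩ hlam
        have hphase := β.phase_groupCoord lam (N.xc g) t (N.zc g, N.yc g)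
        rw [show β.groupCoord (N.xc g, (N.zc g, N.yc g)) = g from rfl] at hphase
        simp only [groupCoordInv, hphase]
        rw [windowed_dualCoord β hlam, prodChar_comm]
        ring

end AdaptedBasis

section Frames

variable {E : Type*} [NormedAddCommGroup E] [InnerProductSpace ℂ E]

theorem exists_linearIsometry_Lp {α : Type*} [MeasurableSpace α] {μ : Measure α} {e : α → E}
    (hm : ∀ x, AEStronglyMeasurable (fun g => inner ℂ (e g) x) μ)
    (h : ∀ x, ∫⁻ g, ‖inner ℂ (e g) x‖ₑ ^ 2 ∂μ = ‖x‖ₑ ^ 2) :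
    ∃ W : E →ₗᵢ[ℂ] Lp ℂ 2 μ, ∀ x, W x =ᵐ[μ] fun g => inner ℂ (e g) x := by
  have hL (x : E) : MemLp (fun g => inner ℂ (e g) x) 2 μ := by
    rw [memLp_two_iff_lintegral_enorm_sq (hm x), h]
    exact ENNReal.pow_lt_top enorm_lt_top
  exact ⟨
    { toFun x := (hL x).toLp
      map_add' x y := by
        rw [← MemLp.toLp_add]
        exact MemLp.toLp_congr _ _ (.of_forall fun g => inner_add_right _ _ _)
      map_smul' c x := by
        rw [RingHom.id_apply, ← MemLp.toLp_const_smul]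
        exact MemLp.toLp_congr _ _ (.of_forall fun g => inner_smul_right _ _ _)
      norm_map' x := norm_eq_of_enorm_sq_eq ((enorm_sq_toLp (hL x)).trans (h x)) },
    fun x => (hL x).coeFn_toLp⟩

variable {ι : Type*} {e : ι → E} (h : ∀ x, ∑' i, ‖inner ℂ (e i) x‖ₑ ^ 2 = ‖x‖ₑ ^ 2)

include h

theorem exists_linearIsometry_lp :
    ∃ D : E →ₗᵢ[ℂ] lp (fun _ : ι => ℂ) 2, ∀ x i, D x i = inner ℂ (e i) x := by
  have hL (x : E) : Memℓp (fun i => inner ℂ (e i) x) 2 :=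
    memℓp_two_of_tsum_enorm_sq_ne_top (by rw [h]; exact ENNReal.pow_ne_top enorm_ne_top)
  exact ⟨
    { toFun x := ⟨fun i => inner ℂ (e i) x, hL x⟩
      map_add' x y := Subtype.ext (funext fun i => inner_add_right _ _ _)
      map_smul' c x := Subtype.ext (funext fun i => inner_smul_right _ _ _)
      norm_map' x := norm_eq_of_enorm_sq_eq ((enorm_sq_lp_two _).trans (h x)) },
    fun x i => rfl⟩

theorem orthonormal_of_parseval (h1 : ∀ i, ‖e i‖ = 1) : Orthonormal ℂ e := by
  classical
  refine ⟨h1, fun i j hij => ?_⟩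
  have hself : ‖inner ℂ (e j) (e j)‖ₑ ^ 2 = 1 := by
    rw [inner_self_eq_norm_sq_to_K, h1]
    simp
  have hsum := h (e j)
  rw [ENNReal.tsum_eq_add_tsum_ite j, hself, enorm_eq_one_of_norm_eq_one (h1 j), one_pow] at hsum
  have hzero := (ENNReal.add_right_inj ENNReal.one_ne_top).1 (hsum.trans (add_zero 1).symm)
  simpa [hij] using ENNReal.tsum_eq_zero.1 hzero i

theorem exists_hilbertBasis_of_parseval [CompleteSpace E] (h1 : ∀ i, ‖e i‖ = 1) :
    ∃ b : HilbertBasis ι ℂ E, ∀ i, b i = e i := by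
  have hbot : (Submodule.span ℂ (Set.range e))ᗮ = ⊥ := by
    refine (Submodule.eq_bot_iff _).2 fun x hx => ?_
    have hcoef (i : ι) : inner ℂ (e i) x = 0 := hx (e i) (Submodule.subset_span ⟨i, rfl⟩)
    have hsum := h x
    simp only [hcoef] at hsum
    simpa using hsum.symm
  exact ⟨HilbertBasis.mkOfOrthogonalEqBot (orthonormal_of_parseval h h1) hbot, fun i => by
    rw [HilbertBasis.coe_mkOfOrthogonalEqBot]⟩

end Frames

section TileWindow

variable {Λ : Type*} {d : ℕ}

/-- The indicator of `E` normalized by `√(∏ b_j)`: its fibres are unit vectors when those of `E`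
have the measure of a fundamental domain of `∏ (1 / b_j) ℤ`. -/
noncomputable def tileWindow (b : Fin d → ℝ) (E : Set (Λ × (Fin d → ℝ))) :
    Λ × (Fin d → ℝ) → ℂ :=
  E.indicator fun _ => (√(∏ i, b i) : ℂ)

theorem enorm_sq_tileWindow {b : Fin d → ℝ} (hb : ∀ i, 0 < b i) (E : Set (Λ × (Fin d → ℝ)))
    (w : Λ × (Fin d → ℝ)) :
    ‖tileWindow b E w‖ₑ ^ 2 = E.indicator (fun _ => ENNReal.ofReal (∏ i, b i)) w := by
  have hconst : ‖(√(∏ i, b i) : ℂ)‖ₑ ^ 2 = ENNReal.ofReal (∏ i, b i) := by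
    rw [← ofReal_norm, ← ENNReal.ofReal_pow (norm_nonneg _), Complex.norm_real,
      Real.norm_eq_abs, sq_abs, Real.sq_sqrt (Finset.prod_nonneg fun i _ => (hb i).le)]
  by_cases h : w ∈ E <;> simp [tileWindow, h, hconst]

theorem mem_of_tileWindow_ne_zero {b : Fin d → ℝ} {E : Set (Λ × (Fin d → ℝ))}
    {w : Λ × (Fin d → ℝ)} (h : tileWindow b E w ≠ 0) : w ∈ E :=
  Set.mem_of_indicator_ne_zero h

theorem intCast_div_injective {r : Fin d → ℝ} (hr : ∀ j, 0 < r j) :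
    Function.Injective fun (n : Fin d → ℤ) j => (n j : ℝ) / r j := fun n n' h => by
  funext j
  exact_mod_cast (div_left_inj' (hr j).ne').1 (congrFun h j)

theorem diagonal_inv_mulVec_intCast (b : Fin d → ℝ) (n : Fin d → ℤ) :
    (Matrix.diagonal b⁻¹ *ᵥ fun i => (n i : ℝ)) = fun i => n i / b i := by
  funext i
  rw [Matrix.mulVec_diagonal, Pi.inv_apply, inv_mul_eq_div]

theorem det_diagonal_inv (b : Fin d → ℝ) : (Matrix.diagonal b⁻¹).det = (∏ i, b i)⁻¹ := by
  simp only [Matrix.det_diagonal, Pi.inv_apply, Finset.prod_inv_distrib]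

theorem det_diagonal_inv_ne_zero {b : Fin d → ℝ} (hb : ∀ i, 0 < b i) :
    (Matrix.diagonal b⁻¹).det ≠ 0 := by
  rw [det_diagonal_inv]
  exact inv_ne_zero (Finset.prod_pos fun i _ => hb i).ne'

variable {b : Fin d → ℝ} {E : Set (Λ × (Fin d → ℝ))} {lam : Λ}

theorem lintegral_enorm_sq_tileWindow [MeasurableSpace Λ] (hb : ∀ i, 0 < b i)
    (hE : MeasurableSet E)
    (hF : IsAddFundamentalDomain (matrixLattice (Matrix.diagonal b⁻¹)) {t | (lam, t) ∈ E}) :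
    ∫⁻ t, ‖tileWindow b E (lam, t)‖ₑ ^ 2 = 1 := by
  have hpos : 0 < ∏ i, b i := Finset.prod_pos fun i _ => hb i
  have hslice (t : Fin d → ℝ) : E.indicator (fun _ => ENNReal.ofReal (∏ i, b i)) (lam, t) =
      {t | (lam, t) ∈ E}.indicator (fun _ => ENNReal.ofReal (∏ i, b i)) t := rfl
  have hEslice : MeasurableSet {t | (lam, t) ∈ E} := measurable_prodMk_left hE
  simp only [enorm_sq_tileWindow hb, hslice]
  rw [lintegral_indicator_const hEslice,
    volume_eq_of_isAddFundamentalDomain (det_diagonal_inv_ne_zero hb) hF, det_diagonal_inv,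
    abs_of_pos (inv_pos.2 hpos), ← ENNReal.ofReal_mul hpos.le, mul_inv_cancel₀ hpos.ne',
    ENNReal.ofReal_one]

theorem ae_tsum_enorm_sq_tileWindow (hb : ∀ i, 0 < b i)
    (hF : IsAddFundamentalDomain (matrixLattice (Matrix.diagonal b⁻¹)) {t | (lam, t) ∈ E})
    (hp : PacksUnder (fun (k : matrixLattice (Matrix.diagonal b⁻¹)) t => k +ᵥ t)
      {t | (lam, t) ∈ E}) :
    ∀ᵐ t : Fin d → ℝ, ∑' n : Fin d → ℤ, ‖tileWindow b E (lam, t - fun i => n i / b i)‖ₑ ^ 2 =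
      ENNReal.ofReal (∏ i, b i) := by
  filter_upwards [ae_existsUnique_sub_mulVec_mem (det_diagonal_inv_ne_zero hb) hF hp]
    with t ⟨n₀, hn₀, hunique⟩
  simp only [diagonal_inv_mulVec_intCast] at hn₀ hunique
  simp only [enorm_sq_tileWindow hb]
  rw [tsum_eq_single n₀ fun n hn => Set.indicator_of_notMem (fun h => hn (hunique n h)) _,
    Set.indicator_of_mem (by exact hn₀)]

end TileWindow

namespace AdaptedBasis

variable {𝔫 : Type*} [LieRing 𝔫] [LieAlgebra ℝ 𝔫] {m d : ℕ} (β : AdaptedBasis 𝔫 m d)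

/-- A generating matrix of the lattice of those `s ∈ ℝ^d` for which `B(lam)ᵀ s ∈ ∏ q_j ℤ`. -/
noncomputable def modulationLatticeMatrix (q : Fin d → ℝ) (lam : Fin m → ℝ) :
    Matrix (Fin d) (Fin d) ℝ :=
  ((β.B lam)ᵀ)⁻¹ * Matrix.diagonal q

variable {S : Set (Fin m → ℝ)} {a : Fin m → ℝ} {q b : Fin d → ℝ}

theorem measurable_modulationLatticeMatrix (q : Fin d → ℝ) (i j : Fin d) :
    Measurable fun lam => β.modulationLatticeMatrix q lam i j := by
  simp only [modulationLatticeMatrix, Matrix.mul_diagonal]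
  exact (measurable_matrix_inv β.measurable_B_transpose_apply i j).mul_const _

theorem det_modulationLatticeMatrix (q : Fin d → ℝ) (lam : Fin m → ℝ) :
    (β.modulationLatticeMatrix q lam).det = (β.B lam).det⁻¹ * ∏ i, q i := by
  rw [modulationLatticeMatrix, Matrix.det_mul, Matrix.det_nonsing_inv, Matrix.det_transpose,
    Ring.inverse_eq_inv', Matrix.det_diagonal]

theorem det_modulationLatticeMatrix_ne_zero (hq : ∀ i, 0 < q i) {lam : Fin m → ℝ}
    (hlam : lam ∈ β.crossSection) : (β.modulationLatticeMatrix q lam).det ≠ 0 := by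
  rw [det_modulationLatticeMatrix]
  exact mul_ne_zero (inv_ne_zero hlam) (Finset.prod_pos fun i _ => hq i).ne'

theorem eq_add_modulationLatticeMatrix_mulVec {lam : Fin m → ℝ} (hlam : lam ∈ β.crossSection)
    {t t' : Fin d → ℝ} {n : Fin d → ℤ}
    (h : (β.B lam)ᵀ *ᵥ t' = (β.B lam)ᵀ *ᵥ t + fun i => n i * q i) :
    t' = t + β.modulationLatticeMatrix q lam *ᵥ fun i => (n i : ℝ) := by
  have hdet : IsUnit ((β.B lam)ᵀ).det := by
    rw [Matrix.det_transpose]; exact hlam.isUnit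
  have hdiag : (Matrix.diagonal q *ᵥ fun i => (n i : ℝ)) = fun i => n i * q i := by
    funext i
    rw [Matrix.mulVec_diagonal, mul_comm]
  have hinv := congrArg (fun s => ((β.B lam)ᵀ)⁻¹ *ᵥ s) h
  simpa only [Matrix.mulVec_add, Matrix.mulVec_mulVec, Matrix.nonsing_inv_mul _ hdet,
    Matrix.one_mulVec, ← hdiag, modulationLatticeMatrix] using hinv

theorem abs_det_diagonal_inv_le (hq : ∀ i, 0 < q i) (hb : ∀ i, 0 < b i) {lam : Fin m → ℝ}
    (hlam : lam ∈ β.crossSection) (hle : |(β.B lam).det| ≤ (∏ i, b i) * ∏ i, q i) :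
    |(Matrix.diagonal b⁻¹).det| ≤ |(β.modulationLatticeMatrix q lam).det| := by
  have hbpos : 0 < ∏ i, b i := Finset.prod_pos fun i _ => hb i
  have hqpos : 0 < ∏ i, q i := Finset.prod_pos fun i _ => hq i
  rw [det_diagonal_inv, det_modulationLatticeMatrix, abs_mul, abs_inv, abs_inv,
    abs_of_pos hbpos, abs_of_pos hqpos, inv_mul_eq_div, inv_eq_one_div,
    div_le_div_iff₀ hbpos (abs_pos.2 hlam), one_mul]
  linarith

/-- The density condition `|det B(lam)| ≤ ∏ b_j ∏ q_j` compares the covolumes of the lattice that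
has to tile and the lattice that has to pack. -/
theorem exists_isTilingWindow (hq : ∀ i, 0 < q i) (hb : ∀ i, 0 < b i)
    (hSc : S ⊆ β.crossSection) (hSle : ∀ lam ∈ S, |(β.B lam).det| ≤ (∏ i, b i) * ∏ i, q i) :
    ∃ v, β.IsTilingWindow S q b v := by
  obtain ⟨E, hE, hpack, hpack', htile⟩ := exists_measurable_tile
    (C := fun _ : Fin m → ℝ => Matrix.diagonal b⁻¹) (fun _ _ => measurable_const)
    (β.measurable_modulationLatticeMatrix q)
  have htileS (lam) (hlam : lam ∈ S) := htile lam (det_diagonal_inv_ne_zero hb)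
    (β.det_modulationLatticeMatrix_ne_zero hq (hSc hlam))
    (β.abs_det_diagonal_inv_le hq hb (hSc hlam) (hSle lam hlam))
  refine ⟨tileWindow b E, ⟨stronglyMeasurable_const.indicator hE,
    fun lam hlam => lintegral_enorm_sq_tileWindow hb hE (htileS lam hlam),
    _, fun w => norm_indicator_le_norm_self _ _⟩, fun lam hlam t t' n ht ht' htt' => ?_,
    fun lam hlam => ae_tsum_enorm_sq_tileWindow hb (htileS lam hlam) (hpack lam)⟩
  exact (hpack' lam).eq_zero_of_mulVec (β.det_modulationLatticeMatrix_ne_zero hq (hSc hlam))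
    (mem_of_tileWindow_ne_zero ht) (mem_of_tileWindow_ne_zero ht')
    (β.eq_add_modulationLatticeMatrix_mulVec (hSc hlam) htt')

theorem plancherelMeasure_lt_top (hS : MeasurableSet S) (hSa : S ⊆ Set.Icc 0 a) {r : ℝ}
    (hSle : ∀ lam ∈ S, |(β.B lam).det| ≤ r) : β.plancherelMeasure S < ∞ := by
  rw [plancherelMeasure, withDensity_apply _ hS]
  calc ∫⁻ lam in S, ENNReal.ofReal |(β.B lam).det|
      ≤ ∫⁻ _ in S, ENNReal.ofReal r :=
        setLIntegral_mono' hS fun lam h => ENNReal.ofReal_le_ofReal (hSle lam h)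
    _ = ENNReal.ofReal r * volume S := setLIntegral_const _ _
    _ < ∞ := ENNReal.mul_lt_top ENNReal.ofReal_lt_top
        ((measure_mono hSa).trans_lt isCompact_Icc.measure_lt_top)

/-- The parametrization of the quasi-lattice by the integer coordinates, in the order `(x, (z, y))`
of `groupCoord`. -/
noncomputable def quasiLatticeEquiv (ha : ∀ j, 0 < a j) (hq : ∀ j, 0 < q j)
    (hb : ∀ j, 0 < b j) :
    (Fin d → ℤ) × ((Fin m → ℤ) × (Fin d → ℤ)) ≃ β.quasiLattice a q b :=
  Equiv.ofBijective
    (fun n => ⟨N.mk (fun j => n.2.1 j / a j) (fun j => n.2.2 j / q j) (fun j => n.1 j / b j),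
      n.2.1, n.2.2, n.1, rfl⟩) <| by
    constructor
    · intro n n' h
      have hval := congrArg Subtype.val h
      exact Prod.ext (intCast_div_injective hb (congrArg N.xc hval))
        (Prod.ext (intCast_div_injective ha (congrArg N.zc hval))
          (intCast_div_injective hq (congrArg N.yc hval)))
    · rintro ⟨g, k, l, p, rfl⟩
      exact ⟨(p, (k, l)), rfl⟩

theorem groupCoordInv_quasiLatticeEquiv (ha : ∀ j, 0 < a j) (hq : ∀ j, 0 < q j)
    (hb : ∀ j, 0 < b j) (n : (Fin d → ℤ) × ((Fin m → ℤ) × (Fin d → ℤ))) :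
    β.groupCoordInv (β.quasiLatticeEquiv ha hq hb n) =
      (fun j => n.1 j / b j, (fun j => n.2.1 j / a j, fun j => n.2.2 j / q j)) :=
  rfl

end AdaptedBasis

theorem exists_stronglyMeasurable_ae_eq_prodMk {α T : Type*} [MeasurableSpace α]
    [MeasurableSpace T] [MeasurableSpace.CountablyGenerated T] {μ : Measure α} {ν : Measure T}
    [SFinite μ] [SFinite ν] {u : α → Lp ℂ 2 ν} (hu : MemLp u 2 μ) :
    ∃ U : α × T → ℂ, StronglyMeasurable U ∧ ∀ᵐ a ∂μ, (fun t => U (a, t)) =ᵐ[ν] u a := by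
  refine ⟨(curryEquiv (μ := μ) (ν := ν)).symm hu.toLp, Lp.stronglyMeasurable _, ?_⟩
  filter_upwards [ae_coeFn_curryEquiv ((curryEquiv (μ := μ) (ν := ν)).symm hu.toLp),
    hu.coeFn_toLp] with a hcurry ha
  rwa [LinearIsometryEquiv.apply_symm_apply, ha] at hcurry

namespace AdaptedBasis

variable {𝔫 : Type*} [LieRing 𝔫] [LieAlgebra ℝ 𝔫] {m d : ℕ} (β : AdaptedBasis 𝔫 m d)
  {S : Set (Fin m → ℝ)} {U v : (Fin m → ℝ) × (Fin d → ℝ) → ℂ} {a : Fin m → ℝ} {q b : Fin d → ℝ}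

theorem exists_joint_unitField (hS : MeasurableSet S) (hSf : β.plancherelMeasure S < ∞)
    {u : (Fin m → ℝ) → L2R d} (hu : StronglyMeasurable u) (hu1 : ∀ lam ∈ S, ‖u lam‖ = 1) :
    ∃ U : (Fin m → ℝ) × (Fin d → ℝ) → ℂ, StronglyMeasurable U ∧
      (∀ᵐ lam ∂β.plancherelMeasure.restrict S, ∫⁻ s, ‖U (lam, s)‖ₑ ^ 2 = 1) ∧
      ∀ᵐ lam ∂β.plancherelMeasure.restrict S, (fun s => U (lam, s)) =ᵐ[volume] u lam := by
  have : IsFiniteMeasure (β.plancherelMeasure.restrict S) := isFiniteMeasure_restrict.2 hSf.ne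
  have hmem : MemLp u 2 (β.plancherelMeasure.restrict S) :=
    .of_bound hu.aestronglyMeasurable 1 <| by
      filter_upwards [ae_restrict_mem hS] with lam hlam using (hu1 lam hlam).le
  obtain ⟨U, hU, hUu⟩ := exists_stronglyMeasurable_ae_eq_prodMk hmem
  refine ⟨U, hU, ?_, hUu⟩
  filter_upwards [hUu, ae_restrict_mem hS] with lam hlam hlamS
  calc ∫⁻ s, ‖U (lam, s)‖ₑ ^ 2 = ∫⁻ s, ‖u lam s‖ₑ ^ 2 :=
        lintegral_congr_ae (hlam.fun_comp (‖·‖ₑ ^ 2))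
    _ = 1 := by
        rw [lintegral_enorm_sq_coeFn, enorm_eq_one_of_norm_eq_one (hu1 lam hlamS), one_pow]

theorem measurableSet_abs_det_div_le_one {I : Set (Fin m → ℝ)} (hI : MeasurableSet I) (r : ℝ) :
    MeasurableSet {lam ∈ I | |(β.B lam).det| / r ≤ 1} :=
  hI.inter (measurableSet_le (β.continuous_det_B.abs.measurable.div_const _) measurable_const)

variable (hS : MeasurableSet S) (hU : StronglyMeasurable U)
  (hU1 : ∀ᵐ lam ∂β.plancherelMeasure.restrict S, ∫⁻ s, ‖U (lam, s)‖ₑ ^ 2 = 1)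

/-- The multiplicity-free band-limited space with spectrum `S` and unit field `U`. -/
noncomputable def bandLimitedSpace : Submodule ℂ β.L2N :=
  LinearMap.range (β.bandLimited hS hU hU1).toLinearMap

theorem bandLimited_mem (V : Lp ℂ 2 (β.bandMeasure S)) :
    β.bandLimited hS hU hU1 V ∈ β.bandLimitedSpace hS hU hU1 :=
  ⟨V, rfl⟩

theorem eq_bandLimitedSpace {u : (Fin m → ℝ) → L2R d}
    (hUu : ∀ᵐ lam ∂β.plancherelMeasure.restrict S, (fun s => U (lam, s)) =ᵐ[volume] u lam)
    {H : Submodule ℂ β.L2N} (hH : ∀ f : β.L2N, f ∈ H ↔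
      ∃ K : β.HSField, β.IsPlancherelTransform f K ∧ β.MemMultiplicityFree S u K) :
    H = β.bandLimitedSpace hS hU hU1 :=
  Submodule.ext fun f => (hH f).trans (β.mem_range_bandLimited_iff hS hU hU1 hUu f).symm

instance completeSpace_bandLimitedSpace : CompleteSpace (β.bandLimitedSpace hS hU hU1) :=
  (β.bandLimited hS hU hU1).isometry.isUniformInducing.isComplete_range.completeSpace_coe

variable (hSf : β.plancherelMeasure S < ∞) (hv : IsBoundedUnitField S v)
  {V₀ : Lp ℂ 2 (β.bandMeasure S)} (hV₀ : V₀ =ᵐ[β.bandMeasure S] v)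

include hv hV₀ in
theorem norm_bandLimited_eq_one (hμ : β.plancherelMeasure S = 1) :
    ‖β.bandLimited hS hU hU1 V₀‖ = 1 := by
  rw [LinearIsometry.norm_map, ← norm_one (α := ℂ)]
  refine norm_eq_of_enorm_sq_eq ?_
  calc ‖V₀‖ₑ ^ 2 = ∫⁻ w, ‖V₀ w‖ₑ ^ 2 ∂β.bandMeasure S := (lintegral_enorm_sq_coeFn _).symm
    _ = ∫⁻ w, ‖v w‖ₑ ^ 2 ∂β.bandMeasure S := lintegral_congr_ae (hV₀.fun_comp (‖·‖ₑ ^ 2))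
    _ = ‖(1 : ℂ)‖ₑ ^ 2 := by
        simpa only [sub_zero, hμ, enorm_one, one_pow] using β.lintegral_enorm_sq_unitField hS hv 0

include hSf hv hV₀

theorem leftReg_bandLimited_mem (g : β.N) :
    β.leftReg g (β.bandLimited hS hU hU1 V₀) ∈ β.bandLimitedSpace hS hU hU1 := by
  rw [β.leftReg_bandLimited hS hU hU1 hSf hv hV₀]
  exact β.bandLimited_mem hS hU hU1 _

theorem enorm_inner_leftReg_bandLimited (g : β.N) (V : Lp ℂ 2 (β.bandMeasure S)) :
    ‖(inner ℂ (β.leftReg g (β.bandLimited hS hU hU1 V₀)) (β.bandLimited hS hU hU1 V) : ℂ)‖ₑ =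
      ‖sliceFourier (β.windowed S v V) (β.groupCoordInv g)‖ₑ := by
  rw [β.inner_leftReg_bandLimited hS hU hU1 hSf hv hV₀, RCLike.enorm_conj]

theorem aestronglyMeasurable_inner_leftReg_bandLimited (V : Lp ℂ 2 (β.bandMeasure S)) :
    AEStronglyMeasurable fun g : β.N =>
      (inner ℂ (β.leftReg g (β.bandLimited hS hU hU1 V₀)) (β.bandLimited hS hU hU1 V) : ℂ) := by
  simp only [β.inner_leftReg_bandLimited hS hU hU1 hSf hv hV₀]
  exact (Complex.continuous_conj.comp_stronglyMeasurable
    ((stronglyMeasurable_sliceFourier (β.stronglyMeasurable_windowed hS hv.stronglyMeasurable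
      (Lp.stronglyMeasurable V))).comp_measurable
      β.measurable_groupCoordInv)).aestronglyMeasurable

theorem lintegral_enorm_sq_inner_leftReg_bandLimited (V : Lp ℂ 2 (β.bandMeasure S)) :
    ∫⁻ g : β.N, ‖(inner ℂ (β.leftReg g (β.bandLimited hS hU hU1 V₀))
        (β.bandLimited hS hU hU1 V) : ℂ)‖ₑ ^ 2 = ‖β.bandLimited hS hU hU1 V‖ₑ ^ 2 := by
  simp only [β.enorm_inner_leftReg_bandLimited hS hU hU1 hSf hv hV₀]
  rw [β.lintegral_enorm_sq_sliceFourier_windowed hS hSf hv (Lp.stronglyMeasurable V) (Lp.memLp V),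
    lintegral_enorm_sq_coeFn, LinearIsometry.enorm_map]

theorem isContinuousWavelet_bandLimited :
    β.IsContinuousWavelet (β.bandLimitedSpace hS hU hU1) (β.bandLimited hS hU hU1 V₀) := by
  have hmem := β.leftReg_bandLimited_mem hS hU hU1 hSf hv hV₀
  obtain ⟨W, hW⟩ := exists_linearIsometry_Lp (μ := (volume : Measure β.N))
    (e := fun g => (⟨_, hmem g⟩ : β.bandLimitedSpace hS hU hU1)) (by
      rintro ⟨_, V, rfl⟩
      exact β.aestronglyMeasurable_inner_leftReg_bandLimited hS hU hU1 hSf hv hV₀ V) (by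
      rintro ⟨_, V, rfl⟩
      exact β.lintegral_enorm_sq_inner_leftReg_bandLimited hS hU hU1 hSf hv hV₀ V)
  exact ⟨β.bandLimited_mem hS hU hU1 V₀, W, hW⟩

omit hv
variable (hvt : β.IsTilingWindow S q b v) (ha : ∀ j, 0 < a j) (hq : ∀ j, 0 < q j)
  (hb : ∀ j, 0 < b j) (hbqa : (∏ j, b j) * (∏ j, q j) * ∏ j, a j = 1)
  (hSc : S ⊆ β.crossSection) (hSa : S ⊆ Set.Icc 0 a)

include hvt ha hq hb hbqa hSc hSa

theorem tsum_enorm_sq_inner_leftReg_bandLimited (V : Lp ℂ 2 (β.bandMeasure S)) :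
    ∑' γ : β.quasiLattice a q b, ‖(inner ℂ (β.leftReg γ (β.bandLimited hS hU hU1 V₀))
        (β.bandLimited hS hU hU1 V) : ℂ)‖ₑ ^ 2 = ‖β.bandLimited hS hU hU1 V‖ₑ ^ 2 := by
  have hconst : ((∏ i, a i) * ∏ j, q j) * ∏ j, b j = 1 := by rw [← hbqa]; ring
  have hpos : 0 ≤ (∏ i, a i) * ∏ j, q j :=
    mul_nonneg (Finset.prod_nonneg fun i _ => (ha i).le) (Finset.prod_nonneg fun j _ => (hq j).le)
  simp only [β.enorm_inner_leftReg_bandLimited hS hU hU1 hSf hvt.toIsBoundedUnitField hV₀]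
  rw [← (β.quasiLatticeEquiv ha hq hb).tsum_eq, ENNReal.tsum_prod']
  simp only [groupCoordInv_quasiLatticeEquiv]
  rw [β.tsum_enorm_sq_sliceFourier_windowed ha hq hS hSf hSc hSa hvt (Lp.stronglyMeasurable V)
      (Lp.memLp V), ← mul_assoc, ← ENNReal.ofReal_mul hpos, hconst, ENNReal.ofReal_one, one_mul,
    lintegral_enorm_sq_coeFn, LinearIsometry.enorm_map]

theorem exists_linearIsometry_lp_quasiLattice :
    ∃ D : β.bandLimitedSpace hS hU hU1 →ₗᵢ[ℂ] lp (fun _ : β.quasiLattice a q b => ℂ) 2,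
      ∀ ψ γ, D ψ γ = inner ℂ (β.leftReg γ (β.bandLimited hS hU hU1 V₀)) (ψ : β.L2N) :=
  exists_linearIsometry_lp
    (e := fun γ : β.quasiLattice a q b =>
      (⟨_, β.leftReg_bandLimited_mem hS hU hU1 hSf hvt.toIsBoundedUnitField hV₀ γ⟩ :
        β.bandLimitedSpace hS hU hU1)) <| by
    rintro ⟨_, V, rfl⟩
    exact β.tsum_enorm_sq_inner_leftReg_bandLimited hS hU hU1 hSf hV₀ hvt ha hq hb hbqa hSc hSa V

theorem exists_hilbertBasis_quasiLattice (hμ : β.plancherelMeasure S = 1) :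
    ∃ e : HilbertBasis (β.quasiLattice a q b) ℂ (β.bandLimitedSpace hS hU hU1),
      ∀ γ, (e γ : β.L2N) = β.leftReg γ (β.bandLimited hS hU hU1 V₀) := by
  obtain ⟨e, he⟩ := exists_hilbertBasis_of_parseval
    (e := fun γ : β.quasiLattice a q b =>
      (⟨_, β.leftReg_bandLimited_mem hS hU hU1 hSf hvt.toIsBoundedUnitField hV₀ γ⟩ :
        β.bandLimitedSpace hS hU hU1)) (by
      rintro ⟨_, V, rfl⟩
      exact β.tsum_enorm_sq_inner_leftReg_bandLimited hS hU hU1 hSf hV₀ hvt ha hq hb hbqa hSc hSa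
        V) fun γ => ((β.leftReg γ).norm_map _).trans
          (β.norm_bandLimited_eq_one hS hU hU1 hvt.toIsBoundedUnitField hV₀ hμ)
  exact ⟨e, fun γ => congrArg Subtype.val (he γ)⟩

end AdaptedBasis

end BandLimited

theorem mainTheorem4 {𝔫 : Type*} [LieRing 𝔫] [LieAlgebra ℝ 𝔫] {m d : ℕ} (hd : 0 < d)
    (β : AdaptedBasis 𝔫 m d)
    (a : Fin m → ℝ) (q b : Fin d → ℝ)
    (ha : ∀ j, 0 < a j) (hq : ∀ j, 0 < q j) (hb : ∀ j, 0 < b j)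
    (I S : Set (Fin m → ℝ)) (hI : MeasurableSet I)
    (hI_sub : I ⊆ {lam ∈ β.crossSection | ∀ j, 0 ≤ lam j ∧ lam j ≤ a j})
    (hS : S = {lam ∈ I | |(β.B lam).det| / ((∏ j, b j) * ∏ j, q j) ≤ 1})
    (hbqa : (∏ j, b j) * (∏ j, q j) * ∏ j, a j = 1)
    (u : (Fin m → ℝ) → L2R d) (hu : MeasureTheory.StronglyMeasurable u)
    (hu_norm : ∀ lam ∈ S, ‖u lam‖ = 1)
    (H : Submodule ℂ β.L2N)
    (hH : ∀ f : β.L2N, f ∈ H ↔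
      ∃ K : β.HSField, β.IsPlancherelTransform f K ∧ β.MemMultiplicityFree S u K) :
    ∃ φ : β.L2N, β.IsContinuousWavelet H φ ∧
      (∃ D : H →ₗᵢ[ℂ] lp (fun _ : β.quasiLattice a q b => ℂ) 2,
        ∀ (ψ : H) (γ : β.quasiLattice a q b),
          D ψ γ = inner ℂ (β.leftReg γ φ) (ψ : β.L2N)) ∧
      (β.plancherelMeasure S = 1 →
        ∃ e : HilbertBasis (β.quasiLattice a q b) ℂ H,
          ∀ γ : β.quasiLattice a q b, (e γ : β.L2N) = β.leftReg γ φ) := by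
  have hr : 0 < (∏ j, b j) * ∏ j, q j :=
    mul_pos (Finset.prod_pos fun j _ => hb j) (Finset.prod_pos fun j _ => hq j)
  have hSI {lam} (hlam : lam ∈ S) : lam ∈ I ∧ |(β.B lam).det| / ((∏ j, b j) * ∏ j, q j) ≤ 1 := by
    rwa [hS] at hlam
  have hSm : MeasurableSet S := hS ▸ β.measurableSet_abs_det_div_le_one hI _
  have hSc : S ⊆ β.crossSection := fun lam hlam => (hI_sub (hSI hlam).1).1
  have hSa : S ⊆ Set.Icc 0 a := fun lam hlam =>
    ⟨fun j => ((hI_sub (hSI hlam).1).2 j).1, fun j => ((hI_sub (hSI hlam).1).2 j).2⟩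
  have hSle : ∀ lam ∈ S, |(β.B lam).det| ≤ (∏ j, b j) * ∏ j, q j := fun lam hlam =>
    (div_le_one hr).1 (hSI hlam).2
  have hSf : β.plancherelMeasure S < ∞ := β.plancherelMeasure_lt_top hSm hSa hSle
  obtain ⟨U, hU, hU1, hUu⟩ := β.exists_joint_unitField hSm hSf hu hu_norm
  obtain rfl := β.eq_bandLimitedSpace hSm hU hU1 hUu hH
  obtain ⟨v, hv⟩ := β.exists_isTilingWindow hq hb hSc hSle
  have hvL : MemLp v 2 (β.bandMeasure S) := by
    simpa only [sub_zero, Prod.mk.eta] using β.memLp_unitField hSm hSf hv.toIsBoundedUnitField 0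
  exact ⟨β.bandLimited hSm hU hU1 hvL.toLp,
    β.isContinuousWavelet_bandLimited hSm hU hU1 hSf hv.toIsBoundedUnitField hvL.coeFn_toLp,
    β.exists_linearIsometry_lp_quasiLattice hSm hU hU1 hSf hvL.coeFn_toLp hv ha hq hb hbqa hSc hSa,
    β.exists_hilbertBasis_quasiLattice hSm hU hU1 hSf hvL.coeFn_toLp hv ha hq hb hbqa hSc hSa⟩
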